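/- **Setting.** Consider a two-player zero-sum Markov game with finite state space $\mathcal S$, finite action spaces $\mathcal A_1,\mathcal A_2$, horizon $T$, initial distribution $P_I$, transition probabilities $P_T$, reward distributions $P_R(\cdot\mid s,a^1,a^2)$ with mean $R$, and discount factor $\gamma\in[0,1]$. Let $\Omega_i$ be the set of all Markov policies $\pi_i=(\pi_{i,t})_{t\le T}$ of player $i$, write $\pi=(\pi_1,\pi_2)$, $\pi_t(a\mid s)=\pi_{1,t}(a^1\mid s)\pi_{2,t}(a^2\mid s)$ for $a=(a^1,a^2)$, and let $v_1(\pi)=\mathbb E_\pi[\sum_{t=1}^T\gamma^{t-1}r_t]$, $v_2=-v_1$. Let $V_{1,t},Q_{1,t}$ be the value functions of player 1 and $p^\pi_t(s,a)$ the marginal state-action distribution under $\pi$. The data are $n$ i.i.d. trajectories $(s_1,a_1,r_1,\dots,s_T,a_T,r_T,s_{T+1})$ sampled with a behavior profile $\pi^b$; put $p_{b,t}=p^{\pi^b}_t$ and $\mu_t=p^\pi_t/p_{b,t}$, $\mu_0=1$. Let $\Pi_i\subset\Omega_i$ be policy classes and $\Pi=\Pi_1\times\Pi_2$. For a class $\Pi$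 define $$v^{\exp}_\Pi(\pi)=\max_{\pi_1'\in\Pi_1}v_1(\pi_1',\pi_2)+\max_{\pi_2'\in\Pi_2}v_2(\pi_1,\pi_2'),$$ and let $v^{\exp}$ be the same quantity with $\Omega_1,\Omega_2$ in place of $\Pi_1,\Pi_2$. **Estimators.** Split the indices $1,\dots,n$, independently of the data, into $K$ folds of equal size (up to one index). For each fold $k$, an estimated game $(\hat R^{-k},\hat P_I^{-k},\hat P_T^{-k})$ and an estimate $\hat p_{b,t}^{-k}$ of $p_{b,t}$ are computed measurably from the data outside fold $k$. For a profile $\pi$, $\hat Q_{1,t}^{-k},\hat V_{1,t}^{-k}$ are the value functions of $\pi$ in the estimated game, and $\hat\mu_t^{-k}=\hat p_t^{\pi,-k}/\hat p_{b,t}^{-k}$ with $\hat p^{\pi,-k}_t$ the marginal distribution of $\pi$ in the estimated game, $\hat\mu_0^{-k}=1$. With $k(i)$ the fold of index $i$, the DRL value estimator is $$\hat v_1^{\mathrm{DRL}}(\pi)=\frac1n\sum_{i=1}^n\sum_{t=1}^T\gamma^{t-1}\Big(\hat\mu_t^{-k(i)}\big(r_{i,t}-\hat Q_{1,t}^{-k(i)}\big)+\hat\mu_{t-1}^{-k(i)}\hat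 V_{1,t}^{-k(i)}\Big),\qquad \hat v_2^{\mathrm{DRL}}=-\hat v_1^{\mathrm{DRL}},$$ where the functions are evaluated along the $i$-th trajectory, and $\hat v^{\exp}_{\mathrm{DRL}}(\pi)=\max_{\pi_1'\in\Pi_1}\hat v^{\mathrm{DRL}}_1(\pi_1',\pi_2)+\max_{\pi_2'\in\Pi_2}\hat v_2^{\mathrm{DRL}}(\pi_1,\pi_2')$. Let $\hat\pi^{\mathrm{DRL}}$ minimize $\hat v^{\exp}_{\mathrm{DRL}}$ over $\Pi$ and let $\pi^*$ minimize $v^{\exp}_\Pi$ over $\Pi$. **Covering numbers.** For $m$ state trajectories $(s_{i,1},\dots,s_{i,T})$, $i\le m$, let $H_m(\pi,\pi')$ be the fraction of those $i$ for which $\pi_{j,t}(\cdot\mid s_{i,t})\ne\pi'_{j,t}(\cdot\mid s_{i,t})$ for some $t\le T$ and some $j\in\{1,2\}$. Let $N_H(\epsilon,\Pi)$ be the supremum, over all $m\ge1$ and all families of $m$ state trajectories, of the least number of elements of $\Pi$ that $\epsilon$-cover $\Pi$ in $H_m$, and put $\kappa(\Pi)=\int_0^\infty\sqrt{\log N_H(\epsilon^2,\Pi)}\,d\epsilon$.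 **Assumptions.** There are constants $C_0,R_{\max}$, $D_1,D_2>0$, $0\le\omega<1/2$ and $\alpha_1,\alpha_2>0$ with $\alpha_1+\alpha_2\ge1/2$ such that: 1. $\pi_t(a\mid s)\le C_0\,\pi^b_t(a\mid s)$ for all $\pi\in\Pi$ and all $t,s,a$; and $|r|\le R_{\max}$ almost surely under every $P_R(\cdot\mid s,a)$. 2. Almost surely, $0\le\hat\mu_t^{-k}\le C_0^t$ and $|\hat Q_{1,t}^{-k}|\le(T+1-t)R_{\max}$ for all $\pi\in\Pi$, all $k$, all $t\le T$, and all arguments $(s,a)$ with $p_{b,t}(s,a)>0$. 3. $N_H(\epsilon,\Pi)\le D_1\exp(D_2\epsilon^{-\omega})$ for $0<\epsilon<1$. 4. For all $k$, all $1\le t\le t'\le T$ and every sequence $(s_t,a_t,\dots,s_{t'},a_{t'})$ with $p_{b,t}(s_t,a_t)>0$ and $\pi^b_l(a_l\mid s_l)>0$ for $t<l\le t'$, $$\mathbb E\Big[\Big(\hat R^{-k}(s_{t'},a_{t'})\prod_{l=t}^{t'-1}\hat P_T^{-k}(s_{l+1}\mid s_l,a_l)-R(s_{t'},a_{t'})\prod_{l=t}^{t'-1}P_T(s_{l+1}\mid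 s_l,a_l)\Big)^2\Big]=o(n^{-2\alpha_1}).$$ 5. For all $k$, all $1\le t\le T$ and every sequence $(s_1,a_1,\dots,s_t,a_t)$ with $p_{b,t}(s_t,a_t)>0$ and $\pi^b_l(a_l\mid s_l)>0$ for $l<t$, $$\mathbb E\Big[\Big(\frac{\hat P_I^{-k}(s_1)\prod_{l=2}^{t}\hat P_T^{-k}(s_l\mid s_{l-1},a_{l-1})}{\hat p_{b,t}^{-k}(s_t,a_t)}-\frac{P_I(s_1)\prod_{l=2}^{t}P_T(s_l\mid s_{l-1},a_{l-1})}{p_{b,t}(s_t,a_t)}\Big)^2\Big]=o(n^{-2\alpha_2}).$$ **Claim.** There is $C>0$ such that for every $\delta>0$ there is $N_\delta>0$ such that for every $n\ge N_\delta$, with probability at least $1-2\delta$, $$v^{\exp}_\Pi(\hat\pi^{\mathrm{DRL}})-v^{\exp}_\Pi(\pi^*)\le C\big(\kappa(\Pi)+\sqrt{\log(1/\delta)}\big)\sqrt{\Upsilon^*_{\mathrm{DRL}}/n},$$ where $\Upsilon^*_{\mathrm{DRL}}=\sup_{\pi\in\Pi}\mathbb E\big[\big(\sum_{t=1}^T\gamma^{t-1}(\mu_t(r_t-Q_{1,t})+\mu_{t-1}V_{1,t})\big)^2\big]$,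 the expectation being over a trajectory sampled with $\pi^b$ (and $\sqrt{\log(1/\delta)}$ is read as $0$ for $\delta>1$, where the claim is void). If, moreover, every policy in $\Pi_1$ or $\Pi_2$ has a best response among all Markov policies of the opponent that lies in the opponent's class, then the same bound holds, with the same $C$ and $N_\delta$, for $v^{\exp}(\hat\pi^{\mathrm{DRL}})-v^{\exp}(\pi^*)$. -/

import Mathlib

open MeasureTheory ProbabilityTheory Filter Topology

noncomputable section

namespace MarkovGame

/-- A two-player zero-sum Markov game with state space `S` and action spaces `A₁`, `A₂`:
initial state distribution, transition probabilities, reward distributions, discount factor.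
The horizon is a separate parameter `T`. The reward of player 2 is minus that of player 1. -/
structure Game (S A₁ A₂ : Type*) [Fintype S] where
  PI : S → ℝ
  PI_nonneg : ∀ s, 0 ≤ PI s
  PI_sum : ∑ s, PI s = 1
  PT : S → A₁ → A₂ → S → ℝ
  PT_nonneg : ∀ s a b s', 0 ≤ PT s a b s'
  PT_sum : ∀ s a b, ∑ s', PT s a b s' = 1
  PR : S → A₁ → A₂ → Measure ℝ
  PR_prob : ∀ s a b, IsProbabilityMeasure (PR s a b)
  γ : ℝ
  γ_nonneg : 0 ≤ γ
  γ_le_one : γ ≤ 1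

/-- A Markov policy over `T` steps (steps are numbered `0, …, T - 1`). The type of all of them is
the whole policy set of a player. -/
@[ext]
structure Policy (T : ℕ) (S A : Type*) [Fintype A] where
  prob : Fin T → S → A → ℝ
  nonneg : ∀ t s a, 0 ≤ prob t s a
  sum_one : ∀ t s, ∑ a, prob t s a = 1

/-- The action probabilities of a policy at a step given as a natural number
(zero beyond the horizon). -/
def Policy.p {T : ℕ} {S A : Type*} [Fintype A] (π : Policy T S A) (t : ℕ) (s : S) (a : A) : ℝ :=
  if h : t < T then π.prob ⟨t, h⟩ s a else 0

/-- A policy profile. -/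
abbrev Profile (T : ℕ) (S A₁ A₂ : Type*) [Fintype A₁] [Fintype A₂] :=
  Policy T S A₁ × Policy T S A₂

/-- The joint probability of an action pair under a policy profile. -/
def Profile.p {T : ℕ} {S A₁ A₂ : Type*} [Fintype A₁] [Fintype A₂] (π : Profile T S A₁ A₂)
    (t : ℕ) (s : S) (a : A₁) (b : A₂) : ℝ :=
  π.1.p t s a * π.2.p t s b

/-- A trajectory `(s_1, …, s_{T+1}), (a¹_1, …, a¹_T), (a²_1, …, a²_T), (r_1, …, r_T)`. -/
abbrev Traj (T : ℕ) (S A₁ A₂ : Type*) :=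
  (Fin (T + 1) → S) × (Fin T → A₁) × (Fin T → A₂) × (Fin T → ℝ)

/-- State transition data together with a mean reward function; used both for the true
game and for estimated games (the entries of the latter need not be normalized). -/
structure Model (S A₁ A₂ : Type*) where
  R : S → A₁ → A₂ → ℝ
  PI : S → ℝ
  PT : S → A₁ → A₂ → S → ℝ

/-- An estimate of the game together with an estimate `pb` of the marginal state-action
distributions under the behavior policy profile. -/
structure Estimate (T : ℕ) (S A₁ A₂ : Type*) extends Model S A₁ A₂ where
  pb : Fin T → S → A₁ → A₂ → ℝ

section

variable {T : ℕ} {S A₁ A₂ : Type*} [Fintype S] [Fintype A₁] [Fintype A₂]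

/-- The true mean rewards, initial distribution and transition probabilities of the game. -/
def Game.toModel (G : Game S A₁ A₂) : Model S A₁ A₂ where
  R := fun s a b => ∫ r, r ∂(G.PR s a b)
  PI := G.PI
  PT := G.PT

/-- The law of a trajectory when the profile `π` is played:
`P_I(s_1) ∏_t π_{1,t}(a¹_t|s_t) π_{2,t}(a²_t|s_t) P_R(r_t|s_t,a¹_t,a²_t) P_T(s_{t+1}|s_t,a¹_t,a²_t)`. -/
def Game.trajLaw [MeasurableSpace S] [MeasurableSpace A₁] [MeasurableSpace A₂]
    (G : Game S A₁ A₂) (π : Profile T S A₁ A₂) : Measure (Traj T S A₁ A₂) :=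
  ∑ s : Fin (T + 1) → S, ∑ a : Fin T → A₁, ∑ b : Fin T → A₂,
    ENNReal.ofReal (G.PI (s 0) * ∏ t : Fin T,
      (π.p t (s t.castSucc) (a t) (b t) * G.PT (s t.castSucc) (a t) (b t) (s t.succ))) •
    (Measure.pi fun t : Fin T => G.PR (s t.castSucc) (a t) (b t)).map fun r => (s, a, b, r)

/-- The `T`-step discounted value of player 1 (that of player 2 is its negative). -/
def Game.value [MeasurableSpace S] [MeasurableSpace A₁] [MeasurableSpace A₂]
    (G : Game S A₁ A₂) (π : Profile T S A₁ A₂) : ℝ :=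
  ∫ τ, ∑ t : Fin T, G.γ ^ (t : ℕ) * τ.2.2.2 t ∂(G.trajLaw π)

/-- The state marginal at step `t` under `π`, in the model `M`. -/
def Model.stateOcc (M : Model S A₁ A₂) (π : Profile T S A₁ A₂) : ℕ → S → ℝ
  | 0 => M.PI
  | t + 1 => fun s' => ∑ s, ∑ a, ∑ b,
      M.PT s a b s' * (π.p t s a b * M.stateOcc π t s)

/-- The marginal state-action distribution `p^π_t(s, a¹, a²)`, in the model `M`. -/
def Model.occ (M : Model S A₁ A₂) (π : Profile T S A₁ A₂) (t : ℕ) (s : S) (a : A₁) (b : A₂) : ℝ :=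
  π.p t s a b * M.stateOcc π t s

/-- Player 1's state value function with `k` steps to go, in the model `M`
(Bellman recursion). -/
def Model.valueToGo (M : Model S A₁ A₂) (γ : ℝ) (π : Profile T S A₁ A₂) : ℕ → S → ℝ
  | 0 => fun _ => 0
  | k + 1 => fun s => ∑ a, ∑ b, π.p (T - (k + 1)) s a b *
      (M.R s a b + γ * ∑ s', M.PT s a b s' * M.valueToGo γ π k s')

/-- The state value function `V_{1,t}`, in the model `M`. -/
def Model.V (M : Model S A₁ A₂) (γ : ℝ) (π : Profile T S A₁ A₂) (t : ℕ) (s : S) : ℝ :=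
  M.valueToGo γ π (T - t) s

/-- The state-action value function `Q_{1,t}`, in the model `M`. -/
def Model.Q (M : Model S A₁ A₂) (γ : ℝ) (π : Profile T S A₁ A₂)
    (t : ℕ) (s : S) (a : A₁) (b : A₂) : ℝ :=
  M.R s a b + γ * ∑ s', M.PT s a b s' * M.V γ π (t + 1) s'

/-- `∑_t γ^{t-1} (μ_t (r_t - Q_t) + μ_{t-1} V_t)` along a trajectory, with `μ_0 = 1` in the
one-based numbering of steps, where `μ_t` is evaluated at `(s_t, a¹_t, a²_t)` and the value functions
`Q`, `V` of `π` are computed in the model `M`. -/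
def drlScore (M : Model S A₁ A₂) (γ : ℝ) (π : Profile T S A₁ A₂)
    (μ : Fin T → S → A₁ → A₂ → ℝ) (τ : Traj T S A₁ A₂) : ℝ :=
  ∑ t : Fin T, γ ^ (t : ℕ) *
    (μ t (τ.1 t.castSucc) (τ.2.1 t) (τ.2.2.1 t) *
        (τ.2.2.2 t - M.Q γ π t (τ.1 t.castSucc) (τ.2.1 t) (τ.2.2.1 t)) +
      (if (t : ℕ) = 0 then 1 else
        let u : Fin T := ⟨t - 1, lt_of_le_of_lt (Nat.sub_le _ _) t.isLt⟩
        μ u (τ.1 u.castSucc) (τ.2.1 u) (τ.2.2.1 u)) * M.V γ π t (τ.1 t.castSucc))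

/-- The true marginal density ratio `μ_t = p^π_t / p^{π^b}_t`. -/
def Game.ratio (G : Game S A₁ A₂) (πb π : Profile T S A₁ A₂)
    (t : Fin T) (s : S) (a : A₁) (b : A₂) : ℝ :=
  G.toModel.occ π t s a b / G.toModel.occ πb t s a b

/-- The estimated marginal density ratio: the numerator is computed in the estimated game. -/
def Estimate.ratio (E : Estimate T S A₁ A₂) (π : Profile T S A₁ A₂)
    (t : Fin T) (s : S) (a : A₁) (b : A₂) : ℝ :=
  E.toModel.occ π t s a b / E.pb t s a b

/-- The initial-and-transition probability `P_I(s_1) ∏_{l=2}^{t} P_T(s_l | s_{l-1}, a_{l-1})` of a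
path up to step `t`, in the model `M`. -/
def Model.pathProb (M : Model S A₁ A₂) (t : Fin T) (s : Fin T → S) (a : Fin T → A₁)
    (b : Fin T → A₂) : ℝ :=
  M.PI (s ⟨0, t.pos⟩) * ∏ l : Fin T, if h : (l : ℕ) < t then
    M.PT (s l) (a l) (b l) (s ⟨l + 1, lt_of_le_of_lt h t.isLt⟩) else 1

/-- `R(s_{t'}, a_{t'}) ∏_{l=t}^{t'-1} P_T(s_{l+1} | s_l, a_l)` along a path, in the model `M`. -/
def Model.rewardPath (M : Model S A₁ A₂) (t t' : Fin T) (s : Fin T → S) (a : Fin T → A₁)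
    (b : Fin T → A₂) : ℝ :=
  M.R (s t') (a t') (b t') * ∏ l : Fin T, if h : t ≤ l ∧ (l : ℕ) < t' then
    M.PT (s l) (a l) (b l) (s ⟨l + 1, lt_of_le_of_lt h.2 t'.isLt⟩) else 1

/-- A cross-fitted estimation procedure: for every sample size `n`, partition `f` of the indices
into `K` folds, and fold `k`, it maps the trajectories outside fold `k` to an estimate. -/
abbrev Estimator (K T : ℕ) (S A₁ A₂ : Type*) :=
  (n : ℕ) → (f : Fin n → Fin K) → (k : Fin K) →
    ({i : Fin n // f i ≠ k} → Traj T S A₁ A₂) → Estimate T S A₁ A₂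

/-- All entries of the estimates are measurable functions of the data. -/
def Estimator.IsMeasurable {K : ℕ} [MeasurableSpace S] [MeasurableSpace A₁] [MeasurableSpace A₂]
    (est : Estimator K T S A₁ A₂) : Prop :=
  ∀ n f k,
    (∀ s a b, Measurable fun D => (est n f k D).R s a b) ∧
    (∀ s, Measurable fun D => (est n f k D).PI s) ∧
    (∀ s a b s', Measurable fun D => (est n f k D).PT s a b s') ∧
    (∀ t s a b, Measurable fun D => (est n f k D).pb t s a b)

/-- The estimate computed from the trajectories of the data set `D` outside fold `k`. -/
def Estimator.fit {K : ℕ} (est : Estimator K T S A₁ A₂) {n : ℕ} (f : Fin n → Fin K)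
    (D : Fin n → Traj T S A₁ A₂) (k : Fin K) : Estimate T S A₁ A₂ :=
  est n f k fun i => D i

/-- The cross-fitted double reinforcement learning estimator of player 1's value. -/
def Estimator.valueDRL {K : ℕ} (est : Estimator K T S A₁ A₂) (γ : ℝ) {n : ℕ} (f : Fin n → Fin K)
    (D : Fin n → Traj T S A₁ A₂) (π : Profile T S A₁ A₂) : ℝ :=
  (n : ℝ)⁻¹ * ∑ i : Fin n,
    drlScore (est.fit f D (f i)).toModel γ π ((est.fit f D (f i)).ratio π) (D i)

/-- All folds of a partition of `n` indices into `K` folds have the same size `n / K`, up to one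
index when `K` does not divide `n`. -/
def IsBalanced {n K : ℕ} (f : Fin n → Fin K) : Prop :=
  ∀ k, n / K ≤ Fintype.card {i // f i = k} ∧ Fintype.card {i // f i = k} ≤ (n + K - 1) / K

/-- For a value function `v` of player 1 (player 2 has `-v`):
`max_{π₁' ∈ C₁} v(π₁', π₂) + max_{π₂' ∈ C₂} (-v(π₁, π₂'))`. -/
def exploitability (v : Profile T S A₁ A₂ → ℝ) (C₁ : Set (Policy T S A₁)) (C₂ : Set (Policy T S A₂))
    (π : Profile T S A₁ A₂) : ℝ :=
  sSup ((fun π₁' => v (π₁', π.2)) '' C₁) + sSup ((fun π₂' => -v (π.1, π₂')) '' C₂)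

/-- `π` minimizes `F` over the profiles in `C₁ × C₂`. -/
def IsSelected (F : Profile T S A₁ A₂ → ℝ) (C₁ : Set (Policy T S A₁)) (C₂ : Set (Policy T S A₂))
    (π : Profile T S A₁ A₂) : Prop :=
  π ∈ C₁ ×ˢ C₂ ∧ ∀ π' ∈ C₁ ×ˢ C₂, F π ≤ F π'

/-- Every policy of either class has, among all Markov policies of the opponent, a best response
that belongs to the opponent's class. -/
def HasBestResponses (v : Profile T S A₁ A₂ → ℝ) (C₁ : Set (Policy T S A₁))
    (C₂ : Set (Policy T S A₂)) : Prop :=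
  (∀ π₂ ∈ C₂, ∃ π₁ ∈ C₁, ∀ π₁' : Policy T S A₁, v (π₁', π₂) ≤ v (π₁, π₂)) ∧
    (∀ π₁ ∈ C₁, ∃ π₂ ∈ C₂, ∀ π₂' : Policy T S A₂, v (π₁, π₂) ≤ v (π₁, π₂'))

open Classical in
/-- The Hamming distance of two profiles on `m` state trajectories: the fraction of the state
trajectories on which the action distributions of one of the players differ at some step. -/
def hamming {m : ℕ} (σ : Fin m → Fin T → S) (π π' : Profile T S A₁ A₂) : ℝ :=
  (m : ℝ)⁻¹ * ∑ i : Fin m,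
    if (∃ t, π.1.prob t (σ i t) ≠ π'.1.prob t (σ i t)) ∨
        (∃ t, π.2.prob t (σ i t) ≠ π'.2.prob t (σ i t)) then 1 else 0

/-- The least number of profiles in `C` that `ε`-cover `C` in the Hamming distance on given state
trajectories. -/
def coveringNumberOn {m : ℕ} (σ : Fin m → Fin T → S) (ε : ℝ) (C : Set (Profile T S A₁ A₂)) : ℕ∞ :=
  ⨅ (c : Finset (Profile T S A₁ A₂)) (_ : (c : Set (Profile T S A₁ A₂)) ⊆ C)
    (_ : ∀ π ∈ C, ∃ π' ∈ c, hamming σ π π' ≤ ε), (c.card : ℕ∞)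

/-- The `ε`-Hamming covering number: the supremum over all finite nonempty families of state
trajectories. -/
def coveringNumber (ε : ℝ) (C : Set (Profile T S A₁ A₂)) : ℕ∞ :=
  ⨆ (m : ℕ) (_ : 1 ≤ m) (σ : Fin m → Fin T → S), coveringNumberOn σ ε C

/-- The entropy integral `κ(C) = ∫_0^∞ √(log N_H(ε², C)) dε`. -/
def entropyIntegral (C : Set (Profile T S A₁ A₂)) : ℝ :=
  ∫ ε in Set.Ioi (0 : ℝ), √(Real.log ((coveringNumber (ε ^ 2) C).toNat : ℝ))

/-- `N_H(ε, C) ≤ D₁ exp(D₂ (1/ε)^ω)` for all `0 < ε < 1`, for some `D₁, D₂ > 0`,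
`0 ≤ ω < 1/2`. -/
def HasEntropyBound (C : Set (Profile T S A₁ A₂)) : Prop :=
  ∃ D₁ D₂ ω : ℝ, 0 < D₁ ∧ 0 < D₂ ∧ 0 ≤ ω ∧ ω < 1 / 2 ∧ ∀ ε : ℝ, 0 < ε → ε < 1 →
    (coveringNumber ε C : ENNReal) ≤ ENNReal.ofReal (D₁ * Real.exp (D₂ * (1 / ε) ^ ω))

/-- `sup_{π ∈ C} E[(∑_t γ^{t-1} (μ_t (r_t - Q_{1,t}) + μ_{t-1} V_{1,t}))²]`, the expectation being
that of the data distribution. -/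
def Game.varianceDRL [MeasurableSpace S] [MeasurableSpace A₁] [MeasurableSpace A₂]
    (G : Game S A₁ A₂) (πb : Profile T S A₁ A₂) (C : Set (Profile T S A₁ A₂)) : ℝ :=
  sSup ((fun π => ∫ τ, drlScore G.toModel G.γ π (G.ratio πb π) τ ^ 2 ∂(G.trajLaw πb)) '' C)

/-- `E[X_n²] = o(n^{-2α})`, with the expectation as a Lebesgue integral in `[0, ∞]`. -/
def MeanSquareLittleO {Ω : Type*} [MeasurableSpace Ω] (P : Measure Ω) (X : ℕ → Ω → ℝ)
    (α : ℝ) : Prop :=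
  Tendsto (fun n : ℕ => ENNReal.ofReal ((n : ℝ) ^ (2 * α)) *
    ∫⁻ ω, ENNReal.ofReal (X n ω ^ 2) ∂P) atTop (𝓝 0)

end

end MarkovGame

end

open MarkovGame

/-!
# Regret of policy learning with double reinforcement learning in Markov games

A cover of the class at a Hamming resolution finer than `1 / |S| ^ T`, on a family that lists
every state trajectory once, contains the whole class. Hence, over a finite state space, the entropy
bound forces the class to be finite, and `√(log |C|)` is at most `|S| ^ (T / 2)` times the
entropy integral (`sqrt_log_ncard_le_entropyIntegral`). The regret of the selected profile is at most
four times the largest deviation of the value estimator over the class (`exploitability_sub_le`),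
so that it suffices to control the estimator at each of finitely many profiles.

The error of the estimator at a profile splits into the error of the oracle estimator, which
averages the score with the true nuisance functions, and the nuisance error.

* The oracle estimator is an average of bounded independent variables whose mean is the value and
  whose second moments are at most `varianceDRL`. A Bernstein bound in the range of moderate
  deviations (`measure_abs_sum_ge_le`) shows that its tail is governed by that second moment alone
  once `n` is large, and a union bound costs `log |C|`.
* The nuisance error is `o(n ^ (-1/2))` in probability (`tendsto_nuisance`). Given the data outside
  a fold, the contributions of the fold are independent; their fluctuations are small because the
  estimated nuisance functions are consistent (`lintegral_sq_fold_le`,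
  `exists_lipschitz_drlScore`), and their bias is bounded by the product of the errors of the density
  ratio and of the value function (`Game.abs_scoreMean_sub_le`). With the true value functions the
  mean of the score telescopes for any weights, and with the true density ratio it is the value for
  any value functions, so that the terms that are linear in one of the errors cancel.

The rates assumed for products along paths pass to the density ratios and value functions by
induction along the path (`rate_stateOcc`, `rate_Q_segProb`): the sums over the visited states and
actions are finite, and `π` gives weight only to actions which the behavior profile plays.

In the degenerate cases of a class with a single profile and of `varianceDRL = 0`, where all values
in the class vanish, the regret is zero.
-/

set_option linter.unusedSectionVars false

namespace MarkovGame

/-! ### Covering numbers of policy classes over a finite state space -/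

section Covering

variable {T : ℕ} {S A₁ A₂ : Type*} [Fintype A₁] [Fintype A₂]

lemma hamming_self {m : ℕ} (σ : Fin m → Fin T → S) (π : Profile T S A₁ A₂) :
    hamming σ π π = 0 := by
  simp [hamming]

lemma hamming_le_one {m : ℕ} (σ : Fin m → Fin T → S) (π π' : Profile T S A₁ A₂) :
    hamming σ π π' ≤ 1 := by
  classical
  rw [hamming, inv_mul_eq_div]
  apply div_le_one_of_le₀ _ (Nat.cast_nonneg m)
  calc _ ≤ ∑ _i : Fin m, (1 : ℝ) := Finset.sum_le_sum fun i _ => by split_ifs <;> norm_num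
    _ = m := by simp

lemma coveringNumberOn_anti {m : ℕ} (σ : Fin m → Fin T → S) {ε ε' : ℝ} (h : ε ≤ ε')
    (C : Set (Profile T S A₁ A₂)) : coveringNumberOn σ ε' C ≤ coveringNumberOn σ ε C := by
  refine le_iInf fun c => le_iInf fun hc => le_iInf fun hcov => ?_
  refine iInf_le_of_le c (iInf_le_of_le hc (iInf_le_of_le (fun π hπ => ?_) le_rfl))
  obtain ⟨π', h1, h2⟩ := hcov π hπ
  exact ⟨π', h1, h2.trans h⟩

lemma coveringNumber_anti {ε ε' : ℝ} (h : ε ≤ ε') (C : Set (Profile T S A₁ A₂)) :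
    coveringNumber ε' C ≤ coveringNumber ε C :=
  iSup_mono fun _ => iSup_mono fun _ => iSup_mono fun σ => coveringNumberOn_anti σ h C

lemma coveringNumber_le_ncard {ε : ℝ} (hε : 0 ≤ ε) {C : Set (Profile T S A₁ A₂)}
    (hC : C.Finite) : coveringNumber ε C ≤ (C.ncard : ℕ∞) := by
  refine iSup_le fun m => iSup_le fun _ => iSup_le fun σ => ?_
  refine iInf_le_of_le hC.toFinset (iInf_le_of_le (by simp) (iInf_le_of_le (fun π hπ => ?_) ?_))
  · exact ⟨π, by simpa using hπ, by rwa [hamming_self]⟩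
  · rw [Set.ncard_eq_toFinset_card _ hC]

lemma coveringNumber_le_one {ε : ℝ} (hε : 1 ≤ ε) (C : Set (Profile T S A₁ A₂)) :
    coveringNumber ε C ≤ 1 := by
  refine iSup_le fun m => iSup_le fun _ => iSup_le fun σ => ?_
  rcases C.eq_empty_or_nonempty with rfl | ⟨π₀, h₀⟩
  · exact iInf_le_of_le ∅ (iInf_le_of_le (by simp) (iInf_le_of_le (by simp) (by simp)))
  · exact iInf_le_of_le {π₀} (iInf_le_of_le (by simpa using h₀) (iInf_le_of_le
      (fun π _ => ⟨π₀, by simp, (hamming_le_one σ π π₀).trans hε⟩) (by simp)))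

/-- On a family that lists every state trajectory, distinct profiles differ by at least one
trajectory, so that a cover at a resolution finer than `1 / |S| ^ T` contains the whole class. -/
lemma subset_of_cover_all [Fintype S] {σ : Fin (Fintype.card S ^ T) → Fin T → S}
    (hσ : Function.Surjective σ) {ε : ℝ} (hε : ε * (Fintype.card S ^ T : ℕ) < 1)
    {C : Set (Profile T S A₁ A₂)} {c : Finset (Profile T S A₁ A₂)}
    (hcov : ∀ π ∈ C, ∃ π' ∈ c, hamming σ π π' ≤ ε) : C ⊆ c := by
  classical
  intro π hπ
  obtain ⟨π', hc, hle⟩ := hcov π hπ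
  suffices h : π = π' by rw [h]; exact hc
  rcases isEmpty_or_nonempty (Fin T → S) with hem | hne
  · have hS : IsEmpty S := by
      by_contra hS
      rw [not_isEmpty_iff] at hS
      exact hem.elim fun _ => Classical.arbitrary S
    refine Prod.ext (Policy.ext ?_) (Policy.ext ?_) <;>
    · funext t s
      exact hS.elim s
  obtain ⟨x₀⟩ := hne
  have hm : (0 : ℝ) < (Fintype.card S ^ T : ℕ) := by
    obtain ⟨i, -⟩ := hσ x₀
    exact_mod_cast i.pos
  have key : ∀ i, ¬ ((∃ t, π.1.prob t (σ i t) ≠ π'.1.prob t (σ i t)) ∨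
        (∃ t, π.2.prob t (σ i t) ≠ π'.2.prob t (σ i t))) := by
    intro i hi
    have h1 : (1 : ℝ) ≤ ∑ i : Fin (Fintype.card S ^ T),
        if (∃ t, π.1.prob t (σ i t) ≠ π'.1.prob t (σ i t)) ∨
        (∃ t, π.2.prob t (σ i t) ≠ π'.2.prob t (σ i t)) then 1 else 0 := by
      refine le_trans ?_ (Finset.single_le_sum (fun j _ => ?_) (Finset.mem_univ i))
      · rw [if_pos hi]
      · split_ifs <;> norm_num
    rw [hamming, inv_mul_eq_div, div_le_iff₀ hm] at hle
    linarith
  push Not at key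
  refine Prod.ext (Policy.ext ?_) (Policy.ext ?_) <;>
  · funext t s
    obtain ⟨i, hi⟩ := hσ (Function.update x₀ t s)
    have := key i
    simp only [hi] at this
    first
    | simpa using this.1 t
    | simpa using this.2 t

lemma ncard_le_coveringNumber [Fintype S] [Nonempty S] {ε : ℝ} (hε : ε * (Fintype.card S ^ T : ℕ) < 1)
    (C : Set (Profile T S A₁ A₂)) : C.encard ≤ coveringNumber ε C := by
  classical
  have hcard : Fintype.card (Fin T → S) = Fintype.card S ^ T := by simp
  have hm : 1 ≤ Fintype.card S ^ T := Nat.one_le_pow _ _ Fintype.card_pos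
  let σ : Fin (Fintype.card S ^ T) → Fin T → S := (Fintype.equivFinOfCardEq hcard).symm
  refine le_trans ?_ (le_iSup_of_le (Fintype.card S ^ T) (le_iSup_of_le hm (le_iSup
    (fun σ => coveringNumberOn σ ε C) σ)))
  refine le_iInf fun c => le_iInf fun hc => le_iInf fun hcov => ?_
  rw [← Set.encard_coe_eq_coe_finsetCard]
  exact Set.encard_le_encard (subset_of_cover_all (Equiv.surjective _) hε hcov)

lemma HasEntropyBound.finite [Fintype S] [Nonempty S] {C : Set (Profile T S A₁ A₂)}
    (h : HasEntropyBound C) : C.Finite := by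
  obtain ⟨D₁, D₂, w, -, -, -, -, h⟩ := h
  have hm : (1 : ℝ) ≤ (Fintype.card S ^ T : ℕ) := by
    exact_mod_cast Nat.one_le_pow T _ (Fintype.card_pos (α := S))
  set m : ℝ := ((Fintype.card S ^ T : ℕ) : ℝ)
  have hlt := h (1 / (2 * m)) (by positivity) (by rw [div_lt_one (by positivity)]; linarith)
  have hfin : coveringNumber (1 / (2 * m)) C ≠ ⊤ := by
    intro htop
    rw [htop] at hlt
    simp at hlt
  refine Set.encard_ne_top_iff.1 (ne_top_of_le_ne_top hfin (ncard_le_coveringNumber ?_ C))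
  rw [div_mul_eq_mul_div, div_lt_one (by positivity)]
  change 1 * m < 2 * m
  linarith

lemma entropyIntegral_nonneg (C : Set (Profile T S A₁ A₂)) : 0 ≤ entropyIntegral C :=
  integral_nonneg fun _ => Real.sqrt_nonneg _

/-- For `ε < |S| ^ (-T / 2)` the integrand of the entropy integral is `√(log |C|)`. -/
lemma sqrt_log_ncard_le_entropyIntegral [Fintype S] [Nonempty S] {C : Set (Profile T S A₁ A₂)}
    (hC : C.Finite) :
    √(Real.log C.ncard) ≤ √(Fintype.card S ^ T : ℕ) * entropyIntegral C := by
  have hm : (1 : ℝ) ≤ (Fintype.card S ^ T : ℕ) := by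
    exact_mod_cast Nat.one_le_pow T _ (Fintype.card_pos (α := S))
  set m : ℝ := ((Fintype.card S ^ T : ℕ) : ℝ) with hmdef
  have hsm : 0 < √m := Real.sqrt_pos.2 (by linarith)
  set f : ℝ → ℝ := fun ε => √(Real.log ((coveringNumber (ε ^ 2) C).toNat : ℝ)) with hf
  have hne : ∀ ε : ℝ, coveringNumber (ε ^ 2) C ≠ ⊤ := fun ε =>
    ne_top_of_le_ne_top (ENat.natCast_ne_top _) (coveringNumber_le_ncard (sq_nonneg ε) hC)
  have hmonoR : ∀ a b : ℕ, a ≤ b → √(Real.log (a : ℝ)) ≤ √(Real.log (b : ℝ)) := by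
    intro a b hab
    rcases Nat.eq_zero_or_pos a with rfl | ha
    · simp
    · exact Real.sqrt_le_sqrt (Real.log_le_log (by exact_mod_cast ha) (by exact_mod_cast hab))
  have hanti : AntitoneOn f (Set.Ioi 0) := by
    intro x hx y hy hxy
    exact hmonoR _ _ (ENat.toNat_le_toNat (coveringNumber_anti
      (pow_le_pow_left₀ (le_of_lt hx) hxy 2) C) (hne x))
  have hle : ∀ x, f x ≤ √(Real.log C.ncard) := fun x => hmonoR _ _ (by
    simpa using ENat.toNat_le_toNat (coveringNumber_le_ncard (sq_nonneg x) hC) (by simp))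
  have hzero : ∀ x, 1 ≤ x → f x = 0 := by
    intro x hx
    have h1 := ENat.toNat_le_toNat (coveringNumber_le_one (by nlinarith : 1 ≤ x ^ 2) C) (by simp)
    have h2 := hmonoR _ _ h1
    simp only [ENat.toNat_one, Nat.cast_one, Real.log_one, Real.sqrt_zero] at h2
    exact le_antisymm h2 (Real.sqrt_nonneg _)
  have hint : IntegrableOn f (Set.Ioi 0) := by
    have hmeas := aemeasurable_restrict_of_antitoneOn (μ := volume) measurableSet_Ioi hanti
    have hg : Integrable ((Set.Icc (0 : ℝ) 1).indicator fun _ => √(Real.log C.ncard))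
        (volume.restrict (Set.Ioi 0)) :=
      (integrable_indicator_iff measurableSet_Icc).2 (by
        refine integrableOn_const ?_
        exact ((Measure.restrict_apply_le _ _).trans_lt (by simp)).ne)
    refine hg.mono' hmeas.aestronglyMeasurable ?_
    filter_upwards [ae_restrict_mem measurableSet_Ioi] with x hx
    rw [Real.norm_of_nonneg (Real.sqrt_nonneg _)]
    by_cases h1 : x ≤ 1
    · rw [Set.indicator_of_mem (show x ∈ Set.Icc (0 : ℝ) 1 from ⟨le_of_lt hx, h1⟩)]
      exact hle x
    · rw [Set.indicator_of_notMem (fun h => h1 h.2)]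
      exact (hzero x (by linarith)).le
  have hconst : ∀ x ∈ Set.Ioo (0 : ℝ) (√m)⁻¹, √(Real.log C.ncard) ≤ f x := by
    intro x hx
    apply hmonoR
    have hx2 : x ^ 2 * m < 1 := by
      have h1 : x * √m < 1 := by
        have := mul_lt_mul_of_pos_right hx.2 hsm
        rwa [inv_mul_cancel₀ hsm.ne'] at this
      have h2 : 0 ≤ x * √m := mul_nonneg hx.1.le hsm.le
      have h3 : (x * √m) ^ 2 = x ^ 2 * m := by rw [mul_pow, Real.sq_sqrt (by linarith)]
      nlinarith
    exact ENat.toNat_le_toNat (ncard_le_coveringNumber hx2 C) (hne x)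
  have h1 : ∫ x in Set.Ioo (0 : ℝ) (√m)⁻¹, √(Real.log C.ncard) ≤
      ∫ x in Set.Ioo (0 : ℝ) (√m)⁻¹, f x :=
    setIntegral_mono_on (integrableOn_const (by simp)) (hint.mono_set Set.Ioo_subset_Ioi_self)
      measurableSet_Ioo hconst
  have h2 : ∫ x in Set.Ioo (0 : ℝ) (√m)⁻¹, f x ≤ entropyIntegral C :=
    setIntegral_mono_set hint (ae_of_all _ fun _ => Real.sqrt_nonneg _)
      Set.Ioo_subset_Ioi_self.eventuallyLE
  have h3 : ∫ x in Set.Ioo (0 : ℝ) (√m)⁻¹, √(Real.log C.ncard) =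
      (√m)⁻¹ * √(Real.log C.ncard) := by
    simp [hsm.le]
  rw [h3] at h1
  have h4 := mul_le_mul_of_nonneg_left (h1.trans h2) hsm.le
  rwa [mul_inv_cancel_left₀ hsm.ne'] at h4

end Covering

/-! ### Exploitability -/

section Exploitability

variable {T : ℕ} {S A₁ A₂ : Type*} [Fintype A₁] [Fintype A₂]

lemma abs_sSup_image_sub_le {ι : Type*} {s : Set ι} (hs : s.Finite) (hne : s.Nonempty)
    {f g : ι → ℝ} {ε : ℝ} (h : ∀ i ∈ s, |f i - g i| ≤ ε) :
    |sSup (f '' s) - sSup (g '' s)| ≤ ε := by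
  have one : ∀ f g : ι → ℝ, (∀ i ∈ s, |f i - g i| ≤ ε) → sSup (f '' s) - sSup (g '' s) ≤ ε := by
    intro f g h
    rw [sub_le_iff_le_add]
    refine csSup_le (hne.image f) ?_
    rintro _ ⟨i, hi, rfl⟩
    have h1 := le_csSup (hs.image g).bddAbove (Set.mem_image_of_mem g hi)
    have h2 := (abs_le.1 (h i hi)).2
    linarith
  rw [abs_le]
  have h1 := one g f fun i hi => by rw [abs_sub_comm]; exact h i hi
  exact ⟨by linarith, one f g h⟩

lemma abs_exploitability_sub_le {C₁ : Set (Policy T S A₁)} {C₂ : Set (Policy T S A₂)}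
    (hC₁ : C₁.Finite) (hC₂ : C₂.Finite) {v w : Profile T S A₁ A₂ → ℝ} {ε : ℝ}
    (h : ∀ π ∈ C₁ ×ˢ C₂, |v π - w π| ≤ ε) {π : Profile T S A₁ A₂} (hπ : π ∈ C₁ ×ˢ C₂) :
    |exploitability v C₁ C₂ π - exploitability w C₁ C₂ π| ≤ 2 * ε := by
  have h1 := abs_sSup_image_sub_le hC₁ ⟨_, hπ.1⟩ (f := fun π₁' => v (π₁', π.2))
    (g := fun π₁' => w (π₁', π.2)) fun π₁' h1 => h (π₁', π.2) ⟨h1, hπ.2⟩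
  have h2 := abs_sSup_image_sub_le hC₂ ⟨_, hπ.2⟩ (f := fun π₂' => -v (π.1, π₂'))
    (g := fun π₂' => -w (π.1, π₂')) (ε := ε) fun π₂' h2 => by
      rw [neg_sub_neg, abs_sub_comm]
      exact h (π.1, π₂') ⟨hπ.1, h2⟩
  rw [exploitability, exploitability, add_sub_add_comm]
  exact (abs_add_le _ _).trans (by linarith)

/-- A minimizer of the exploitability of an approximate value function has nearly the least
exploitability. -/
lemma exploitability_sub_le {C₁ : Set (Policy T S A₁)} {C₂ : Set (Policy T S A₂)}
    (hC₁ : C₁.Finite) (hC₂ : C₂.Finite) {v w : Profile T S A₁ A₂ → ℝ} {ε : ℝ}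
    (h : ∀ π ∈ C₁ ×ˢ C₂, |w π - v π| ≤ ε) {π π' : Profile T S A₁ A₂}
    (hπ : IsSelected (exploitability w C₁ C₂) C₁ C₂ π) (hπ' : π' ∈ C₁ ×ˢ C₂) :
    exploitability v C₁ C₂ π - exploitability v C₁ C₂ π' ≤ 4 * ε := by
  have h1 := abs_le.1 (abs_exploitability_sub_le hC₁ hC₂ h hπ.1)
  have h2 := abs_le.1 (abs_exploitability_sub_le hC₁ hC₂ h hπ')
  have h3 := hπ.2 π' hπ'
  linarith [h1.1, h2.2]

lemma sSup_image_eq {ι : Type*} {s : Set ι} {f : ι → ℝ} {i : ι} (hi : i ∈ s)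
    (h : ∀ j, f j ≤ f i) : sSup (f '' s) = f i := by
  refine IsGreatest.csSup_eq ⟨Set.mem_image_of_mem f hi, ?_⟩
  rintro _ ⟨j, -, rfl⟩
  exact h j

lemma HasBestResponses.exploitability_univ {C₁ : Set (Policy T S A₁)} {C₂ : Set (Policy T S A₂)}
    {v : Profile T S A₁ A₂ → ℝ} (h : HasBestResponses v C₁ C₂) {π : Profile T S A₁ A₂}
    (hπ : π ∈ C₁ ×ˢ C₂) :
    exploitability v Set.univ Set.univ π = exploitability v C₁ C₂ π := by
  obtain ⟨π₁, h1, h1'⟩ := h.1 π.2 hπ.2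
  obtain ⟨π₂, h2, h2'⟩ := h.2 π.1 hπ.1
  rw [exploitability, exploitability,
    sSup_image_eq (f := fun π₁' => v (π₁', π.2)) (Set.mem_univ π₁) h1',
    sSup_image_eq (f := fun π₁' => v (π₁', π.2)) h1 h1',
    sSup_image_eq (f := fun π₂' => -v (π.1, π₂')) (Set.mem_univ π₂) fun j => neg_le_neg (h2' j),
    sSup_image_eq (f := fun π₂' => -v (π.1, π₂')) h2 fun j => neg_le_neg (h2' j)]

end Exploitability

/-! ### Marginals of the trajectory law -/

section Marginals

variable {T : ℕ} {S A₁ A₂ : Type*} [Fintype S] [Fintype A₁] [Fintype A₂]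

lemma Policy.p_nonneg {A : Type*} [Fintype A] (π : Policy T S A) (t : ℕ) (s : S) (a : A) :
    0 ≤ π.p t s a := by
  unfold Policy.p
  split_ifs
  exacts [π.nonneg _ _ _, le_rfl]

lemma Profile.p_nonneg (π : Profile T S A₁ A₂) (t : ℕ) (s : S) (a : A₁) (b : A₂) :
    0 ≤ π.p t s a b :=
  mul_nonneg (π.1.p_nonneg _ _ _) (π.2.p_nonneg _ _ _)

lemma Profile.sum_p (π : Profile T S A₁ A₂) {t : ℕ} (ht : t < T) (s : S) :
    ∑ a, ∑ b, π.p t s a b = 1 := by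
  simp only [Profile.p, ← Finset.mul_sum, Policy.p, dif_pos ht, Policy.sum_one, mul_one]

lemma Profile.p_le_one (π : Profile T S A₁ A₂) (t : ℕ) (s : S) (a : A₁) (b : A₂) :
    π.p t s a b ≤ 1 := by
  by_cases ht : t < T
  · rw [← π.sum_p ht s]
    refine le_trans ?_ (Finset.single_le_sum (f := fun a => ∑ b, π.p t s a b)
      (fun a _ => Finset.sum_nonneg fun b _ => π.p_nonneg t s a b) (Finset.mem_univ a))
    exact Finset.single_le_sum (f := fun b => π.p t s a b) (fun b _ => π.p_nonneg t s a b)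
      (Finset.mem_univ b)
  · simp [Profile.p, Policy.p, ht]

lemma Game.stateOcc_nonneg (G : Game S A₁ A₂) (π : Profile T S A₁ A₂) (t : ℕ) (s : S) :
    0 ≤ G.toModel.stateOcc π t s := by
  induction t generalizing s with
  | zero => exact G.PI_nonneg s
  | succ t ih =>
    exact Finset.sum_nonneg fun x _ => Finset.sum_nonneg fun a _ => Finset.sum_nonneg fun b _ =>
      mul_nonneg (G.PT_nonneg _ _ _ _) (mul_nonneg (π.p_nonneg _ _ _ _) (ih x))

lemma Game.occ_nonneg (G : Game S A₁ A₂) (π : Profile T S A₁ A₂) (t : ℕ) (s : S) (a : A₁)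
    (b : A₂) : 0 ≤ G.toModel.occ π t s a b :=
  mul_nonneg (π.p_nonneg _ _ _ _) (G.stateOcc_nonneg π t s)

lemma Model.stateOcc_succ (M : Model S A₁ A₂) (π : Profile T S A₁ A₂) (t : ℕ) (s' : S) :
    M.stateOcc π (t + 1) s' = ∑ s, ∑ a, ∑ b, M.PT s a b s' * M.occ π t s a b := rfl

lemma Game.mul_occ_le_stateOcc_succ (G : Game S A₁ A₂) (π : Profile T S A₁ A₂) (t : ℕ) (s : S)
    (a : A₁) (b : A₂) (s' : S) :
    G.PT s a b s' * G.toModel.occ π t s a b ≤ G.toModel.stateOcc π (t + 1) s' := by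
  have h : ∀ s a b, 0 ≤ G.PT s a b s' * G.toModel.occ π t s a b := fun s a b =>
    mul_nonneg (G.PT_nonneg _ _ _ _) (G.occ_nonneg _ _ _ _ _)
  rw [Model.stateOcc_succ]
  refine le_trans ?_ (Finset.single_le_sum (fun s _ => Finset.sum_nonneg fun a _ =>
    Finset.sum_nonneg fun b _ => h s a b) (Finset.mem_univ s))
  refine le_trans ?_ (Finset.single_le_sum (fun a _ => Finset.sum_nonneg fun b _ => h s a b)
    (Finset.mem_univ a))
  exact Finset.single_le_sum (fun b _ => h s a b) (Finset.mem_univ b)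

lemma Game.sum_stateOcc (G : Game S A₁ A₂) (π : Profile T S A₁ A₂) {t : ℕ} (ht : t ≤ T) :
    ∑ s, G.toModel.stateOcc π t s = 1 := by
  induction t with
  | zero => exact G.PI_sum
  | succ t ih =>
    rw [← ih (by omega)]
    simp only [Model.stateOcc_succ]
    rw [Finset.sum_comm]
    refine Finset.sum_congr rfl fun s _ => ?_
    rw [Finset.sum_comm]
    calc _ = ∑ a, ∑ b, G.toModel.occ π t s a b := by
          refine Finset.sum_congr rfl fun a _ => ?_
          rw [Finset.sum_comm]
          refine Finset.sum_congr rfl fun b _ => ?_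
          rw [← Finset.sum_mul]
          exact (congrArg (· * _) (G.PT_sum s a b)).trans (one_mul _)
      _ = (∑ a, ∑ b, π.p t s a b) * G.toModel.stateOcc π t s := by
          simp only [Finset.sum_mul]; rfl
      _ = _ := by rw [π.sum_p (by omega), one_mul]

lemma Game.occ_le_one (G : Game S A₁ A₂) (π : Profile T S A₁ A₂) {t : ℕ} (ht : t ≤ T) (s : S)
    (a : A₁) (b : A₂) : G.toModel.occ π t s a b ≤ 1 := by
  refine mul_le_one₀ (π.p_le_one _ _ _ _) (G.stateOcc_nonneg _ _ _) ?_
  rw [← G.sum_stateOcc π ht]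
  exact Finset.single_le_sum (fun x _ => G.stateOcc_nonneg π t x) (Finset.mem_univ s)

/-- The probability of the states and actions of a path, in the model `M` under `π`. -/
noncomputable def Model.pathWeight (M : Model S A₁ A₂) (π : Profile T S A₁ A₂) (n : ℕ)
    (s : Fin (n + 1) → S) (a : Fin n → A₁) (b : Fin n → A₂) : ℝ :=
  M.PI (s 0) * ∏ l : Fin n,
    (π.p l (s l.castSucc) (a l) (b l) * M.PT (s l.castSucc) (a l) (b l) (s l.succ))

lemma sum_fin_snoc {α : Type*} [Fintype α] {n : ℕ} (f : (Fin (n + 1) → α) → ℝ) :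
    ∑ x, f x = ∑ x : Fin n → α, ∑ y, f (Fin.snoc x y) := by
  rw [← (Fin.snocEquiv fun _ => α).sum_comp, Fintype.sum_prod_type, Finset.sum_comm]
  rfl

lemma sum_rotate {α β γ : Type*} [Fintype α] [Fintype β] [Fintype γ] (f : α → β → γ → ℝ) :
    ∑ x, ∑ y, ∑ z, f x y z = ∑ y, ∑ z, ∑ x, f x y z := by
  rw [Finset.sum_comm]
  exact Finset.sum_congr rfl fun y _ => Finset.sum_comm

lemma sum_path_snoc {n : ℕ} (f : (Fin (n + 2) → S) → (Fin (n + 1) → A₁) → (Fin (n + 1) → A₂) → ℝ) :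
    ∑ s, ∑ a, ∑ b, f s a b = ∑ s, ∑ a, ∑ b, ∑ a', ∑ b', ∑ s',
      f (Fin.snoc s s') (Fin.snoc a a') (Fin.snoc b b') := by
  rw [sum_fin_snoc]
  refine Finset.sum_congr rfl fun s _ => ?_
  simp only [sum_fin_snoc (α := A₁), sum_fin_snoc (α := A₂)]
  rw [Finset.sum_comm]
  refine Finset.sum_congr rfl fun a _ => ?_
  rw [sum_rotate, Finset.sum_comm]
  exact Finset.sum_congr rfl fun b _ => Finset.sum_congr rfl fun a' _ => Finset.sum_comm

lemma Model.pathWeight_snoc (M : Model S A₁ A₂) (π : Profile T S A₁ A₂) (n : ℕ)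
    (s : Fin (n + 1) → S) (a : Fin n → A₁) (b : Fin n → A₂) (s' : S) (a' : A₁) (b' : A₂) :
    M.pathWeight π (n + 1) (Fin.snoc s s' : Fin (n + 2) → S) (Fin.snoc a a' : Fin (n + 1) → A₁)
        (Fin.snoc b b' : Fin (n + 1) → A₂) =
      M.pathWeight π n s a b *
        (π.p n (s (Fin.last n)) a' b' * M.PT (s (Fin.last n)) a' b' s') := by
  have h0 : (Fin.snoc s s' : Fin (n + 2) → S) 0 = s 0 := by
    rw [← Fin.castSucc_zero, Fin.snoc_castSucc]
  simp only [Model.pathWeight, Fin.prod_univ_castSucc, Fin.snoc_castSucc, Fin.snoc_last, h0,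
    ← Fin.castSucc_succ, Fin.succ_last, Fin.val_castSucc, Fin.val_last]
  ring

lemma Model.sum_pathWeight_last (M : Model S A₁ A₂) (π : Profile T S A₁ A₂) (n : ℕ) (g : S → ℝ) :
    ∑ s, ∑ a, ∑ b, M.pathWeight π n s a b * g (s (Fin.last n)) = ∑ s, M.stateOcc π n s * g s := by
  induction n generalizing g with
  | zero =>
    simp only [Finset.univ_unique, Finset.sum_singleton]
    rw [← (Equiv.funUnique (Fin 1) S).sum_comp]
    simp [Model.pathWeight, Model.stateOcc]
  | succ n ih =>
    rw [sum_path_snoc]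
    simp only [Model.pathWeight_snoc, Fin.snoc_last]
    simp only [mul_assoc, ← Finset.mul_sum]
    rw [ih fun x => ∑ a', ∑ b', π.p n x a' b' * ∑ s', M.PT x a' b' s' * g s']
    simp only [Model.stateOcc_succ, Finset.sum_mul, Finset.mul_sum, Model.occ]
    conv_rhs => rw [Finset.sum_comm]
    refine Finset.sum_congr rfl fun s _ => ?_
    conv_rhs => rw [sum_rotate]
    refine Finset.sum_congr rfl fun a _ => Finset.sum_congr rfl fun b _ =>
      Finset.sum_congr rfl fun s' _ => ?_
    ring

/-- The joint law of the state and actions at step `t` and the next state. -/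
lemma Game.sum_pathWeight (G : Game S A₁ A₂) (π : Profile T S A₁ A₂) {n : ℕ} (hn : n ≤ T)
    (t : Fin n) (g : S → A₁ → A₂ → S → ℝ) :
    ∑ s, ∑ a, ∑ b, G.toModel.pathWeight π n s a b * g (s t.castSucc) (a t) (b t) (s t.succ) =
      ∑ s, ∑ a, ∑ b, G.toModel.occ π t s a b * ∑ s', G.PT s a b s' * g s a b s' := by
  induction n with
  | zero => exact t.elim0
  | succ n ih =>
    rw [sum_path_snoc]
    simp only [Model.pathWeight_snoc]
    induction t using Fin.lastCases with
    | last =>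
      simp only [Fin.snoc_castSucc, Fin.snoc_last, Fin.succ_last, mul_assoc, ← Finset.mul_sum]
      rw [Model.sum_pathWeight_last G.toModel π n fun x => ∑ a', ∑ b', π.p n x a' b' *
        ∑ s', G.toModel.PT x a' b' s' * g x a' b' s']
      refine Finset.sum_congr rfl fun s _ => ?_
      simp only [Finset.mul_sum, Model.occ, Fin.val_last, Game.toModel]
      refine Finset.sum_congr rfl fun a _ => Finset.sum_congr rfl fun b _ =>
        Finset.sum_congr rfl fun s' _ => ?_
      ring
    | cast t =>
      have h1 : ∀ x, ∑ a', ∑ b', ∑ s', π.p n x a' b' * G.PT x a' b' s' = 1 := fun x => by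
        simp only [← Finset.mul_sum, G.PT_sum, mul_one]
        exact π.sum_p (by omega) x
      rw [Fin.val_castSucc, ← ih (by omega) t]
      refine Finset.sum_congr rfl fun s _ => Finset.sum_congr rfl fun a _ =>
        Finset.sum_congr rfl fun b _ => ?_
      simp only [Fin.snoc_castSucc, ← Fin.castSucc_succ]
      rw [← mul_one (_ * g _ _ _ _), ← h1 (s (Fin.last n))]
      simp only [Finset.mul_sum]
      refine Finset.sum_congr rfl fun a' _ => Finset.sum_congr rfl fun b' _ =>
        Finset.sum_congr rfl fun s' _ => ?_
      change _ * (_ * G.PT _ _ _ _) * _ = _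
      ring

lemma Game.pathWeight_nonneg (G : Game S A₁ A₂) (π : Profile T S A₁ A₂) (n : ℕ)
    (s : Fin (n + 1) → S) (a : Fin n → A₁) (b : Fin n → A₂) :
    0 ≤ G.toModel.pathWeight π n s a b :=
  mul_nonneg (G.PI_nonneg _) (Finset.prod_nonneg fun _ _ =>
    mul_nonneg (π.p_nonneg _ _ _ _) (G.PT_nonneg _ _ _ _))

/-- A path of positive probability visits only state-action triples of positive occupancy. -/
lemma Game.occ_pos_of_pathWeight (G : Game S A₁ A₂) (π : Profile T S A₁ A₂) {n : ℕ}
    {s : Fin (n + 1) → S} {a : Fin n → A₁} {b : Fin n → A₂}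
    (h : G.toModel.pathWeight π n s a b ≠ 0) (t : Fin n) :
    0 < G.toModel.occ π t (s t.castSucc) (a t) (b t) := by
  have h0 : 0 < G.PI (s 0) := (G.PI_nonneg _).lt_of_ne' (left_ne_zero_of_mul h)
  have h1 : ∀ l : Fin n, 0 < π.p l (s l.castSucc) (a l) (b l) ∧
      0 < G.PT (s l.castSucc) (a l) (b l) (s l.succ) := fun l => by
    have := Finset.prod_ne_zero_iff.1 (right_ne_zero_of_mul h) l (Finset.mem_univ l)
    exact ⟨(π.p_nonneg _ _ _ _).lt_of_ne' (left_ne_zero_of_mul this),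
      (G.PT_nonneg _ _ _ _).lt_of_ne' (right_ne_zero_of_mul this)⟩
  obtain ⟨t, ht⟩ := t
  induction t with
  | zero => exact mul_pos (h1 ⟨0, ht⟩).1 h0
  | succ t ih =>
    refine mul_pos (h1 ⟨t + 1, ht⟩).1 (lt_of_lt_of_le ?_
      (G.mul_occ_le_stateOcc_succ π t (s (Fin.castSucc ⟨t, by omega⟩)) (a ⟨t, by omega⟩)
        (b ⟨t, by omega⟩) _))
    exact mul_pos (h1 ⟨t, by omega⟩).2 (ih (by omega))

end Marginals

section Expectation

variable {T : ℕ} {S A₁ A₂ : Type*} [Fintype S] [Fintype A₁] [Fintype A₂]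
  [MeasurableSpace S] [DiscreteMeasurableSpace S]
  [MeasurableSpace A₁] [DiscreteMeasurableSpace A₁]
  [MeasurableSpace A₂] [DiscreteMeasurableSpace A₂]

/-- The law of the rewards given the states and actions. -/
noncomputable def Game.rewardLaw (G : Game S A₁ A₂) (s : Fin (T + 1) → S) (a : Fin T → A₁)
    (b : Fin T → A₂) : Measure (Fin T → ℝ) :=
  Measure.pi fun t : Fin T => G.PR (s t.castSucc) (a t) (b t)

instance (G : Game S A₁ A₂) (s : Fin (T + 1) → S) (a : Fin T → A₁) (b : Fin T → A₂) :
    IsProbabilityMeasure (G.rewardLaw s a b) := by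
  have := G.PR_prob
  unfold Game.rewardLaw
  infer_instance

lemma measurable_traj {β : Type*} [MeasurableSpace β] {f : Traj T S A₁ A₂ → β}
    (hf : ∀ s a b, Measurable fun r => f (s, a, b, r)) : Measurable f :=
  measurable_from_prod_countable_right fun s => measurable_from_prod_countable_right fun a =>
    measurable_from_prod_countable_right fun b => hf s a b

lemma Game.trajLaw_eq (G : Game S A₁ A₂) (π : Profile T S A₁ A₂) :
    G.trajLaw π = ∑ s, ∑ a, ∑ b, ENNReal.ofReal (G.toModel.pathWeight π T s a b) •
      (G.rewardLaw s a b).map fun r => (s, a, b, r) := rfl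

lemma Game.integrable_and_integral_trajLaw (G : Game S A₁ A₂) (π : Profile T S A₁ A₂)
    {f : Traj T S A₁ A₂ → ℝ}
    (hf : Measurable f) (hint : ∀ s a b, Integrable (fun r => f (s, a, b, r)) (G.rewardLaw s a b)) :
    Integrable f (G.trajLaw π) ∧ ∫ τ, f τ ∂(G.trajLaw π) =
      ∑ s, ∑ a, ∑ b, G.toModel.pathWeight π T s a b * ∫ r, f (s, a, b, r) ∂(G.rewardLaw s a b) := by
  have hm : ∀ s a b, Measurable fun r : Fin T → ℝ => ((s, a, b, r) : Traj T S A₁ A₂) :=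
    fun s a b => by fun_prop
  have h1 : ∀ s a b, Integrable f (ENNReal.ofReal (G.toModel.pathWeight π T s a b) •
      (G.rewardLaw s a b).map fun r => (s, a, b, r)) := fun s a b =>
    ((integrable_map_measure hf.aestronglyMeasurable (hm s a b).aemeasurable).2
      (hint s a b)).smul_measure ENNReal.ofReal_ne_top
  rw [Game.trajLaw_eq]
  have h2 : ∀ s a, Integrable f (∑ b, ENNReal.ofReal (G.toModel.pathWeight π T s a b) •
      (G.rewardLaw s a b).map fun r => (s, a, b, r)) := fun s a =>
    integrable_finsetSum_measure.2 fun b _ => h1 s a b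
  have h3 : ∀ s, Integrable f (∑ a, ∑ b, ENNReal.ofReal (G.toModel.pathWeight π T s a b) •
      (G.rewardLaw s a b).map fun r => (s, a, b, r)) := fun s =>
    integrable_finsetSum_measure.2 fun a _ => h2 s a
  refine ⟨integrable_finsetSum_measure.2 fun s _ => h3 s, ?_⟩
  rw [integral_finsetSum_measure fun s _ => h3 s]
  refine Finset.sum_congr rfl fun s _ => ?_
  rw [integral_finsetSum_measure fun a _ => h2 s a]
  refine Finset.sum_congr rfl fun a _ => ?_
  rw [integral_finsetSum_measure fun b _ => h1 s a b]
  refine Finset.sum_congr rfl fun b _ => ?_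
  rw [integral_smul_measure, integral_map (hm s a b).aemeasurable hf.aestronglyMeasurable,
    ENNReal.toReal_ofReal (G.pathWeight_nonneg π T s a b), smul_eq_mul]

lemma Game.ae_trajLaw (G : Game S A₁ A₂) (π : Profile T S A₁ A₂) {p : Traj T S A₁ A₂ → Prop}
    (hp : MeasurableSet {τ | p τ}) (h : ∀ s a b, G.toModel.pathWeight π T s a b ≠ 0 →
      ∀ᵐ r ∂(G.rewardLaw s a b), p (s, a, b, r)) : ∀ᵐ τ ∂(G.trajLaw π), p τ := by
  have hm : ∀ s a b, Measurable fun r : Fin T → ℝ => ((s, a, b, r) : Traj T S A₁ A₂) :=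
    fun s a b => by fun_prop
  rw [Game.trajLaw_eq, ae_iff, Measure.finsetSum_apply]
  refine Finset.sum_eq_zero fun s _ => ?_
  rw [Measure.finsetSum_apply]
  refine Finset.sum_eq_zero fun a _ => ?_
  rw [Measure.finsetSum_apply]
  refine Finset.sum_eq_zero fun b _ => ?_
  rw [Measure.smul_apply, smul_eq_mul]
  by_cases h0 : G.toModel.pathWeight π T s a b = 0
  · simp [h0]
  · have h1 := (ae_map_iff (hm s a b).aemeasurable hp).2 (h s a b h0)
    rw [ae_iff] at h1
    rw [h1, mul_zero]

lemma integral_reward (G : Game S A₁ A₂) (s : Fin (T + 1) → S) (a : Fin T → A₁) (b : Fin T → A₂) (t : Fin T) :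
    ∫ r, r t ∂(G.rewardLaw s a b) = G.toModel.R (s t.castSucc) (a t) (b t) := by
  have := G.PR_prob
  exact integral_comp_eval (μ := fun t : Fin T => G.PR (s t.castSucc) (a t) (b t))
    (f := fun x => x) (by fun_prop)

variable {G : Game S A₁ A₂} {Rmax : ℝ}
  (h_reward : ∀ s a b, ∀ᵐ r ∂(G.PR s a b), |r| ≤ Rmax)
include h_reward

lemma ae_rewardLaw (s : Fin (T + 1) → S) (a : Fin T → A₁) (b : Fin T → A₂) :
    ∀ᵐ r ∂(G.rewardLaw s a b), ∀ t, |r t| ≤ Rmax := by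
  have := G.PR_prob
  refine ae_all_iff.2 fun t => ?_
  exact (Measure.tendsto_eval_ae_ae (μ := fun t : Fin T => G.PR (s t.castSucc) (a t) (b t))
    (i := t)).eventually (h_reward _ _ _)

lemma integrable_reward (s : Fin (T + 1) → S) (a : Fin T → A₁) (b : Fin T → A₂) (t : Fin T) :
    Integrable (fun r => r t) (G.rewardLaw s a b) :=
  Integrable.of_bound (measurable_pi_apply t).aestronglyMeasurable Rmax ((ae_rewardLaw h_reward s a b).mono fun _ h => h t)

/-- Trajectories of the behavior profile visit only state-action triples of positive occupancy,
and their rewards are bounded. -/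
lemma ae_trajLaw_good (π : Profile T S A₁ A₂) :
    ∀ᵐ τ ∂(G.trajLaw π), ∀ t : Fin T, 0 < G.toModel.occ π t (τ.1 t.castSucc) (τ.2.1 t) (τ.2.2.1 t) ∧
      |τ.2.2.2 t| ≤ Rmax := by
  refine G.ae_trajLaw π ?_ fun s a b h => ?_
  · rw [Set.ofPred_forall]
    refine MeasurableSet.iInter fun t => MeasurableSet.inter ?_ ?_
    · exact measurableSet_lt measurable_const (measurable_traj
        (f := fun τ => G.toModel.occ π t (τ.1 t.castSucc) (τ.2.1 t) (τ.2.2.1 t))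
        fun s a b =>
          (measurable_const (a := G.toModel.occ π t (s t.castSucc) (a t) (b t)) :))
    · exact measurableSet_le (measurable_traj (f := fun τ => |τ.2.2.2 t|)
        fun s a b => by fun_prop) measurable_const
  · filter_upwards [ae_rewardLaw h_reward s a b] with r hr t
    exact ⟨G.occ_pos_of_pathWeight π h t, hr t⟩

/-- Expectation of a function of a step of the trajectory that is affine in the reward. -/
lemma integral_step (π : Profile T S A₁ A₂) (t : Fin T) (f : S → A₁ → A₂ → ℝ)
    (g : S → A₁ → A₂ → S → ℝ) :
    Integrable (fun τ => f (τ.1 t.castSucc) (τ.2.1 t) (τ.2.2.1 t) * τ.2.2.2 t +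
        g (τ.1 t.castSucc) (τ.2.1 t) (τ.2.2.1 t) (τ.1 t.succ)) (G.trajLaw π) ∧
    ∫ τ, f (τ.1 t.castSucc) (τ.2.1 t) (τ.2.2.1 t) * τ.2.2.2 t +
        g (τ.1 t.castSucc) (τ.2.1 t) (τ.2.2.1 t) (τ.1 t.succ) ∂(G.trajLaw π) =
      ∑ s, ∑ a, ∑ b, G.toModel.occ π t s a b *
        (f s a b * G.toModel.R s a b + ∑ s', G.PT s a b s' * g s a b s') := by
  have hm : Measurable (fun τ : Traj T S A₁ A₂ =>
      f (τ.1 t.castSucc) (τ.2.1 t) (τ.2.2.1 t) * τ.2.2.2 t +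
        g (τ.1 t.castSucc) (τ.2.1 t) (τ.2.2.1 t) (τ.1 t.succ)) :=
    measurable_traj fun s a b => by fun_prop
  obtain ⟨h1, h2⟩ := G.integrable_and_integral_trajLaw π hm fun s a b =>
    (((integrable_reward h_reward s a b t).const_mul (f (s t.castSucc) (a t) (b t))).add
      (integrable_const (g (s t.castSucc) (a t) (b t) (s t.succ))) :)
  refine ⟨h1, h2.trans ?_⟩
  have h3 : ∀ s a b, ∫ r, f (s t.castSucc) (a t) (b t) * r t +
      g (s t.castSucc) (a t) (b t) (s t.succ) ∂(G.rewardLaw s a b) =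
      f (s t.castSucc) (a t) (b t) * G.toModel.R (s t.castSucc) (a t) (b t) +
      g (s t.castSucc) (a t) (b t) (s t.succ) := fun s a b => by
    rw [integral_add ((integrable_reward h_reward s a b t).const_mul _) (integrable_const _),
      integral_const_mul, integral_reward]
    simp
  simp only [h3]
  refine (G.sum_pathWeight π le_rfl t fun s a b s' => f s a b * G.toModel.R s a b +
    g s a b s').trans ?_
  simp only [mul_add, Finset.sum_add_distrib, ← Finset.sum_mul, G.PT_sum, one_mul]

end Expectation

/-! ### Bellman equations and absolute continuity -/

section Bellman

variable {T : ℕ} {S A₁ A₂ : Type*} [Fintype S] [Fintype A₁] [Fintype A₂]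

lemma Model.V_eq_sum_Q (M : Model S A₁ A₂) (γ : ℝ) (π : Profile T S A₁ A₂) {t : ℕ} (ht : t < T)
    (s : S) : M.V γ π t s = ∑ a, ∑ b, π.p t s a b * M.Q γ π t s a b := by
  obtain ⟨k, rfl⟩ : ∃ k, T = t + (k + 1) := ⟨T - t - 1, by omega⟩
  have h1 : t + (k + 1) - t = k + 1 := by omega
  have h2 : t + (k + 1) - (k + 1) = t := by omega
  have h3 : t + (k + 1) - (t + 1) = k := by omega
  simp only [Model.V, Model.Q, h1, h3, Model.valueToGo, h2]

lemma Model.V_horizon (M : Model S A₁ A₂) (γ : ℝ) (π : Profile T S A₁ A₂) (s : S) :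
    M.V γ π T s = 0 := by
  simp [Model.V, Model.valueToGo]

/-- `π` plays only action pairs that `πb` plays with positive probability. -/
def Profile.AbsCont (π πb : Profile T S A₁ A₂) : Prop :=
  ∀ t s a b, πb.p t s a b = 0 → π.p t s a b = 0

lemma Profile.absCont_of_le {π πb : Profile T S A₁ A₂} {c : ℝ}
    (h : ∀ (t : Fin T) s a b, Profile.p π t s a b ≤ c * πb.p t s a b) : π.AbsCont πb := by
  intro t s a b h0
  by_cases ht : t < T
  · have := h ⟨t, ht⟩ s a b
    simp only [h0, mul_zero] at this
    exact le_antisymm this (π.p_nonneg _ _ _ _)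
  · simp [Profile.p, Policy.p, ht]

lemma Profile.AbsCont.pos {π πb : Profile T S A₁ A₂} (h : π.AbsCont πb) {t : ℕ} {s : S} {a : A₁}
    {b : A₂} (h0 : π.p t s a b ≠ 0) : 0 < πb.p t s a b :=
  (πb.p_nonneg _ _ _ _).lt_of_ne' fun h1 => h0 (h t s a b h1)

lemma Profile.AbsCont.stateOcc_eq_zero {π πb : Profile T S A₁ A₂} (h : π.AbsCont πb)
    (G : Game S A₁ A₂) {t : ℕ} {s : S} (h0 : G.toModel.stateOcc πb t s = 0) :
    G.toModel.stateOcc π t s = 0 := by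
  induction t generalizing s with
  | zero => exact h0
  | succ t ih =>
    rw [Model.stateOcc_succ]
    refine Finset.sum_eq_zero fun x _ => Finset.sum_eq_zero fun a _ => Finset.sum_eq_zero
      fun b _ => ?_
    have h1 : G.PT x a b s * G.toModel.occ πb t x a b = 0 :=
      le_antisymm (h0 ▸ G.mul_occ_le_stateOcc_succ πb t x a b s)
        (mul_nonneg (G.PT_nonneg _ _ _ _) (G.occ_nonneg _ _ _ _ _))
    rcases mul_eq_zero.1 h1 with h2 | h2
    · exact mul_eq_zero_of_left h2 _
    · rcases mul_eq_zero.1 h2 with h3 | h3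
      · exact mul_eq_zero_of_right _ (mul_eq_zero_of_left (h t x a b h3) _)
      · exact mul_eq_zero_of_right _ (mul_eq_zero_of_right _ (ih h3))

lemma Profile.AbsCont.occ_eq_zero {π πb : Profile T S A₁ A₂} (h : π.AbsCont πb)
    (G : Game S A₁ A₂) {t : ℕ} {s : S} {a : A₁} {b : A₂} (h0 : G.toModel.occ πb t s a b = 0) :
    G.toModel.occ π t s a b = 0 := by
  rcases mul_eq_zero.1 h0 with h1 | h1
  · exact mul_eq_zero_of_left (h t s a b h1) _
  · exact mul_eq_zero_of_right _ (h.stateOcc_eq_zero G h1)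

lemma Profile.AbsCont.occ_mul_ratio {π πb : Profile T S A₁ A₂} (h : π.AbsCont πb)
    (G : Game S A₁ A₂) (t : Fin T) (s : S) (a : A₁) (b : A₂) :
    G.toModel.occ πb t s a b * G.ratio πb π t s a b = G.toModel.occ π t s a b := by
  by_cases h0 : G.toModel.occ πb t s a b = 0
  · rw [h0, zero_mul, h.occ_eq_zero G h0]
  · rw [Game.ratio, mul_div_cancel₀ _ h0]

end Bellman

/-! ### The mean of the score and double robustness -/

section DoubleRobust

variable {T : ℕ} {S A₁ A₂ : Type*} [Fintype S] [Fintype A₁] [Fintype A₂]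

open Classical in
/-- The total deviation of two families of functions on the support of the behavior profile. -/
noncomputable def Game.supportDist (G : Game S A₁ A₂) (πb : Profile T S A₁ A₂)
    (f g : Fin T → S → A₁ → A₂ → ℝ) : ℝ :=
  ∑ t : Fin T, ∑ s, ∑ a, ∑ b, if 0 < G.toModel.occ πb t s a b then |f t s a b - g t s a b| else 0

lemma Game.supportDist_term_nonneg (G : Game S A₁ A₂) (πb : Profile T S A₁ A₂)
    (f g : Fin T → S → A₁ → A₂ → ℝ) (t : Fin T) (s : S) (a : A₁) (b : A₂) [d : Decidable _] :
    0 ≤ @ite _ (0 < G.toModel.occ πb t s a b) d |f t s a b - g t s a b| 0 := by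
  split_ifs
  exacts [abs_nonneg _, le_rfl]

lemma Game.supportDist_nonneg (G : Game S A₁ A₂) (πb : Profile T S A₁ A₂)
    (f g : Fin T → S → A₁ → A₂ → ℝ) : 0 ≤ G.supportDist πb f g := by
  classical
  exact Finset.sum_nonneg fun t _ => Finset.sum_nonneg fun s _ => Finset.sum_nonneg fun a _ =>
    Finset.sum_nonneg fun b _ => G.supportDist_term_nonneg πb f g t s a b

open Classical in
lemma Game.sum_le_supportDist (G : Game S A₁ A₂) (πb : Profile T S A₁ A₂)
    (f g : Fin T → S → A₁ → A₂ → ℝ) (t : Fin T) :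
    ∑ s, ∑ a, ∑ b, (if 0 < G.toModel.occ πb t s a b then |f t s a b - g t s a b| else 0) ≤
      G.supportDist πb f g :=
  Finset.single_le_sum (f := fun t : Fin T => ∑ s, ∑ a, ∑ b,
    (if 0 < G.toModel.occ πb t s a b then |f t s a b - g t s a b| else 0))
    (fun t _ => Finset.sum_nonneg fun s _ => Finset.sum_nonneg fun a _ =>
    Finset.sum_nonneg fun b _ => G.supportDist_term_nonneg πb f g t s a b) (Finset.mem_univ t)

lemma Game.abs_sub_le_supportDist (G : Game S A₁ A₂) (πb : Profile T S A₁ A₂)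
    (f g : Fin T → S → A₁ → A₂ → ℝ) {t : Fin T} {s : S} {a : A₁} {b : A₂}
    (h : 0 < G.toModel.occ πb t s a b) : |f t s a b - g t s a b| ≤ G.supportDist πb f g := by
  classical
  refine le_trans ?_ (G.sum_le_supportDist πb f g t)
  have h0 := G.supportDist_term_nonneg πb f g t
  refine le_trans ?_ (Finset.single_le_sum (fun s _ => Finset.sum_nonneg fun a _ =>
    Finset.sum_nonneg fun b _ => h0 s a b) (Finset.mem_univ s))
  refine le_trans ?_ (Finset.single_le_sum (fun a _ => Finset.sum_nonneg fun b _ => h0 s a b)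
    (Finset.mem_univ a))
  refine le_trans ?_ (Finset.single_le_sum (fun b _ => h0 s a b) (Finset.mem_univ b))
  rw [if_pos h]

/-- The state weights at step `t` that arise from the behavior profile when the previous step is
reweighted by `m`; there is nothing to reweight at the first step. -/
noncomputable def Game.reweighted (G : Game S A₁ A₂) (πb : Profile T S A₁ A₂)
    (m : Fin T → S → A₁ → A₂ → ℝ) : ℕ → S → ℝ
  | 0 => G.PI
  | t + 1 => fun s' => ∑ s, ∑ a, ∑ b, G.toModel.occ πb t s a b *
      (if h : t < T then m ⟨t, h⟩ s a b else 0) * G.PT s a b s'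

/-- The mean of the score with weights `m` and candidate value functions `q` and `w` under
the behavior profile. -/
noncomputable def Game.scoreMean (G : Game S A₁ A₂) (πb : Profile T S A₁ A₂)
    (m : Fin T → S → A₁ → A₂ → ℝ) (q : ℕ → S → A₁ → A₂ → ℝ) (w : ℕ → S → ℝ) : ℝ :=
  ∑ t : Fin T, G.γ ^ (t : ℕ) *
    ((∑ s, ∑ a, ∑ b, G.toModel.occ πb t s a b * m t s a b * (G.toModel.R s a b - q t s a b)) +
      ∑ s, G.reweighted πb m t s * w t s)

lemma Game.sum_reweighted_succ (G : Game S A₁ A₂) (πb : Profile T S A₁ A₂)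
    (m : Fin T → S → A₁ → A₂ → ℝ) (t : Fin T) (w : S → ℝ) :
    ∑ s, G.reweighted πb m (t + 1) s * w s = ∑ s, ∑ a, ∑ b, G.toModel.occ πb t s a b *
      m t s a b * ∑ s', G.PT s a b s' * w s' := by
  simp only [Game.reweighted, Finset.sum_mul, Finset.mul_sum]
  rw [Finset.sum_comm]
  refine Finset.sum_congr rfl fun s _ => ?_
  rw [sum_rotate]
  refine Finset.sum_congr rfl fun a _ => Finset.sum_congr rfl fun b _ =>
    Finset.sum_congr rfl fun s' _ => ?_
  rw [dif_pos t.isLt, mul_assoc]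

/-- With the true value functions the mean of the score telescopes, whatever the weights. -/
lemma Game.scoreMean_true (G : Game S A₁ A₂) (πb π : Profile T S A₁ A₂)
    (m : Fin T → S → A₁ → A₂ → ℝ) :
    G.scoreMean πb m (G.toModel.Q G.γ π) (G.toModel.V G.γ π) =
      ∑ s, G.PI s * G.toModel.V G.γ π 0 s := by
  set A : ℕ → ℝ := fun t => G.γ ^ t * ∑ s, G.reweighted πb m t s * G.toModel.V G.γ π t s with hA
  have h1 : ∀ t : Fin T, G.γ ^ (t : ℕ) *
    ((∑ s, ∑ a, ∑ b, G.toModel.occ πb t s a b * m t s a b *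
      (G.toModel.R s a b - G.toModel.Q G.γ π t s a b)) +
      ∑ s, G.reweighted πb m t s * G.toModel.V G.γ π t s) = A t - A (t + 1) := by
    intro t
    have h2 : ∑ s, ∑ a, ∑ b, G.toModel.occ πb t s a b * m t s a b *
        (G.toModel.R s a b - G.toModel.Q G.γ π t s a b) =
        -(G.γ * ∑ s, G.reweighted πb m (t + 1) s * G.toModel.V G.γ π (t + 1) s) := by
      rw [G.sum_reweighted_succ]
      simp only [Finset.mul_sum, ← Finset.sum_neg_distrib]
      refine Finset.sum_congr rfl fun s _ => Finset.sum_congr rfl fun a _ =>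
        Finset.sum_congr rfl fun b _ => ?_
      rw [Model.Q, Finset.sum_neg_distrib, ← Finset.mul_sum, ← Finset.mul_sum]
      change _ * (_ - (_ + _ * ∑ s', G.PT s a b s' * _)) = _
      ring
    rw [h2]
    simp only [hA, pow_succ]
    ring
  rw [Game.scoreMean, Finset.sum_congr rfl fun t _ => h1 t,
    Fin.sum_univ_eq_sum_range fun t => A t - A (t + 1), Finset.sum_range_sub']
  simp [hA, Model.V_horizon, Game.reweighted]

lemma Profile.AbsCont.reweighted_ratio {π πb : Profile T S A₁ A₂} (h : π.AbsCont πb)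
    (G : Game S A₁ A₂) {t : ℕ} (ht : t < T) (s : S) :
    G.reweighted πb (G.ratio πb π) t s = G.toModel.stateOcc π t s := by
  cases t with
  | zero => rfl
  | succ t =>
    rw [Model.stateOcc_succ, Game.reweighted]
    refine Finset.sum_congr rfl fun x _ => Finset.sum_congr rfl fun a _ =>
      Finset.sum_congr rfl fun b _ => ?_
    rw [dif_pos (by omega : t < T), h.occ_mul_ratio G ⟨t, by omega⟩ x a b, mul_comm]
    rfl

lemma Game.sum_occ_mul (G : Game S A₁ A₂) (π : Profile T S A₁ A₂) (t : ℕ)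
    (f : S → A₁ → A₂ → ℝ) :
    ∑ s, ∑ a, ∑ b, G.toModel.occ π t s a b * f s a b =
      ∑ s, G.toModel.stateOcc π t s * ∑ a, ∑ b, π.p t s a b * f s a b := by
  simp only [Finset.mul_sum, Model.occ]
  refine Finset.sum_congr rfl fun s _ => Finset.sum_congr rfl fun a _ =>
      Finset.sum_congr rfl fun b _ => ?_
  ring

/-- If every `w` is the `π`-average of `q`, the mean of the score with the true density ratio is
the value of `π`, whatever `q`. -/
lemma Profile.AbsCont.scoreMean_ratio {π πb : Profile T S A₁ A₂} (h : π.AbsCont πb)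
    (G : Game S A₁ A₂) {q : ℕ → S → A₁ → A₂ → ℝ} {w : ℕ → S → ℝ}
    (hw : ∀ t < T, ∀ s, w t s = ∑ a, ∑ b, π.p t s a b * q t s a b) :
    G.scoreMean πb (G.ratio πb π) q w =
      ∑ t : Fin T, G.γ ^ (t : ℕ) * ∑ s, ∑ a, ∑ b, G.toModel.occ π t s a b * G.toModel.R s a b := by
  refine Finset.sum_congr rfl fun t _ => congrArg _ ?_
  simp only [h.occ_mul_ratio, h.reweighted_ratio G t.isLt, mul_sub, Finset.sum_sub_distrib]
  simp only [G.sum_occ_mul π t (q t), ← hw t t.isLt, sub_add_cancel]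

lemma Game.abs_V_sub_le (G : Game S A₁ A₂) {πb π : Profile T S A₁ A₂} (h : π.AbsCont πb)
    (M : Model S A₁ A₂) {γ : ℝ} {t : ℕ} (ht : t < T) {s : S}
    (hs : 0 < G.toModel.stateOcc πb t s) :
    |M.V γ π t s - G.toModel.V γ π t s| ≤
      G.supportDist πb (fun t => M.Q γ π t) (fun t => G.toModel.Q γ π t) := by
  set D := G.supportDist πb (fun t => M.Q γ π t) (fun t => G.toModel.Q γ π t) with hD
  have h1 : M.V γ π t s - G.toModel.V γ π t s =
      ∑ a, ∑ b, π.p t s a b * (M.Q γ π t s a b - G.toModel.Q γ π t s a b) := by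
    rw [M.V_eq_sum_Q γ π ht, G.toModel.V_eq_sum_Q γ π ht]
    simp only [mul_sub, Finset.sum_sub_distrib]
  rw [h1]
  calc _ ≤ ∑ a, ∑ b, π.p t s a b * D := by
        refine (Finset.abs_sum_le_sum_abs _ _).trans (Finset.sum_le_sum fun a _ =>
          (Finset.abs_sum_le_sum_abs _ _).trans (Finset.sum_le_sum fun b _ => ?_))
        rw [abs_mul, abs_of_nonneg (π.p_nonneg _ _ _ _)]
        by_cases h0 : π.p t s a b = 0
        · simp [h0]
        · exact mul_le_mul_of_nonneg_left (G.abs_sub_le_supportDist πb (fun t => M.Q γ π t)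
            (fun t => G.toModel.Q γ π t) (t := ⟨t, ht⟩) (mul_pos (h.pos h0) hs))
            (π.p_nonneg _ _ _ _)
    _ = D := by
        simp only [← Finset.sum_mul]
        rw [π.sum_p ht, one_mul]

/-- Double robustness: the bias of the score is at most a multiple of the product of the errors
of the density ratio and of the value function. -/
lemma Game.abs_scoreMean_sub_le (G : Game S A₁ A₂) {πb π : Profile T S A₁ A₂}
    (h : π.AbsCont πb) (M : Model S A₁ A₂) (m : Fin T → S → A₁ → A₂ → ℝ) :
    |G.scoreMean πb m (M.Q G.γ π) (M.V G.γ π) - ∑ s, G.PI s * G.toModel.V G.γ π 0 s| ≤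
      2 * T * (G.supportDist πb m (G.ratio πb π) *
        G.supportDist πb (fun t => M.Q G.γ π t) (fun t => G.toModel.Q G.γ π t)) := by
  classical
  set μ := G.ratio πb π with hμ
  set D := G.supportDist πb m μ with hD
  set E := G.supportDist πb (fun t => M.Q G.γ π t) (fun t => G.toModel.Q G.γ π t) with hE
  have hE0 : 0 ≤ E := G.supportDist_nonneg _ _ _
  -- the error is a sum of products of a weight error and a value error: the terms that are linear
  -- in only one of the errors cancel
  have h1 : G.scoreMean πb m (M.Q G.γ π) (M.V G.γ π) - ∑ s, G.PI s * G.toModel.V G.γ π 0 s =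
      ∑ t : Fin T, G.γ ^ (t : ℕ) *
        ((∑ s, ∑ a, ∑ b, G.toModel.occ πb t s a b * (m t s a b - μ t s a b) *
            -(M.Q G.γ π t s a b - G.toModel.Q G.γ π t s a b)) +
          ∑ s, (G.reweighted πb m t s - G.reweighted πb μ t s) *
            (M.V G.γ π t s - G.toModel.V G.γ π t s)) := by
    have h2 := h.scoreMean_ratio G fun t ht s => M.V_eq_sum_Q G.γ π ht s
    have h3 := h.scoreMean_ratio G fun t ht s => G.toModel.V_eq_sum_Q G.γ π ht s
    have h4 : G.scoreMean πb m (M.Q G.γ π) (M.V G.γ π) - ∑ s, G.PI s * G.toModel.V G.γ π 0 s =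
      (G.scoreMean πb m (M.Q G.γ π) (M.V G.γ π) -
        G.scoreMean πb m (G.toModel.Q G.γ π) (G.toModel.V G.γ π)) -
      (G.scoreMean πb μ (M.Q G.γ π) (M.V G.γ π) -
        G.scoreMean πb μ (G.toModel.Q G.γ π) (G.toModel.V G.γ π)) := by
      rw [h2, h3, G.scoreMean_true]; ring
    rw [h4]
    simp only [Game.scoreMean, ← Finset.sum_sub_distrib, ← mul_sub]
    refine Finset.sum_congr rfl fun t _ => congrArg _ ?_
    simp only [add_sub_add_comm, ← Finset.sum_sub_distrib]
    congr 1
    · refine Finset.sum_congr rfl fun s _ => Finset.sum_congr rfl fun a _ =>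
        Finset.sum_congr rfl fun b _ => ?_
      ring
    · refine Finset.sum_congr rfl fun s _ => ?_
      ring
  have hpos : ∀ {t s a b}, ¬ 0 < G.toModel.occ πb t s a b → G.toModel.occ πb t s a b = 0 :=
    fun h => le_antisymm (not_lt.1 h) (G.occ_nonneg _ _ _ _ _)
  have hA : ∀ t : Fin T, |∑ s, ∑ a, ∑ b, G.toModel.occ πb t s a b * (m t s a b - μ t s a b) *
      -(M.Q G.γ π t s a b - G.toModel.Q G.γ π t s a b)| ≤ D * E := by
    intro t
    refine le_trans ?_ (mul_le_mul_of_nonneg_right (G.sum_le_supportDist πb m μ t) hE0)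
    simp only [Finset.sum_mul]
    refine (Finset.abs_sum_le_sum_abs _ _).trans (Finset.sum_le_sum fun s _ =>
      (Finset.abs_sum_le_sum_abs _ _).trans (Finset.sum_le_sum fun a _ =>
      (Finset.abs_sum_le_sum_abs _ _).trans (Finset.sum_le_sum fun b _ => ?_)))
    split_ifs with h0
    · rw [abs_mul, abs_mul, abs_neg]
      refine mul_le_mul ?_ (G.abs_sub_le_supportDist πb (fun t => M.Q G.γ π t)
            (fun t => G.toModel.Q G.γ π t) h0) (abs_nonneg _) (abs_nonneg _)
      rw [abs_of_pos h0]
      exact mul_le_of_le_one_left (abs_nonneg _) (G.occ_le_one πb t.isLt.le s a b)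
    · simp [hpos h0]
  have hB : ∀ t : Fin T, |∑ s, (G.reweighted πb m t s - G.reweighted πb μ t s) *
      (M.V G.γ π t s - G.toModel.V G.γ π t s)| ≤ D * E := by
    intro t
    obtain ⟨t, ht⟩ := t
    cases t with
    | zero => simpa [Game.reweighted] using mul_nonneg (G.supportDist_nonneg _ _ _) hE0
    | succ t =>
      set u : Fin T := ⟨t, by omega⟩ with hu
      have h5 := G.sum_reweighted_succ πb m u fun s => M.V G.γ π (t + 1) s - G.toModel.V G.γ π (t + 1) s
      have h6 := G.sum_reweighted_succ πb μ u fun s => M.V G.γ π (t + 1) s - G.toModel.V G.γ π (t + 1) s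
      simp only [sub_mul, Finset.sum_sub_distrib]
      simp only [hu] at h5 h6
      rw [h5, h6]
      simp only [← Finset.sum_sub_distrib, ← sub_mul, ← mul_sub]
      refine le_trans ?_ (mul_le_mul_of_nonneg_right (G.sum_le_supportDist πb m μ u) hE0)
      simp only [Finset.sum_mul]
      refine (Finset.abs_sum_le_sum_abs _ _).trans (Finset.sum_le_sum fun s _ =>
        (Finset.abs_sum_le_sum_abs _ _).trans (Finset.sum_le_sum fun a _ =>
        (Finset.abs_sum_le_sum_abs _ _).trans (Finset.sum_le_sum fun b _ => ?_)))
      split_ifs with h0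
      · rw [abs_mul, abs_mul]
        refine mul_le_mul ?_ ?_ (abs_nonneg _) (abs_nonneg _)
        · rw [abs_of_pos h0]
          exact mul_le_of_le_one_left (abs_nonneg _) (G.occ_le_one πb (by omega) s a b)
        · calc _ ≤ ∑ s', G.PT s a b s' * E := by
                refine (Finset.abs_sum_le_sum_abs _ _).trans (Finset.sum_le_sum fun s' _ => ?_)
                rw [abs_mul, abs_of_nonneg (G.PT_nonneg _ _ _ _)]
                by_cases h7 : G.PT s a b s' = 0
                · simp [h7]
                · have h8 := (G.PT_nonneg s a b s').lt_of_ne' h7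
                  exact mul_le_mul_of_nonneg_left (G.abs_V_sub_le h M ht (lt_of_lt_of_le
                    (mul_pos h8 h0) (G.mul_occ_le_stateOcc_succ πb t s a b s'))) h8.le
            _ = E := by rw [← Finset.sum_mul, G.PT_sum, one_mul]
      · rw [show G.toModel.occ πb t s a b = 0 from hpos h0]
        simp
  rw [h1]
  calc _ ≤ ∑ _t : Fin T, (2 * (D * E)) := by
        refine (Finset.abs_sum_le_sum_abs _ _).trans (Finset.sum_le_sum fun t _ => ?_)
        rw [abs_mul, abs_of_nonneg (pow_nonneg G.γ_nonneg _)]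
        refine (mul_le_of_le_one_left (abs_nonneg _)
          (pow_le_one₀ G.γ_nonneg G.γ_le_one)).trans ((abs_add_le _ _).trans ?_)
        linarith [hA t, hB t]
    _ = 2 * T * (D * E) := by simp; ring

end DoubleRobust

section ScoreIntegral

variable {T : ℕ} {S A₁ A₂ : Type*} [Fintype S] [Fintype A₁] [Fintype A₂]
  [MeasurableSpace S] [DiscreteMeasurableSpace S]
  [MeasurableSpace A₁] [DiscreteMeasurableSpace A₁]
  [MeasurableSpace A₂] [DiscreteMeasurableSpace A₂]
  {G : Game S A₁ A₂} {Rmax : ℝ}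

/-- The weight that the score attaches to the value function at step `t`. -/
noncomputable def prevWeight (m : Fin T → S → A₁ → A₂ → ℝ) (t : Fin T) (τ : Traj T S A₁ A₂) : ℝ :=
  if (t : ℕ) = 0 then 1 else
    let u : Fin T := ⟨t - 1, lt_of_le_of_lt (Nat.sub_le _ _) t.isLt⟩
    m u (τ.1 u.castSucc) (τ.2.1 u) (τ.2.2.1 u)

lemma drlScore_eq (M : Model S A₁ A₂) (γ : ℝ) (π : Profile T S A₁ A₂)
    (m : Fin T → S → A₁ → A₂ → ℝ) (τ : Traj T S A₁ A₂) :
    drlScore M γ π m τ = ∑ t : Fin T, γ ^ (t : ℕ) *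
      (m t (τ.1 t.castSucc) (τ.2.1 t) (τ.2.2.1 t) *
        (τ.2.2.2 t - M.Q γ π t (τ.1 t.castSucc) (τ.2.1 t) (τ.2.2.1 t)) +
        prevWeight m t τ * M.V γ π t (τ.1 t.castSucc)) := rfl

lemma prevWeight_zero (m : Fin T → S → A₁ → A₂ → ℝ) (h : 0 < T) (τ : Traj T S A₁ A₂) :
    prevWeight m ⟨0, h⟩ τ = 1 := if_pos rfl

lemma prevWeight_succ (m : Fin T → S → A₁ → A₂ → ℝ) {t : ℕ} (h : t + 1 < T)
    (τ : Traj T S A₁ A₂) :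
    prevWeight m ⟨t + 1, h⟩ τ = m ⟨t, by omega⟩ (τ.1 (Fin.castSucc ⟨t, by omega⟩))
      (τ.2.1 ⟨t, by omega⟩) (τ.2.2.1 ⟨t, by omega⟩) := if_neg (Nat.succ_ne_zero t)

lemma measurable_drlScore (M : Model S A₁ A₂) (γ : ℝ) (π : Profile T S A₁ A₂)
    (m : Fin T → S → A₁ → A₂ → ℝ) : Measurable (drlScore M γ π m) := by
  refine measurable_traj fun s a b => ?_
  have affine : ∀ (t : Fin T) (c₁ c₂ c₃ c₄ : ℝ),
      Measurable fun r : Fin T → ℝ => c₁ * (c₂ * (r t - c₃) + c₄) := by fun_prop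
  exact Finset.measurable_sum _ fun t _ => affine t (γ ^ (t : ℕ))
    (m t (s t.castSucc) (a t) (b t)) (M.Q γ π t (s t.castSucc) (a t) (b t))
    (prevWeight m t (s, a, b, fun _ => 0) * M.V γ π t (s t.castSucc))

lemma integral_prevWeight (h_reward : ∀ s a b, ∀ᵐ r ∂(G.PR s a b), |r| ≤ Rmax)
    (πb : Profile T S A₁ A₂) (m : Fin T → S → A₁ → A₂ → ℝ) (t : Fin T) (w : S → ℝ) :
    Integrable (fun τ => prevWeight m t τ * w (τ.1 t.castSucc)) (G.trajLaw πb) ∧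
    ∫ τ, prevWeight m t τ * w (τ.1 t.castSucc) ∂(G.trajLaw πb) =
      ∑ s, G.reweighted πb m t s * w s := by
  obtain ⟨t, ht⟩ := t
  cases t with
  | zero =>
    have h := integral_step h_reward πb ⟨0, ht⟩ (fun _ _ _ => 0) (fun s _ _ _ => w s)
    simp only [zero_mul, zero_add, ← Finset.sum_mul, G.PT_sum, one_mul] at h
    simp only [prevWeight_zero, one_mul]
    refine ⟨h.1, h.2.trans ?_⟩
    simp only [← Finset.sum_mul, Model.occ, πb.sum_p ht, one_mul]
    rfl
  | succ t =>
    have h := integral_step h_reward πb ⟨t, by omega⟩ (fun _ _ _ => 0)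
      (fun s a b s' => m ⟨t, by omega⟩ s a b * w s')
    simp only [zero_mul, zero_add] at h
    simp only [prevWeight_succ]
    refine ⟨h.1, h.2.trans ?_⟩
    refine Eq.trans ?_ (G.sum_reweighted_succ πb m ⟨t, by omega⟩ w).symm
    refine Finset.sum_congr rfl fun s _ => Finset.sum_congr rfl fun a _ =>
      Finset.sum_congr rfl fun b _ => ?_
    simp only [Finset.mul_sum]
    refine Finset.sum_congr rfl fun s' _ => ?_
    ring

lemma integral_drlScore (h_reward : ∀ s a b, ∀ᵐ r ∂(G.PR s a b), |r| ≤ Rmax)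
    (πb π : Profile T S A₁ A₂) (M : Model S A₁ A₂) (m : Fin T → S → A₁ → A₂ → ℝ) :
    Integrable (drlScore M G.γ π m) (G.trajLaw πb) ∧
    ∫ τ, drlScore M G.γ π m τ ∂(G.trajLaw πb) =
      G.scoreMean πb m (M.Q G.γ π) (M.V G.γ π) := by
  have h1 := fun t : Fin T => integral_step h_reward πb t (m t)
    (fun s a b _ => - (m t s a b * M.Q G.γ π t s a b))
  have h2 := fun t : Fin T => integral_prevWeight h_reward πb m t (M.V G.γ π t)
  have h3 : drlScore M G.γ π m = fun τ => ∑ t : Fin T, G.γ ^ (t : ℕ) *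
      ((m t (τ.1 t.castSucc) (τ.2.1 t) (τ.2.2.1 t) * τ.2.2.2 t +
        -(m t (τ.1 t.castSucc) (τ.2.1 t) (τ.2.2.1 t) *
          M.Q G.γ π t (τ.1 t.castSucc) (τ.2.1 t) (τ.2.2.1 t))) +
        prevWeight m t τ * M.V G.γ π t (τ.1 t.castSucc)) := by
    funext τ
    rw [drlScore_eq]
    refine Finset.sum_congr rfl fun t _ => ?_
    ring
  simp only [h3]
  have h4 : ∀ t : Fin T, Integrable (fun τ : Traj T S A₁ A₂ => G.γ ^ (t : ℕ) *
      ((m t (τ.1 t.castSucc) (τ.2.1 t) (τ.2.2.1 t) * τ.2.2.2 t +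
        -(m t (τ.1 t.castSucc) (τ.2.1 t) (τ.2.2.1 t) *
          M.Q G.γ π t (τ.1 t.castSucc) (τ.2.1 t) (τ.2.2.1 t))) +
        prevWeight m t τ * M.V G.γ π t (τ.1 t.castSucc))) (G.trajLaw πb) :=
    fun t => ((h1 t).1.add (h2 t).1).const_mul (G.γ ^ (t : ℕ))
  refine ⟨integrable_finsetSum _ fun t _ => h4 t, ?_⟩
  rw [integral_finsetSum _ fun t _ => h4 t]
  refine Finset.sum_congr rfl fun t _ => ?_
  rw [integral_const_mul, integral_add (h1 t).1 (h2 t).1, (h1 t).2, (h2 t).2]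
  congr 2
  refine Finset.sum_congr rfl fun s _ => Finset.sum_congr rfl fun a _ =>
      Finset.sum_congr rfl fun b _ => ?_
  rw [← Finset.sum_mul, G.PT_sum]
  ring

lemma value_eq (h_reward : ∀ s a b, ∀ᵐ r ∂(G.PR s a b), |r| ≤ Rmax) (π : Profile T S A₁ A₂) :
    G.value π = ∑ s, G.PI s * G.toModel.V G.γ π 0 s := by
  have h1 := fun t : Fin T => integral_step h_reward π t (fun _ _ _ => 1) (fun _ _ _ _ => 0)
  simp only [one_mul, add_zero, mul_zero, Finset.sum_const_zero] at h1
  rw [Game.value, integral_finsetSum _ fun t _ => (h1 t).1.const_mul _]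
  simp only [integral_const_mul, (h1 _).2]
  have hself : π.AbsCont π := fun _ _ _ _ h => h
  rw [← hself.scoreMean_ratio G fun t ht s => G.toModel.V_eq_sum_Q G.γ π ht s, G.scoreMean_true]

lemma integral_drlScore_true (h_reward : ∀ s a b, ∀ᵐ r ∂(G.PR s a b), |r| ≤ Rmax)
    (πb π : Profile T S A₁ A₂) (m : Fin T → S → A₁ → A₂ → ℝ) :
    ∫ τ, drlScore G.toModel G.γ π m τ ∂(G.trajLaw πb) = G.value π := by
  rw [(integral_drlScore h_reward πb π _ m).2, G.scoreMean_true, value_eq h_reward]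

lemma exists_bound {ι : Type*} [Finite ι] (f : ι → ℝ) : ∃ B, 0 ≤ B ∧ ∀ i, |f i| ≤ B := by
  obtain ⟨B, hB⟩ := (Set.finite_range fun i => |f i|).bddAbove
  exact ⟨max B 0, le_max_right _ _, fun i => (hB ⟨i, rfl⟩).trans (le_max_left _ _)⟩

lemma exists_bound_fun (f : Fin T → S → A₁ → A₂ → ℝ) :
    ∃ B, 0 ≤ B ∧ ∀ t s a b, |f t s a b| ≤ B := by
  obtain ⟨B, h0, hB⟩ := exists_bound fun x : Fin T × S × A₁ × A₂ => f x.1 x.2.1 x.2.2.1 x.2.2.2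
  exact ⟨B, h0, fun t s a b => hB (t, s, a, b)⟩

lemma exists_bound_V (M : Model S A₁ A₂) (γ : ℝ) (π : Profile T S A₁ A₂) :
    ∃ B, 0 ≤ B ∧ ∀ (t : Fin T) s, |M.V γ π t s| ≤ B := by
  obtain ⟨B, h0, hB⟩ := exists_bound fun x : Fin T × S => M.V γ π x.1 x.2
  exact ⟨B, h0, fun t s => hB (t, s)⟩

lemma ae_abs_drlScore_le (h_reward : ∀ s a b, ∀ᵐ r ∂(G.PR s a b), |r| ≤ Rmax)
    (πb π : Profile T S A₁ A₂) (M : Model S A₁ A₂) (m : Fin T → S → A₁ → A₂ → ℝ) :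
    ∃ B, 0 ≤ B ∧ ∀ᵐ τ ∂(G.trajLaw πb), |drlScore M G.γ π m τ| ≤ B := by
  obtain ⟨Bm, hm0, hm⟩ := exists_bound_fun m
  obtain ⟨BQ, hQ0, hQ⟩ := exists_bound_fun fun t : Fin T => M.Q G.γ π t
  obtain ⟨BV, hV0, hV⟩ := exists_bound_V M G.γ π
  have hp : ∀ (t : Fin T) (τ : Traj T S A₁ A₂), |prevWeight m t τ| ≤ 1 + Bm := by
    intro t τ
    unfold prevWeight
    split_ifs
    · simpa using hm0
    · exact (hm _ _ _ _).trans (by linarith)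
  refine ⟨T * (Bm * (|Rmax| + BQ) + (1 + Bm) * BV), by positivity, ?_⟩
  filter_upwards [ae_trajLaw_good h_reward πb] with τ hτ
  rw [drlScore_eq]
  calc _ ≤ ∑ _t : Fin T, (Bm * (|Rmax| + BQ) + (1 + Bm) * BV) := by
        refine (Finset.abs_sum_le_sum_abs _ _).trans (Finset.sum_le_sum fun t _ => ?_)
        rw [abs_mul, abs_of_nonneg (pow_nonneg G.γ_nonneg _)]
        refine (mul_le_of_le_one_left (abs_nonneg _)
          (pow_le_one₀ G.γ_nonneg G.γ_le_one)).trans ((abs_add_le _ _).trans (add_le_add ?_ ?_))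
        · rw [abs_mul]
          refine mul_le_mul (hm _ _ _ _) ((abs_sub _ _).trans (add_le_add ?_ (hQ _ _ _ _)))
            (abs_nonneg _) hm0
          exact (hτ t).2.trans (le_abs_self _)
        · rw [abs_mul]
          exact mul_le_mul (hp t τ) (hV _ _) (abs_nonneg _) (by positivity)
    _ = _ := by simp; ring

/-- The score depends on the nuisance functions in a Lipschitz way, uniformly over weights that
are bounded on the support of the behavior profile. -/
lemma exists_lipschitz_drlScore (h_reward : ∀ s a b, ∀ᵐ r ∂(G.PR s a b), |r| ≤ Rmax)
    {πb π : Profile T S A₁ A₂} (h : π.AbsCont πb) (c : ℝ) :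
    ∃ B, 0 ≤ B ∧ ∀ (M : Model S A₁ A₂) (m : Fin T → S → A₁ → A₂ → ℝ),
      (∀ (t : Fin T) s a b, 0 < G.toModel.occ πb t s a b → |m t s a b| ≤ c) →
      ∀ᵐ τ ∂(G.trajLaw πb),
        |drlScore M G.γ π m τ - drlScore G.toModel G.γ π (G.ratio πb π) τ| ≤
        B * (G.supportDist πb m (G.ratio πb π) +
          G.supportDist πb (fun t => M.Q G.γ π t) (fun t => G.toModel.Q G.γ π t)) := by
  obtain ⟨BQ, hQ0, hQ⟩ := exists_bound_fun fun t : Fin T => G.toModel.Q G.γ π t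
  obtain ⟨BV, hV0, hV⟩ := exists_bound_V G.toModel G.γ π
  set μ := G.ratio πb π with hμ
  refine ⟨T * (|Rmax| + BQ + BV + (1 + 2 * |c|)), by positivity, fun M m hm => ?_⟩
  set D := G.supportDist πb m μ with hD
  set E := G.supportDist πb (fun t => M.Q G.γ π t) (fun t => G.toModel.Q G.γ π t) with hE
  have hD0 : 0 ≤ D := G.supportDist_nonneg _ _ _
  have hE0 : 0 ≤ E := G.supportDist_nonneg _ _ _
  filter_upwards [ae_trajLaw_good h_reward πb] with τ hτ
  have hocc := fun t => (hτ t).1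
  have hA : ∀ t : Fin T, |m t (τ.1 t.castSucc) (τ.2.1 t) (τ.2.2.1 t) *
        (τ.2.2.2 t - M.Q G.γ π t (τ.1 t.castSucc) (τ.2.1 t) (τ.2.2.1 t)) -
        μ t (τ.1 t.castSucc) (τ.2.1 t) (τ.2.2.1 t) *
        (τ.2.2.2 t - G.toModel.Q G.γ π t (τ.1 t.castSucc) (τ.2.1 t) (τ.2.2.1 t))| ≤
      D * (|Rmax| + BQ) + |c| * E := by
    intro t
    have h1 := G.abs_sub_le_supportDist πb m μ (hocc t)
    have h2 := G.abs_sub_le_supportDist πb (fun t => M.Q G.γ π t)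
      (fun t => G.toModel.Q G.γ π t) (hocc t)
    have h3 := (hm _ _ _ _ (hocc t)).trans (le_abs_self c)
    have h4 := (hτ t).2.trans (le_abs_self _)
    have h5 := hQ t (τ.1 t.castSucc) (τ.2.1 t) (τ.2.2.1 t)
    generalize m t (τ.1 t.castSucc) (τ.2.1 t) (τ.2.2.1 t) = x at *
    generalize μ t (τ.1 t.castSucc) (τ.2.1 t) (τ.2.2.1 t) = y at *
    generalize G.toModel.Q G.γ π t (τ.1 t.castSucc) (τ.2.1 t) (τ.2.2.1 t) = q at *
    generalize M.Q G.γ π t (τ.1 t.castSucc) (τ.2.1 t) (τ.2.2.1 t) = q' at *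
    rw [show x * (τ.2.2.2 t - q') - y * (τ.2.2.2 t - q) =
      (x - y) * (τ.2.2.2 t - q) - x * (q' - q) by ring]
    refine (abs_sub _ _).trans (add_le_add ?_ ?_)
    · rw [abs_mul]
      exact mul_le_mul h1 ((abs_sub _ _).trans (add_le_add h4 h5)) (abs_nonneg _) hD0
    · rw [abs_mul]
      exact mul_le_mul h3 h2 (abs_nonneg _) (abs_nonneg _)
  have hB : ∀ t : Fin T, |prevWeight m t τ * M.V G.γ π t (τ.1 t.castSucc) -
        prevWeight μ t τ * G.toModel.V G.γ π t (τ.1 t.castSucc)| ≤ D * BV + (1 + |c|) * E := by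
    intro t
    have h2 := G.abs_V_sub_le h M (γ := G.γ) t.isLt (s := τ.1 t.castSucc)
      ((G.stateOcc_nonneg _ _ _).lt_of_ne' (right_ne_zero_of_mul (hocc t).ne'))
    have h5 := hV t (τ.1 t.castSucc)
    have h6 : |prevWeight m t τ - prevWeight μ t τ| ≤ D ∧ |prevWeight m t τ| ≤ 1 + |c| := by
      unfold prevWeight
      split_ifs
      · simpa using hD0
      · refine ⟨G.abs_sub_le_supportDist πb m μ (hocc _), (hm _ _ _ _ (hocc _)).trans ?_⟩
        linarith [le_abs_self c]
    generalize prevWeight m t τ = x at *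
    generalize prevWeight μ t τ = y at *
    generalize G.toModel.V G.γ π t (τ.1 t.castSucc) = q at *
    generalize M.V G.γ π t (τ.1 t.castSucc) = q' at *
    rw [show x * q' - y * q = (x - y) * q + x * (q' - q) by ring]
    refine (abs_add_le _ _).trans (add_le_add ?_ ?_)
    · rw [abs_mul]
      exact mul_le_mul h6.1 h5 (abs_nonneg _) hD0
    · rw [abs_mul]
      exact mul_le_mul h6.2 h2 (abs_nonneg _) (by positivity)
  rw [drlScore_eq, drlScore_eq, ← Finset.sum_sub_distrib]
  calc _ ≤ ∑ _t : Fin T, ((|Rmax| + BQ + BV + (1 + 2 * |c|)) * (D + E)) := by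
        refine (Finset.abs_sum_le_sum_abs _ _).trans (Finset.sum_le_sum fun t _ => ?_)
        rw [← mul_sub, abs_mul, abs_of_nonneg (pow_nonneg G.γ_nonneg _)]
        refine (mul_le_of_le_one_left (abs_nonneg _) (pow_le_one₀ G.γ_nonneg G.γ_le_one)).trans ?_
        rw [add_sub_add_comm]
        refine (abs_add_le _ _).trans ((add_le_add (hA t) (hB t)).trans ?_)
        have e1 : 0 ≤ (|Rmax| + BQ + BV) * E := by positivity
        have e2 : 0 ≤ (1 + 2 * |c|) * D := by positivity
        linarith
    _ = _ := by simp; ring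

end ScoreIntegral

/-! ### Mean square rates -/

section Rates

variable {Ω : Type*} [MeasurableSpace Ω] {P : Measure Ω} {α : ℝ}

/-- A sequence of random variables that is `o(n ^ (-α))` in mean square. -/
def MeanSquareRate (P : Measure Ω) (X : ℕ → Ω → ℝ) (α : ℝ) : Prop :=
  (∀ n, Measurable (X n)) ∧ MeanSquareLittleO P X α

lemma MeanSquareRate.zero : MeanSquareRate P (fun _ _ => 0) α :=
  ⟨fun _ => measurable_const, by simp [MeanSquareLittleO]⟩

lemma MeanSquareRate.mono {X Y : ℕ → Ω → ℝ} (hX : MeanSquareRate P X α)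
    (hY : ∀ n, Measurable (Y n)) (h : ∀ n ω, |Y n ω| ≤ |X n ω|) : MeanSquareRate P Y α := by
  refine ⟨hY, tendsto_of_tendsto_of_tendsto_of_le_of_le tendsto_const_nhds hX.2
    (fun _ => zero_le) fun n => ?_⟩
  refine mul_le_mul_right (lintegral_mono ?_) _
  exact fun ω => ENNReal.ofReal_le_ofReal (sq_le_sq.2 (h n ω))

lemma MeanSquareRate.add {X Y : ℕ → Ω → ℝ} (hX : MeanSquareRate P X α)
    (hY : MeanSquareRate P Y α) : MeanSquareRate P (fun n ω => X n ω + Y n ω) α := by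
  refine ⟨fun n => (hX.1 n).add (hY.1 n), ?_⟩
  have h := (ENNReal.Tendsto.const_mul hX.2 (Or.inr (ENNReal.ofNat_ne_top (n := 2)))).add
    (ENNReal.Tendsto.const_mul hY.2 (Or.inr (ENNReal.ofNat_ne_top (n := 2))))
  simp only [mul_zero, add_zero] at h
  refine tendsto_of_tendsto_of_tendsto_of_le_of_le tendsto_const_nhds h (fun _ => zero_le)
    fun n => ?_
  have hm := ((hX.1 n).pow_const 2).ennreal_ofReal
  have hm' := ((hY.1 n).pow_const 2).ennreal_ofReal
  have h1 : ∫⁻ ω, ENNReal.ofReal ((X n ω + Y n ω) ^ 2) ∂P ≤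
      2 * ∫⁻ ω, ENNReal.ofReal (X n ω ^ 2) ∂P + 2 * ∫⁻ ω, ENNReal.ofReal (Y n ω ^ 2) ∂P := by
    rw [← lintegral_const_mul _ hm, ← lintegral_const_mul _ hm',
      ← lintegral_add_left (hm.const_mul 2)]
    refine lintegral_mono fun ω => ?_
    rw [← ENNReal.ofReal_ofNat 2, ← ENNReal.ofReal_mul (by norm_num),
      ← ENNReal.ofReal_mul (by norm_num), ← ENNReal.ofReal_add (by positivity) (by positivity)]
    exact ENNReal.ofReal_le_ofReal (by nlinarith [sq_nonneg (X n ω - Y n ω)])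
  calc _ ≤ _ * (_ + _) := mul_le_mul_right h1 _
    _ = _ := by ring

lemma MeanSquareRate.const_mul {X : ℕ → Ω → ℝ} (hX : MeanSquareRate P X α) (c : ℝ) :
    MeanSquareRate P (fun n ω => c * X n ω) α := by
  refine ⟨fun n => (hX.1 n).const_mul c, ?_⟩
  have h := ENNReal.Tendsto.const_mul hX.2 (Or.inr (ENNReal.ofReal_ne_top (r := c ^ 2)))
  simp only [mul_zero] at h
  refine h.congr fun n => ?_
  simp only [mul_pow, ENNReal.ofReal_mul (sq_nonneg c)]
  rw [lintegral_const_mul _ ((hX.1 n).pow_const 2).ennreal_ofReal]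
  ring

lemma MeanSquareRate.sum {ι : Type*} (s : Finset ι) {X : ι → ℕ → Ω → ℝ}
    (hX : ∀ i ∈ s, MeanSquareRate P (X i) α) :
    MeanSquareRate P (fun n ω => ∑ i ∈ s, X i n ω) α := by
  classical
  induction s using Finset.induction_on with
  | empty => simpa using MeanSquareRate.zero
  | insert i s hi ih =>
    simp only [Finset.sum_insert hi]
    exact (hX i (Finset.mem_insert_self i s)).add
      (ih fun j hj => hX j (Finset.mem_insert_of_mem hj))

lemma MeanSquareRate.abs {X : ℕ → Ω → ℝ} (hX : MeanSquareRate P X α) :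
    MeanSquareRate P (fun n ω => |X n ω|) α :=
  hX.mono (fun n => by simpa using (hX.1 n).norm) fun n ω => by rw [abs_abs]

end Rates

/-! ### Measurable dependence on the model -/

section MeasurableModel

variable {T : ℕ} {S A₁ A₂ : Type*} [Fintype S] [Fintype A₁] [Fintype A₂]
  {β : Type*} [MeasurableSpace β]

/-- All entries of a family of models are measurable functions of the parameter. -/
structure Model.MeasurableFamily (M : β → Model S A₁ A₂) : Prop where
  R : ∀ s a b, Measurable fun x => (M x).R s a b
  PI : ∀ s, Measurable fun x => (M x).PI s
  PT : ∀ s a b s', Measurable fun x => (M x).PT s a b s'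

variable {M : β → Model S A₁ A₂} (hM : Model.MeasurableFamily M) (π : Profile T S A₁ A₂)
include hM

lemma Model.MeasurableFamily.stateOcc (t : ℕ) (s : S) :
    Measurable fun x => (M x).stateOcc π t s := by
  induction t generalizing s with
  | zero => exact hM.PI s
  | succ t ih =>
    exact Finset.measurable_sum _ fun s' _ => Finset.measurable_sum _ fun a _ =>
      Finset.measurable_sum _ fun b _ => (hM.PT s' a b s).mul ((ih s').const_mul _)

lemma Model.MeasurableFamily.occ (t : ℕ) (s : S) (a : A₁) (b : A₂) :
    Measurable fun x => (M x).occ π t s a b := (hM.stateOcc π t s).const_mul _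

lemma Model.MeasurableFamily.valueToGo (γ : ℝ) (k : ℕ) (s : S) :
    Measurable fun x => (M x).valueToGo γ π k s := by
  induction k generalizing s with
  | zero => exact measurable_const
  | succ k ih =>
    exact Finset.measurable_sum _ fun a _ => Finset.measurable_sum _ fun b _ =>
      ((hM.R s a b).add ((Finset.measurable_sum _ fun s' _ =>
        (hM.PT s a b s').mul (ih s')).const_mul γ)).const_mul _

lemma Model.MeasurableFamily.V (γ : ℝ) (t : ℕ) (s : S) :
    Measurable fun x => (M x).V γ π t s := hM.valueToGo π γ _ s

lemma Model.MeasurableFamily.Q (γ : ℝ) (t : ℕ) (s : S) (a : A₁) (b : A₂) :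
    Measurable fun x => (M x).Q γ π t s a b :=
  (hM.R s a b).add ((Finset.measurable_sum _ fun s' _ =>
    (hM.PT s a b s').mul (hM.V π γ _ s')).const_mul γ)

end MeasurableModel

/-! ### Path expansions of occupancies and value functions -/

section Paths

variable {T : ℕ} {S A₁ A₂ : Type*} [Fintype S] [Fintype A₁] [Fintype A₂]

/-- The product of the transition probabilities of a path from step `i` to step `j`. -/
noncomputable def Model.segProb (M : Model S A₁ A₂) (i j : ℕ) (hj : j < T) (s : Fin T → S)
    (a : Fin T → A₁) (b : Fin T → A₂) : ℝ :=
  ∏ l : Fin T, if h : i ≤ (l : ℕ) ∧ (l : ℕ) < j then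
    M.PT (s l) (a l) (b l) (s ⟨l + 1, lt_of_le_of_lt h.2 hj⟩) else 1

lemma Model.segProb_self (M : Model S A₁ A₂) (j : ℕ) (hj : j < T) (s : Fin T → S)
    (a : Fin T → A₁) (b : Fin T → A₂) : M.segProb j j hj s a b = 1 :=
  Finset.prod_eq_one fun l _ => dif_neg (by omega)

lemma Model.pathProb_eq (M : Model S A₁ A₂) (t : Fin T) (s : Fin T → S)
    (a : Fin T → A₁) (b : Fin T → A₂) :
    M.pathProb t s a b = M.PI (s ⟨0, t.pos⟩) * M.segProb 0 t t.isLt s a b := by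
  refine congrArg _ (Finset.prod_congr rfl fun l _ => ?_)
  by_cases h : (l : ℕ) < t
  · rw [dif_pos h, dif_pos ⟨Nat.zero_le _, h⟩]
  · rw [dif_neg h, dif_neg fun h' => h h'.2]

lemma Model.rewardPath_eq (M : Model S A₁ A₂) (t t' : Fin T) (s : Fin T → S)
    (a : Fin T → A₁) (b : Fin T → A₂) :
    M.rewardPath t t' s a b = M.R (s t') (a t') (b t') * M.segProb t t' t'.isLt s a b := rfl

/-- Prepending a step to a path segment. -/
lemma Model.segProb_update_left (M : Model S A₁ A₂) {i j : ℕ} (hj : j < T) (hij : i < j)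
    (s : Fin T → S) (a : Fin T → A₁) (b : Fin T → A₂) (x : S) (a' : A₁) (b' : A₂) :
    M.segProb i j hj (Function.update s ⟨i, by omega⟩ x) (Function.update a ⟨i, by omega⟩ a')
        (Function.update b ⟨i, by omega⟩ b') =
      M.PT x a' b' (s ⟨i + 1, by omega⟩) * M.segProb (i + 1) j hj s a b := by
  classical
  have h1 : M.PT x a' b' (s ⟨i + 1, by omega⟩) =
      ∏ l : Fin T, if l = ⟨i, by omega⟩ then M.PT x a' b' (s ⟨i + 1, by omega⟩) else 1 := by
    rw [Finset.prod_ite_eq' Finset.univ (⟨i, by omega⟩ : Fin T)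
      fun _ => M.PT x a' b' (s ⟨i + 1, by omega⟩), if_pos (Finset.mem_univ _)]
  rw [h1, Model.segProb, Model.segProb, ← Finset.prod_mul_distrib]
  refine Finset.prod_congr rfl fun l _ => ?_
  by_cases hl : l = ⟨i, by omega⟩
  · subst hl
    rw [dif_pos ⟨le_rfl, hij⟩, if_pos rfl, dif_neg (by simp), mul_one]
    simp only [Function.update_self]
    rw [Function.update_of_ne (by simp)]
  · have hl' : (l : ℕ) ≠ i := fun h => hl (Fin.ext h)
    rw [if_neg hl, one_mul]
    by_cases h : i + 1 ≤ (l : ℕ) ∧ (l : ℕ) < j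
    · rw [dif_pos h, dif_pos ⟨by omega, h.2⟩, Function.update_of_ne hl, Function.update_of_ne hl,
        Function.update_of_ne hl, Function.update_of_ne]
      intro h2
      have := congrArg Fin.val h2
      simp only at this
      omega
    · rw [dif_neg h, dif_neg fun h2 => h ⟨by omega, h2.2⟩]

/-- Appending a step to a path segment. -/
lemma Model.segProb_update_right (M : Model S A₁ A₂) {i j : ℕ} (hj : j + 1 < T) (hij : i ≤ j)
    (s : Fin T → S) (a : Fin T → A₁) (b : Fin T → A₂) (x : S) (a' : A₁) (b' : A₂) :
    M.segProb i (j + 1) hj (Function.update s ⟨j + 1, hj⟩ x) (Function.update a ⟨j + 1, hj⟩ a')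
        (Function.update b ⟨j + 1, hj⟩ b') =
      M.segProb i j (by omega) s a b *
        M.PT (s ⟨j, by omega⟩) (a ⟨j, by omega⟩) (b ⟨j, by omega⟩) x := by
  classical
  have h1 : M.PT (s ⟨j, by omega⟩) (a ⟨j, by omega⟩) (b ⟨j, by omega⟩) x =
      ∏ l : Fin T, if l = ⟨j, by omega⟩ then
        M.PT (s ⟨j, by omega⟩) (a ⟨j, by omega⟩) (b ⟨j, by omega⟩) x else 1 := by
    rw [Finset.prod_ite_eq' Finset.univ (⟨j, by omega⟩ : Fin T)
      fun _ => M.PT (s ⟨j, by omega⟩) (a ⟨j, by omega⟩) (b ⟨j, by omega⟩) x,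
      if_pos (Finset.mem_univ _)]
  rw [h1, Model.segProb, Model.segProb, ← Finset.prod_mul_distrib]
  have hne : ∀ {l : Fin T}, (l : ℕ) ≤ j → l ≠ ⟨j + 1, hj⟩ := by
    intro l hl h2
    have := congrArg Fin.val h2
    simp only at this
    omega
  refine Finset.prod_congr rfl fun l _ => ?_
  by_cases hl : l = ⟨j, by omega⟩
  · subst hl
    rw [dif_pos ⟨hij, Nat.lt_succ_self j⟩, if_pos rfl, dif_neg (by simp), one_mul,
      Function.update_of_ne (hne le_rfl), Function.update_of_ne (hne le_rfl),
      Function.update_of_ne (hne le_rfl)]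
    simp only [Function.update_self]
  · have hl' : (l : ℕ) ≠ j := fun h => hl (Fin.ext h)
    rw [if_neg hl, mul_one]
    by_cases h : i ≤ (l : ℕ) ∧ (l : ℕ) < j
    · rw [dif_pos h, dif_pos ⟨h.1, by omega⟩, Function.update_of_ne (hne h.2.le),
        Function.update_of_ne (hne h.2.le), Function.update_of_ne (hne h.2.le),
        Function.update_of_ne (hne (by simp only; omega))]
    · rw [dif_neg h, dif_neg fun h2 => h ⟨h2.1, by omega⟩]

variable {Ω : Type*} [MeasurableSpace Ω] {P : Measure Ω} {α : ℝ} {G : Game S A₁ A₂}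
  {πb π : Profile T S A₁ A₂} {E : ℕ → Ω → Estimate T S A₁ A₂}

/-- The error of the occupancy of a state at step `j`, continued along a fixed path to step `t` and
divided by the behavior occupancy at its end, inherits the rate of the paths: induction on `j`, in
which the sum over the step `j` is written with updated paths. -/
lemma rate_stateOcc (h : π.AbsCont πb) (t : Fin T)
    (hrate : ∀ (s : Fin T → S) (a : Fin T → A₁) (b : Fin T → A₂),
      0 < G.toModel.occ πb t (s t) (a t) (b t) →
      (∀ l, l < t → 0 < πb.p l (s l) (a l) (b l)) →
      MeanSquareRate P (fun n ω => (E n ω).pathProb t s a b / (E n ω).pb t (s t) (a t) (b t)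
        - G.toModel.pathProb t s a b / G.toModel.occ πb t (s t) (a t) (b t)) α)
    {j : ℕ} (hj : j ≤ t) (s : Fin T → S) (a : Fin T → A₁) (b : Fin T → A₂)
    (h0 : 0 < G.toModel.occ πb t (s t) (a t) (b t))
    (h1 : ∀ l : Fin T, j ≤ l → l < t → 0 < πb.p l (s l) (a l) (b l)) :
    MeanSquareRate P (fun n ω =>
      (E n ω).stateOcc π j (s ⟨j, by omega⟩) * (E n ω).segProb j t t.isLt s a b /
          (E n ω).pb t (s t) (a t) (b t) -
        G.toModel.stateOcc π j (s ⟨j, by omega⟩) * G.toModel.segProb j t t.isLt s a b /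
          G.toModel.occ πb t (s t) (a t) (b t)) α := by
  induction j generalizing s a b with
  | zero =>
    have := hrate s a b h0 fun l hl => h1 l (Nat.zero_le _) hl
    simp only [Model.pathProb_eq] at this
    exact this
  | succ j ih =>
    have hjt : j < t := hj
    have hne : t ≠ ⟨j, by omega⟩ := fun h2 => by
      have := congrArg Fin.val h2
      simp only at this
      omega
    have hexp : ∀ (M : Model S A₁ A₂) (c : ℝ),
        M.stateOcc π (j + 1) (s ⟨j + 1, by omega⟩) * M.segProb (j + 1) t t.isLt s a b / c =
        ∑ x, ∑ a', ∑ b', π.p j x a' b' * (M.stateOcc π j x *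
          M.segProb j t t.isLt (Function.update s ⟨j, by omega⟩ x)
            (Function.update a ⟨j, by omega⟩ a') (Function.update b ⟨j, by omega⟩ b') / c) := by
      intro M c
      simp only [Model.stateOcc_succ, Model.occ, Finset.sum_mul, Finset.sum_div,
        M.segProb_update_left t.isLt hjt]
      refine Finset.sum_congr rfl fun x _ => Finset.sum_congr rfl fun a' _ =>
        Finset.sum_congr rfl fun b' _ => ?_
      ring
    simp only [hexp, ← Finset.sum_sub_distrib, ← mul_sub]
    refine MeanSquareRate.sum _ fun x _ => MeanSquareRate.sum _ fun a' _ =>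
      MeanSquareRate.sum _ fun b' _ => ?_
    by_cases hp : π.p j x a' b' = 0
    · simpa only [hp, zero_mul] using MeanSquareRate.zero
    · have := ih hjt.le (Function.update s ⟨j, by omega⟩ x)
        (Function.update a ⟨j, by omega⟩ a') (Function.update b ⟨j, by omega⟩ b')
        (by simpa only [Function.update_of_ne hne] using h0) (fun l hl hlt => by
          rcases hl.eq_or_lt with heq | hlt'
          · rw [show l = ⟨j, by omega⟩ from Fin.ext heq.symm]
            simp only [Function.update_self]
            exact h.pos hp
          · have hl2 : l ≠ ⟨j, by omega⟩ := fun h2 => by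
              have := congrArg Fin.val h2
              simp only at this
              omega
            simp only [Function.update_of_ne hl2]
            exact h1 l hlt' hlt)
      simp only [Function.update_of_ne hne, Function.update_self] at this
      exact this.const_mul _

lemma rate_ratio (h : π.AbsCont πb) (t : Fin T)
    (hrate : ∀ (s : Fin T → S) (a : Fin T → A₁) (b : Fin T → A₂),
      0 < G.toModel.occ πb t (s t) (a t) (b t) →
      (∀ l, l < t → 0 < πb.p l (s l) (a l) (b l)) →
      MeanSquareRate P (fun n ω => (E n ω).pathProb t s a b / (E n ω).pb t (s t) (a t) (b t)
        - G.toModel.pathProb t s a b / G.toModel.occ πb t (s t) (a t) (b t)) α)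
    {s : S} {a : A₁} {b : A₂} (h0 : 0 < G.toModel.occ πb t s a b) :
    MeanSquareRate P (fun n ω => (E n ω).ratio π t s a b - G.ratio πb π t s a b) α := by
  have h1 := (rate_stateOcc h t hrate le_rfl (fun _ => s) (fun _ => a) (fun _ => b) h0
    fun l h2 h3 => absurd h3 (by simpa using h2)).const_mul (π.p t s a b)
  simp only [Model.segProb_self, mul_one, mul_sub, ← mul_div_assoc] at h1
  exact h1

/-- The error of the value of the state-action triple at step `j` of a path, weighted with the path
from step `t` to step `j`, inherits the rate of the rewards along the paths: induction from the
horizon down to `j`. -/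
lemma rate_Q_segProb (h : π.AbsCont πb) (γ : ℝ) (t : Fin T)
    (hrate : ∀ (t' : Fin T), t ≤ t' → ∀ (s : Fin T → S) (a : Fin T → A₁) (b : Fin T → A₂),
      0 < G.toModel.occ πb t (s t) (a t) (b t) →
      (∀ l, t < l → l ≤ t' → 0 < πb.p l (s l) (a l) (b l)) →
      MeanSquareRate P (fun n ω => (E n ω).rewardPath t t' s a b
        - G.toModel.rewardPath t t' s a b) α)
    (d : ℕ) {j : ℕ} (hj : j + d + 1 = T) (htj : t ≤ j) (s : Fin T → S) (a : Fin T → A₁)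
    (b : Fin T → A₂) (h0 : 0 < G.toModel.occ πb t (s t) (a t) (b t))
    (h1 : ∀ l : Fin T, t < l → l ≤ j → 0 < πb.p l (s l) (a l) (b l)) :
    MeanSquareRate P (fun n ω =>
      (E n ω).Q γ π j (s ⟨j, by omega⟩) (a ⟨j, by omega⟩) (b ⟨j, by omega⟩) *
          (E n ω).segProb t j (by omega) s a b -
        G.toModel.Q γ π j (s ⟨j, by omega⟩) (a ⟨j, by omega⟩) (b ⟨j, by omega⟩) *
          G.toModel.segProb t j (by omega) s a b) α := by
  have hR := hrate ⟨j, by omega⟩ htj s a b h0 fun l hl hl' => h1 l hl hl'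
  simp only [Model.rewardPath_eq] at hR
  induction d generalizing j s a b with
  | zero =>
    have hV : ∀ (M : Model S A₁ A₂) s, M.V γ π (j + 1) s = 0 := fun M s => by
      have : j + 1 = T := hj
      rw [this, M.V_horizon]
    simpa only [Model.Q, hV, mul_zero, Finset.sum_const_zero, add_zero] using hR
  | succ d ih =>
    have hj1 : j + 1 < T := by omega
    have hne : t ≠ ⟨j + 1, hj1⟩ := fun h2 => by
      have := congrArg Fin.val h2
      simp only at this
      omega
    have hexp : ∀ (M : Model S A₁ A₂),
        M.Q γ π j (s ⟨j, by omega⟩) (a ⟨j, by omega⟩) (b ⟨j, by omega⟩) *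
          M.segProb t j (by omega) s a b =
        M.R (s ⟨j, by omega⟩) (a ⟨j, by omega⟩) (b ⟨j, by omega⟩) *
          M.segProb t j (by omega) s a b +
        γ * ∑ x, ∑ a', ∑ b', π.p (j + 1) x a' b' * (M.Q γ π (j + 1) x a' b' *
          M.segProb t (j + 1) hj1 (Function.update s ⟨j + 1, hj1⟩ x)
            (Function.update a ⟨j + 1, hj1⟩ a') (Function.update b ⟨j + 1, hj1⟩ b')) := by
      intro M
      simp only [M.segProb_update_right hj1 htj]
      rw [Model.Q, add_mul, mul_assoc γ, Finset.sum_mul]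
      refine congrArg _ (congrArg _ (Finset.sum_congr rfl fun x _ => ?_))
      rw [M.V_eq_sum_Q γ π hj1]
      simp only [Finset.mul_sum, Finset.sum_mul]
      refine Finset.sum_congr rfl fun a' _ => Finset.sum_congr rfl fun b' _ => ?_
      ring
    simp only [hexp, add_sub_add_comm, ← Finset.sum_sub_distrib, ← mul_sub]
    refine hR.add ((MeanSquareRate.sum _ fun x _ => MeanSquareRate.sum _ fun a' _ =>
      MeanSquareRate.sum _ fun b' _ => ?_).const_mul γ)
    by_cases hp : π.p (j + 1) x a' b' = 0
    · simpa only [hp, zero_mul] using MeanSquareRate.zero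
    · have h0' : 0 < G.toModel.occ πb t (Function.update s ⟨j + 1, hj1⟩ x t)
          (Function.update a ⟨j + 1, hj1⟩ a' t) (Function.update b ⟨j + 1, hj1⟩ b' t) := by
        simpa only [Function.update_of_ne hne] using h0
      have h1' : ∀ l : Fin T, t < l → l ≤ j + 1 → 0 < πb.p l (Function.update s ⟨j + 1, hj1⟩ x l)
          (Function.update a ⟨j + 1, hj1⟩ a' l) (Function.update b ⟨j + 1, hj1⟩ b' l) := by
        intro l hl hl'
        rcases hl'.eq_or_lt with heq | hlt'
        · rw [show l = ⟨j + 1, hj1⟩ from Fin.ext heq]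
          simp only [Function.update_self]
          exact h.pos hp
        · have hl2 : l ≠ ⟨j + 1, hj1⟩ := fun h2 => by
            have := congrArg Fin.val h2
            simp only at this
            omega
          simp only [Function.update_of_ne hl2]
          exact h1 l hl (by omega)
      have hR' := hrate ⟨j + 1, hj1⟩ (by rw [Fin.le_def]; simp only; omega) _ _ _ h0'
        fun l hl hl' => h1' l hl hl'
      simp only [Model.rewardPath_eq] at hR'
      have := ih (j := j + 1) (by omega) (by omega) _ _ _ h0' h1' hR'
      simp only [Function.update_self] at this
      exact this.const_mul _

lemma rate_Q (h : π.AbsCont πb) (γ : ℝ) (t : Fin T)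
    (hrate : ∀ (t' : Fin T), t ≤ t' → ∀ (s : Fin T → S) (a : Fin T → A₁) (b : Fin T → A₂),
      0 < G.toModel.occ πb t (s t) (a t) (b t) →
      (∀ l, t < l → l ≤ t' → 0 < πb.p l (s l) (a l) (b l)) →
      MeanSquareRate P (fun n ω => (E n ω).rewardPath t t' s a b
        - G.toModel.rewardPath t t' s a b) α)
    {s : S} {a : A₁} {b : A₂} (h0 : 0 < G.toModel.occ πb t s a b) :
    MeanSquareRate P (fun n ω => (E n ω).Q γ π t s a b - G.toModel.Q γ π t s a b) α := by
  have h1 := rate_Q_segProb h γ t hrate (T - t - 1) (j := t) (by omega) le_rfl (fun _ => s)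
    (fun _ => a) (fun _ => b) h0 fun l h2 h3 => absurd h2 (by simpa using h3)
  simpa only [Model.segProb_self, mul_one] using h1

lemma rate_supportDist {f : ℕ → Ω → Fin T → S → A₁ → A₂ → ℝ} {g : Fin T → S → A₁ → A₂ → ℝ}
    (h : ∀ (t : Fin T) s a b, 0 < G.toModel.occ πb t s a b →
      MeanSquareRate P (fun n ω => f n ω t s a b - g t s a b) α) :
    MeanSquareRate P (fun n ω => G.supportDist πb (f n ω) g) α := by
  classical
  refine MeanSquareRate.sum _ fun t _ => MeanSquareRate.sum _ fun s _ =>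
    MeanSquareRate.sum _ fun a _ => MeanSquareRate.sum _ fun b _ => ?_
  by_cases h0 : 0 < G.toModel.occ πb t s a b
  · simpa only [if_pos h0] using (h t s a b h0).abs
  · simpa only [if_neg h0] using MeanSquareRate.zero

end Paths

/-! ### Second moments of cross-fitted sums -/

section SecondMoment

variable {α : Type*} [MeasurableSpace α] {ν : Measure α} [IsProbabilityMeasure ν]

lemma memLp_two_of_ae_bound {g : α → ℝ} (hg : Measurable g) (hB : ∃ B, ∀ᵐ x ∂ν, |g x| ≤ B) :
    MemLp g 2 ν := by
  obtain ⟨B, hB⟩ := hB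
  exact MemLp.of_bound hg.aestronglyMeasurable B hB

lemma lintegral_sq_sum_centered_le {J : Type*} [Fintype J] {g : α → ℝ} (hg : Measurable g)
    (hB : ∃ B, ∀ᵐ x ∂ν, |g x| ≤ B) :
    ∫⁻ z : J → α, ENNReal.ofReal ((∑ j, (g (z j) - ∫ x, g x ∂ν)) ^ 2) ∂(Measure.pi fun _ => ν) ≤
      Fintype.card J * ∫⁻ x, ENNReal.ofReal (g x ^ 2) ∂ν := by
  have hg2 := memLp_two_of_ae_bound hg hB
  have hgi : Integrable g ν := hg2.integrable (by norm_num)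
  set c := ∫ x, g x ∂ν with hc
  have hc2 : MemLp (fun x => g x - c) 2 ν := hg2.sub (memLp_const c)
  have hcomp : ∀ j : J, MemLp (fun z : J → α => g (z j) - c) 2 (Measure.pi fun _ => ν) := fun j =>
    hc2.comp_measurePreserving (measurePreserving_eval (fun _ : J => ν) j)
  have hY : MemLp (fun z : J → α => ∑ j, (g (z j) - c)) 2 (Measure.pi fun _ => ν) :=
    memLp_finsetSum _ fun j _ => hcomp j
  have hmean : ∫ z : J → α, ∑ j, (g (z j) - c) ∂(Measure.pi fun _ => ν) = 0 := by
    rw [integral_finsetSum _ fun j _ => (hcomp j).integrable (by norm_num)]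
    refine Finset.sum_eq_zero fun j _ => ?_
    rw [integral_comp_eval (μ := fun _ : J => ν) (f := fun x => g x - c)
      (hg.sub_const c).aestronglyMeasurable, integral_sub hgi (integrable_const c)]
    simp [hc]
  have hvar := variance_sum_pi (μ := fun _ : J => ν) (X := fun _ x => g x - c) fun _ => hc2
  have hvar' : ∫ z : J → α, (∑ j, (g (z j) - c)) ^ 2 ∂(Measure.pi fun _ => ν) =
      Fintype.card J * Var[fun x => g x - c; ν] := by
    rw [← variance_of_integral_eq_zero hY.aestronglyMeasurable.aemeasurable hmean]
    simp only [Finset.sum_const, Finset.card_univ, nsmul_eq_mul] at hvar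
    rw [← hvar]
    congr 1
    funext z
    simp
  have hle : Var[fun x => g x - c; ν] ≤ ∫ x, g x ^ 2 ∂ν := by
    rw [variance_sub_const hg.aestronglyMeasurable]
    exact variance_le_expectation_sq hg.aestronglyMeasurable
  rw [← ofReal_integral_eq_lintegral_ofReal hY.integrable_sq (ae_of_all _ fun _ => sq_nonneg _),
    ← ofReal_integral_eq_lintegral_ofReal hg2.integrable_sq (ae_of_all _ fun _ => sq_nonneg _),
    hvar', ENNReal.ofReal_mul (Nat.cast_nonneg _), ENNReal.ofReal_natCast]
  gcongr

/-- Conditionally on the data outside a fold, the centered contributions of the fold are independent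
with mean zero, so that the second moment of their sum is at most the sum of their second
moments. -/
lemma lintegral_sq_fold_le {ι : Type*} [Fintype ι] (p : ι → Prop) [DecidablePred p]
    {d : ({i // p i} → α) → α → ℝ} (hd : Measurable (Function.uncurry d))
    (hB : ∀ y, ∃ B, ∀ᵐ x ∂ν, |d y x| ≤ B) :
    ∫⁻ D : ι → α, ENNReal.ofReal ((∑ i, if p i then 0 else
        (d (fun j => D j) (D i) - ∫ x, d (fun j => D j) x ∂ν)) ^ 2) ∂(Measure.pi fun _ => ν) ≤
      Fintype.card ι * ∫⁻ D : ι → α, ∫⁻ x, ENNReal.ofReal (d (fun j => D j) x ^ 2) ∂ν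
        ∂(Measure.pi fun _ => ν) := by
  have he := measurePreserving_piEquivPiSubtypeProd (α := fun _ : ι => α) (fun _ => ν) p
  set e := MeasurableEquiv.piEquivPiSubtypeProd (fun _ : ι => α) p with he_def
  have hmean : Measurable fun y => ∫ x, d y x ∂ν :=
    (hd.stronglyMeasurable.integral_prod_right).measurable
  set H : ({i // p i} → α) × ({i // ¬ p i} → α) → ENNReal := fun q =>
    ENNReal.ofReal ((∑ j, (d q.1 (q.2 j) - ∫ x, d q.1 x ∂ν)) ^ 2) with hH
  set L : ({i // p i} → α) × ({i // ¬ p i} → α) → ENNReal := fun q =>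
    ∫⁻ x, ENNReal.ofReal (d q.1 x ^ 2) ∂ν with hL
  have hHm : Measurable H := by
    refine ((Finset.measurable_sum _ fun j _ => Measurable.sub ?_ ?_).pow_const 2).ennreal_ofReal
    · exact hd.comp (measurable_fst.prodMk ((measurable_pi_apply j).comp measurable_snd))
    · exact hmean.comp measurable_fst
  have hKm : Measurable fun y => ∫⁻ x, ENNReal.ofReal (d y x ^ 2) ∂ν :=
    Measurable.lintegral_prod_right' (f := fun q => ENNReal.ofReal (d q.1 q.2 ^ 2))
      (hd.pow_const 2).ennreal_ofReal
  have hLm : Measurable L := hKm.comp measurable_fst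
  have h1 : ∀ D : ι → α, ENNReal.ofReal ((∑ i, if p i then 0 else
        (d (fun j => D j) (D i) - ∫ x, d (fun j => D j) x ∂ν)) ^ 2) = H (e D) := by
    intro D
    have h2 : (∑ i, if p i then 0 else
        (d (fun j => D j) (D i) - ∫ x, d (fun j => D j) x ∂ν)) =
        ∑ i : {i // ¬ p i}, (d (fun j => D j) (D i) - ∫ x, d (fun j => D j) x ∂ν) := by
      rw [← Finset.sum_subtype (Finset.univ.filter fun i => ¬ p i) (by simp)
        fun i => (d (fun j => D j) (D i) - ∫ x, d (fun j => D j) x ∂ν), Finset.sum_filter]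
      exact Finset.sum_congr rfl fun i _ => by by_cases hp : p i <;> simp [hp]
    rw [h2]
    rfl
  have h3 : ∀ D : ι → α, ∫⁻ x, ENNReal.ofReal (d (fun j => D j) x ^ 2) ∂ν = L (e D) := fun _ => rfl
  simp only [h1, h3]
  rw [he.lintegral_comp hHm, he.lintegral_comp hLm, lintegral_prod _ hHm.aemeasurable,
    lintegral_prod _ hLm.aemeasurable, ← lintegral_const_mul]
  · refine lintegral_mono fun y => ?_
    refine (lintegral_sq_sum_centered_le (hd.comp measurable_prodMk_left) (hB y)).trans ?_
    simp only [hL, lintegral_const, measure_univ, mul_one]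
    exact mul_le_mul_left (by exact_mod_cast Fintype.card_subtype_le _) _
  · simpa [hL] using hKm

/-- Averaging over an independent random partition. -/
lemma lintegral_indep {Ω β γ : Type*} [MeasurableSpace Ω] {P : Measure Ω} [IsProbabilityMeasure P]
    [MeasurableSpace β] [MeasurableSpace γ] [Countable γ] [MeasurableSingletonClass γ]
    {F : Ω → γ} {X : Ω → β} (hF : Measurable F) (hX : Measurable X) (hFX : IndepFun F X P)
    {φ : γ → β → ENNReal} (hφ : ∀ f, Measurable (φ f)) :
    ∫⁻ ω, φ (F ω) (X ω) ∂P = ∫⁻ f, ∫⁻ D, φ f D ∂(P.map X) ∂(P.map F) := by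
  have hm : Measurable fun q : γ × β => φ q.1 q.2 := measurable_from_prod_countable_right hφ
  have := Measure.isProbabilityMeasure_map (μ := P) hX.aemeasurable
  rw [← lintegral_prod (fun q : γ × β => φ q.1 q.2) hm.aemeasurable,
    ← (indepFun_iff_map_prod_eq_prod_map_map hF.aemeasurable hX.aemeasurable).1 hFX,
    lintegral_map hm (hF.prodMk hX)]

end SecondMoment

/-! ### The nuisance error of the cross-fitted estimator -/

section MeasurableScore

variable {T : ℕ} {S A₁ A₂ : Type*} [Fintype S] [Fintype A₁] [Fintype A₂]
  [MeasurableSpace S] [DiscreteMeasurableSpace S]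
  [MeasurableSpace A₁] [DiscreteMeasurableSpace A₁]
  [MeasurableSpace A₂] [DiscreteMeasurableSpace A₂]
  {β : Type*} [MeasurableSpace β]

lemma measurable_prod_traj {γ : Type*} [MeasurableSpace γ] {f : β × Traj T S A₁ A₂ → γ}
    (hf : ∀ s a b, Measurable fun q : β × (Fin T → ℝ) => f (q.1, (s, a, b, q.2))) :
    Measurable f := by
  let f' : (Fin (T + 1) → S) × (Fin T → A₁) × (Fin T → A₂) × (β × (Fin T → ℝ)) → γ :=
    fun x => f (x.2.2.2.1, (x.1, x.2.1, x.2.2.1, x.2.2.2.2))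
  have hf' : Measurable f' := measurable_from_prod_countable_right fun s =>
    measurable_from_prod_countable_right fun a => measurable_from_prod_countable_right
      fun b => hf s a b
  have he : Measurable fun q : β × Traj T S A₁ A₂ =>
      (q.2.1, q.2.2.1, q.2.2.2.1, (q.1, q.2.2.2.2)) := by fun_prop
  exact hf'.comp he

lemma measurable_uncurry_drlScore {M : β → Model S A₁ A₂} (hM : Model.MeasurableFamily M) (γ : ℝ)
    (π : Profile T S A₁ A₂) {m : β → Fin T → S → A₁ → A₂ → ℝ}
    (hm : ∀ t s a b, Measurable fun x => m x t s a b) :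
    Measurable (Function.uncurry fun x τ => drlScore (M x) γ π (m x) τ) := by
  refine measurable_prod_traj fun s a b => ?_
  simp only [Function.uncurry, drlScore_eq]
  refine Finset.measurable_sum _ fun t _ => Measurable.const_mul (Measurable.add
    (Measurable.mul ?_ (Measurable.sub ?_ ?_)) (Measurable.mul ?_ ?_)) _
  · exact (hm t _ _ _).comp measurable_fst
  · exact (measurable_pi_apply t).comp measurable_snd
  · exact (hM.Q π γ t _ _ _).comp measurable_fst
  · unfold prevWeight
    by_cases h : (t : ℕ) = 0
    · simp only [if_pos h]
      exact measurable_const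
    · simp only [if_neg h]
      exact (hm _ _ _ _).comp measurable_fst
  · exact (hM.V π γ t _).comp measurable_fst

end MeasurableScore

section Nuisance

variable {T K : ℕ} {S A₁ A₂ : Type*} [Fintype S] [Fintype A₁] [Fintype A₂]
  [MeasurableSpace S] [DiscreteMeasurableSpace S]
  [MeasurableSpace A₁] [DiscreteMeasurableSpace A₁]
  [MeasurableSpace A₂] [DiscreteMeasurableSpace A₂]

lemma Estimator.IsMeasurable.family {est : Estimator K T S A₁ A₂} (h : est.IsMeasurable) (n : ℕ)
    (f : Fin n → Fin K) (k : Fin K) :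
    Model.MeasurableFamily fun D => (est n f k D).toModel :=
  ⟨(h n f k).1, (h n f k).2.1, (h n f k).2.2.1⟩

lemma Estimator.IsMeasurable.ratio {est : Estimator K T S A₁ A₂} (h : est.IsMeasurable) (n : ℕ)
    (f : Fin n → Fin K) (k : Fin K) (π : Profile T S A₁ A₂) (t : Fin T) (s : S) (a : A₁) (b : A₂) :
    Measurable fun D => (est n f k D).ratio π t s a b :=
  ((h.family n f k).occ π t s a b).div ((h n f k).2.2.2 t s a b)

/-- The error of the score that is caused by the estimated nuisance functions. -/
noncomputable def scoreError (G : Game S A₁ A₂) (πb π : Profile T S A₁ A₂) (E : Estimate T S A₁ A₂)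
    (τ : Traj T S A₁ A₂) : ℝ :=
  drlScore E.toModel G.γ π (E.ratio π) τ - drlScore G.toModel G.γ π (G.ratio πb π) τ

/-- The error of the estimated density ratio on the support of the behavior profile. -/
noncomputable def ratioError (G : Game S A₁ A₂) (πb π : Profile T S A₁ A₂)
    (E : Estimate T S A₁ A₂) : ℝ := G.supportDist πb (E.ratio π) (G.ratio πb π)

/-- The error of the estimated value function on the support of the behavior profile. -/
noncomputable def valueError (G : Game S A₁ A₂) (πb π : Profile T S A₁ A₂)
    (E : Estimate T S A₁ A₂) : ℝ :=
  G.supportDist πb (fun t => E.toModel.Q G.γ π t) (fun t => G.toModel.Q G.γ π t)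

lemma Estimator.IsMeasurable.scoreError {est : Estimator K T S A₁ A₂} (h : est.IsMeasurable)
    (G : Game S A₁ A₂) (πb π : Profile T S A₁ A₂) (n : ℕ) (f : Fin n → Fin K) (k : Fin K) :
    Measurable (Function.uncurry fun D τ => scoreError G πb π (est n f k D) τ) :=
  (measurable_uncurry_drlScore (h.family n f k) G.γ π (h.ratio n f k π)).sub
    ((measurable_drlScore G.toModel G.γ π (G.ratio πb π)).comp measurable_snd)

variable {G : Game S A₁ A₂} {Rmax : ℝ} {πb π : Profile T S A₁ A₂}

lemma scoreError_ae_bound (h_reward : ∀ s a b, ∀ᵐ r ∂(G.PR s a b), |r| ≤ Rmax)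
    (E : Estimate T S A₁ A₂) : ∃ B, ∀ᵐ τ ∂(G.trajLaw πb), |scoreError G πb π E τ| ≤ B := by
  obtain ⟨B, -, hB⟩ := ae_abs_drlScore_le h_reward πb π E.toModel (E.ratio π)
  obtain ⟨B', -, hB'⟩ := ae_abs_drlScore_le h_reward πb π G.toModel (G.ratio πb π)
  refine ⟨B + B', ?_⟩
  filter_upwards [hB, hB'] with τ h1 h2
  exact (abs_sub _ _).trans (add_le_add h1 h2)

lemma abs_integral_scoreError_le (h_reward : ∀ s a b, ∀ᵐ r ∂(G.PR s a b), |r| ≤ Rmax)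
    (h : π.AbsCont πb) (E : Estimate T S A₁ A₂) :
    |∫ τ, scoreError G πb π E τ ∂(G.trajLaw πb)| ≤
      2 * T * (ratioError G πb π E * valueError G πb π E) := by
  unfold scoreError
  rw [integral_sub (integral_drlScore h_reward πb π _ _).1 (integral_drlScore h_reward πb π _ _).1,
    (integral_drlScore h_reward πb π _ _).2, integral_drlScore_true h_reward, value_eq h_reward]
  exact G.abs_scoreMean_sub_le h E.toModel (E.ratio π)

variable {Ω : Type*} [MeasurableSpace Ω] {P : Measure Ω} [IsProbabilityMeasure P]

lemma MeanSquareRate.of_le {X : ℕ → Ω → ℝ} {α α' : ℝ} (hX : MeanSquareRate P X α) (h : α' ≤ α) :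
    MeanSquareRate P X α' := by
  refine ⟨hX.1, tendsto_of_tendsto_of_tendsto_of_le_of_le' tendsto_const_nhds hX.2
    (Eventually.of_forall fun _ => zero_le) ?_⟩
  filter_upwards [eventually_ge_atTop 1] with n hn
  have hn' : (1 : ℝ) ≤ n := by exact_mod_cast hn
  gcongr

lemma MeanSquareRate.tendsto_lintegral_sq {X : ℕ → Ω → ℝ} {α : ℝ} (hX : MeanSquareRate P X α)
    (hα : 0 ≤ α) : Tendsto (fun n => ∫⁻ ω, ENNReal.ofReal (X n ω ^ 2) ∂P) atTop (𝓝 0) := by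
  have := (hX.of_le hα).2
  simpa only [MeanSquareLittleO, mul_zero, Real.rpow_zero, ENNReal.ofReal_one, one_mul] using this

/-- A product of two factors whose rates multiply to `n ^ (-1/2)` is `o(n ^ (-1/2))` in mean. -/
lemma MeanSquareRate.tendsto_lintegral_mul {X Y : ℕ → Ω → ℝ} {α α' : ℝ}
    (hX : MeanSquareRate P X α) (hY : MeanSquareRate P Y α') (hα : 1 / 2 ≤ α + α') :
    Tendsto (fun n : ℕ => ∫⁻ ω, ENNReal.ofReal (√n * |X n ω * Y n ω|) ∂P) atTop (𝓝 0) := by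
  have h := hX.2.add hY.2
  rw [add_zero] at h
  refine tendsto_of_tendsto_of_tendsto_of_le_of_le' tendsto_const_nhds h
    (Eventually.of_forall fun _ => zero_le) ?_
  filter_upwards [eventually_ge_atTop 1] with n hn
  have hn' : (1 : ℝ) ≤ n := by exact_mod_cast hn
  have hn0 : (0 : ℝ) < n := by linarith
  rw [← lintegral_const_mul _ ((hX.1 n).pow_const 2).ennreal_ofReal,
    ← lintegral_const_mul _ ((hY.1 n).pow_const 2).ennreal_ofReal,
    ← lintegral_add_left (((hX.1 n).pow_const 2).ennreal_ofReal.const_mul _)]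
  refine lintegral_mono fun ω => ?_
  rw [← ENNReal.ofReal_mul (by positivity), ← ENNReal.ofReal_mul (by positivity),
    ← ENNReal.ofReal_add (by positivity) (by positivity)]
  refine ENNReal.ofReal_le_ofReal ?_
  have h1 : √(n : ℝ) ≤ (n : ℝ) ^ α * (n : ℝ) ^ α' := by
    rw [Real.sqrt_eq_rpow, ← Real.rpow_add hn0]
    exact Real.rpow_le_rpow_of_exponent_le hn' hα
  have h2 : ∀ x : ℝ, (n : ℝ) ^ (2 * x) = ((n : ℝ) ^ x) ^ 2 := fun x => by
    rw [mul_comm, Real.rpow_mul hn0.le]; norm_num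
  rw [h2, h2, abs_mul]
  calc _ ≤ (n : ℝ) ^ α * (n : ℝ) ^ α' * (|X n ω| * |Y n ω|) := by gcongr
    _ ≤ ((n : ℝ) ^ α * |X n ω|) ^ 2 + ((n : ℝ) ^ α' * |Y n ω|) ^ 2 := by
        have e1 : 0 ≤ (n : ℝ) ^ α * |X n ω| := by positivity
        have e2 : 0 ≤ (n : ℝ) ^ α' * |Y n ω| := by positivity
        nlinarith [sq_nonneg ((n : ℝ) ^ α * |X n ω| - (n : ℝ) ^ α' * |Y n ω|)]
    _ = _ := by rw [mul_pow, mul_pow, sq_abs, sq_abs]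

lemma tendsto_measure_of_tendsto_lintegral {Y : ℕ → Ω → ℝ} (hY : ∀ n, Measurable (Y n))
    (h : Tendsto (fun n => ∫⁻ ω, ENNReal.ofReal (Y n ω) ∂P) atTop (𝓝 0)) {θ : ℝ} (hθ : 0 < θ) :
    Tendsto (fun n => P {ω | θ ≤ Y n ω}) atTop (𝓝 0) := by
  have hθ' : ENNReal.ofReal θ ≠ 0 := by simpa using hθ
  have h1 := ENNReal.Tendsto.div_const h (Or.inr hθ')
  rw [ENNReal.zero_div] at h1
  refine tendsto_of_tendsto_of_tendsto_of_le_of_le tendsto_const_nhds h1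
    (fun _ => zero_le) fun n => ?_
  refine le_trans (measure_mono fun ω hω => ?_)
    (meas_ge_le_lintegral_div (hY n).ennreal_ofReal.aemeasurable hθ' ENNReal.ofReal_ne_top)
  exact ENNReal.ofReal_le_ofReal hω

variable {X : ℕ → Ω → Traj T S A₁ A₂} {F : (n : ℕ) → Ω → Fin n → Fin K}
  {est : Estimator K T S A₁ A₂}

lemma map_data (hX_meas : ∀ i, Measurable (X i))
    (hX_indep : iIndepFun X P) (hX_law : ∀ i, P.map (X i) = G.trajLaw πb) (n : ℕ) :
    P.map (fun ω (i : Fin n) => X i ω) = Measure.pi fun _ => G.trajLaw πb := by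
  have h1 : iIndepFun (fun i : Fin n => X i) P := hX_indep.precomp Fin.val_injective
  have h2 := (iIndepFun_iff_map_fun_eq_pi_map fun i : Fin n => (hX_meas i).aemeasurable).1 h1
  simpa only [hX_law] using h2

lemma measurable_data (hX_meas : ∀ i, Measurable (X i)) (n : ℕ) :
    Measurable fun ω (i : Fin n) => X i ω := measurable_pi_lambda _ fun i => hX_meas i

/-- Functions of the partition and the data that are measurable in the data are measurable. -/
lemma measurable_partition_data (hX_meas : ∀ i, Measurable (X i)) (hF_meas : ∀ n, Measurable (F n))
    {β : Type*} [MeasurableSpace β] (n : ℕ) {φ : (Fin n → Fin K) → (Fin n → Traj T S A₁ A₂) → β}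
    (hφ : ∀ f, Measurable (φ f)) : Measurable fun ω => φ (F n ω) fun i => X i ω :=
  (measurable_from_prod_countable_right (f := fun q : _ × _ => φ q.1 q.2) hφ).comp
    ((hF_meas n).prodMk (measurable_data hX_meas n))

/-- The centered contribution of the fold `k` to the nuisance error. -/
noncomputable def foldSum (G : Game S A₁ A₂) (πb π : Profile T S A₁ A₂)
    (est : Estimator K T S A₁ A₂) {n : ℕ} (k : Fin K) (f : Fin n → Fin K)
    (D : Fin n → Traj T S A₁ A₂) : ℝ :=
  ∑ i, if f i ≠ k then 0 else (scoreError G πb π (est.fit f D k) (D i) -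
    ∫ τ, scoreError G πb π (est.fit f D k) τ ∂(G.trajLaw πb))

lemma measurable_fit (n : ℕ) (f : Fin n → Fin K) (k : Fin K) :
    Measurable fun (D : Fin n → Traj T S A₁ A₂) (i : {i : Fin n // f i ≠ k}) => D i :=
  measurable_pi_lambda _ fun _ => measurable_pi_apply _

lemma measurable_integral_scoreError [IsFiniteMeasure (G.trajLaw πb)] (h_est : est.IsMeasurable)
    (n : ℕ) (k : Fin K) (f : Fin n → Fin K) :
    Measurable fun D => ∫ τ, scoreError G πb π (est.fit f D k) τ ∂(G.trajLaw πb) :=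
  ((h_est.scoreError G πb π n f k).stronglyMeasurable.integral_prod_right).measurable.comp
    (measurable_fit n f k)

lemma measurable_foldSum [IsFiniteMeasure (G.trajLaw πb)] (h_est : est.IsMeasurable)
    (n : ℕ) (k : Fin K) (f : Fin n → Fin K) : Measurable (foldSum G πb π est k f) := by
  refine Finset.measurable_sum _ fun i _ => ?_
  by_cases hi : f i ≠ k
  · simp only [if_pos hi]
    exact measurable_const
  · simp only [if_neg hi]
    exact (((h_est.scoreError G πb π n f k).comp
      ((measurable_fit n f k).prodMk (measurable_pi_apply i)))).sub
        (measurable_integral_scoreError h_est n k f)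

lemma lintegral_foldSum_sq_le [IsProbabilityMeasure (G.trajLaw πb)]
    (h_reward : ∀ s a b, ∀ᵐ r ∂(G.PR s a b), |r| ≤ Rmax) (hX_meas : ∀ i, Measurable (X i))
    (hX_indep : iIndepFun X P) (hX_law : ∀ i, P.map (X i) = G.trajLaw πb)
    (hF_meas : ∀ n, Measurable (F n))
    (hF_indep : ∀ n, IndepFun (F n) (fun ω (i : Fin n) => X i ω) P) (h_est : est.IsMeasurable)
    (n : ℕ) (k : Fin K) :
    ∫⁻ ω, ENNReal.ofReal (foldSum G πb π est k (F n ω) (fun i => X i ω) ^ 2) ∂P ≤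
      n * ∫⁻ ω, ∫⁻ τ, ENNReal.ofReal
        (scoreError G πb π (est.fit (F n ω) (fun i => X i ω) k) τ ^ 2) ∂(G.trajLaw πb) ∂P := by
  have hm : ∀ f, Measurable fun D : Fin n → Traj T S A₁ A₂ =>
      ∫⁻ τ, ENNReal.ofReal (scoreError G πb π (est.fit f D k) τ ^ 2) ∂(G.trajLaw πb) := fun f =>
    (Measurable.lintegral_prod_right' (f := fun q => ENNReal.ofReal
      (scoreError G πb π (est n f k q.1) q.2 ^ 2))
      ((h_est.scoreError G πb π n f k).pow_const 2).ennreal_ofReal).comp (measurable_fit n f k)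
  rw [lintegral_indep (hF_meas n) (measurable_data hX_meas n) (hF_indep n)
      (φ := fun f D => ENNReal.ofReal (foldSum G πb π est k f D ^ 2))
      fun f => ((measurable_foldSum h_est n k f).pow_const 2).ennreal_ofReal,
    lintegral_indep (hF_meas n) (measurable_data hX_meas n) (hF_indep n) hm,
    ← lintegral_const_mul _ (measurable_of_countable _), map_data hX_meas hX_indep hX_law n]
  refine lintegral_mono fun f => ?_
  have := lintegral_sq_fold_le (ν := G.trajLaw πb) (fun i => f i ≠ k)
    (h_est.scoreError G πb π n f k) fun y => scoreError_ae_bound h_reward _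
  rwa [Fintype.card_fin] at this

/-- The cross-fitted estimator differs from the oracle estimator by fold sums and biases. -/
lemma valueDRL_sub_oracle (n : ℕ) (f : Fin n → Fin K) (D : Fin n → Traj T S A₁ A₂) :
    est.valueDRL G.γ f D π - (n : ℝ)⁻¹ * ∑ i, drlScore G.toModel G.γ π (G.ratio πb π) (D i) =
      (n : ℝ)⁻¹ * ∑ k, (foldSum G πb π est k f D + ((Finset.univ.filter fun i => f i = k).card : ℝ) *
        ∫ τ, scoreError G πb π (est.fit f D k) τ ∂(G.trajLaw πb)) := by
  rw [Estimator.valueDRL, ← mul_sub, ← Finset.sum_sub_distrib]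
  congr 1
  have h1 : ∀ k, foldSum G πb π est k f D + ((Finset.univ.filter fun i => f i = k).card : ℝ) *
        ∫ τ, scoreError G πb π (est.fit f D k) τ ∂(G.trajLaw πb) =
      ∑ i, if f i = k then scoreError G πb π (est.fit f D k) (D i) else 0 := by
    intro k
    rw [foldSum, ← nsmul_eq_mul, ← Finset.sum_const, Finset.sum_filter, ← Finset.sum_add_distrib]
    refine Finset.sum_congr rfl fun i _ => ?_
    by_cases h : f i = k <;> simp [h]
  rw [Finset.sum_congr rfl fun k _ => h1 k, Finset.sum_comm]
  refine Finset.sum_congr rfl fun i _ => ?_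
  rw [Finset.sum_ite_eq Finset.univ (f i) fun k => scoreError G πb π (est.fit f D k) (D i),
    if_pos (Finset.mem_univ _)]
  rfl

/-- The nuisance error of the cross-fitted estimator is `o(n ^ (-1/2))` in probability. -/
theorem tendsto_nuisance [IsProbabilityMeasure (G.trajLaw πb)]
    (h_reward : ∀ s a b, ∀ᵐ r ∂(G.PR s a b), |r| ≤ Rmax) (hX_meas : ∀ i, Measurable (X i))
    (hX_indep : iIndepFun X P) (hX_law : ∀ i, P.map (X i) = G.trajLaw πb)
    (hF_meas : ∀ n, Measurable (F n))
    (hF_indep : ∀ n, IndepFun (F n) (fun ω (i : Fin n) => X i ω) P) (h_est : est.IsMeasurable)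
    (hAC : π.AbsCont πb) {c : ℝ}
    (h_bound : ∀ n k, ∀ᵐ ω ∂P, ∀ (t : Fin T) s a b, 0 < G.toModel.occ πb t s a b →
      |(est.fit (F n ω) (fun i => X i ω) k).ratio π t s a b| ≤ c)
    {α₁ α₂ : ℝ} (hα₁ : 0 ≤ α₁) (hα₂ : 0 ≤ α₂) (hα : 1 / 2 ≤ α₁ + α₂)
    (h_value : ∀ k, MeanSquareRate P
      (fun n ω => valueError G πb π (est.fit (F n ω) (fun i => X i ω) k)) α₁)
    (h_ratio : ∀ k, MeanSquareRate P
      (fun n ω => ratioError G πb π (est.fit (F n ω) (fun i => X i ω) k)) α₂)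
    {ε : ℝ} (hε : 0 < ε) :
    Tendsto (fun n : ℕ => P {ω | ε ≤ √n * |est.valueDRL G.γ (F n ω) (fun i => X i ω) π -
      (n : ℝ)⁻¹ * ∑ i : Fin n, drlScore G.toModel G.γ π (G.ratio πb π) (X i ω)|}) atTop (𝓝 0) := by
  set E : ℕ → Ω → Fin K → Estimate T S A₁ A₂ :=
    fun n ω k => est.fit (F n ω) (fun i => X i ω) k with hE
  set A : ℕ → Ω → Fin K → ℝ := fun n ω k => foldSum G πb π est k (F n ω) fun i => X i ω with hA
  set b : ℕ → Ω → Fin K → ℝ :=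
    fun n ω k => ∫ τ, scoreError G πb π (E n ω k) τ ∂(G.trajLaw πb) with hb
  have hAm : ∀ n k, Measurable fun ω => A n ω k := fun n k =>
    measurable_partition_data hX_meas hF_meas n (φ := fun f D => foldSum G πb π est k f D)
      fun f => measurable_foldSum h_est n k f
  have hbm : ∀ n k, Measurable fun ω => b n ω k := fun n k =>
    measurable_partition_data hX_meas hF_meas n
      (φ := fun f D => ∫ τ, scoreError G πb π (est.fit f D k) τ ∂(G.trajLaw πb))
      fun f => measurable_integral_scoreError h_est n k f
  obtain ⟨B, hB0, hB⟩ := exists_lipschitz_drlScore h_reward hAC c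
  -- the fold sums
  have hA0 : ∀ k, Tendsto (fun n : ℕ => ∫⁻ ω, ENNReal.ofReal ((n : ℝ)⁻¹ * A n ω k ^ 2) ∂P)
      atTop (𝓝 0) := by
    intro k
    have hsum := (((h_ratio k).of_le hα₂).add ((h_value k).of_le hα₁)).const_mul B
    refine tendsto_of_tendsto_of_tendsto_of_le_of_le' tendsto_const_nhds
      (hsum.tendsto_lintegral_sq le_rfl) (Eventually.of_forall fun _ => zero_le) ?_
    filter_upwards [eventually_ge_atTop 1] with n hn
    have hn0 : (0 : ℝ) < n := by exact_mod_cast hn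
    have h1 : ∀ᵐ ω ∂P, ∫⁻ τ, ENNReal.ofReal (scoreError G πb π (E n ω k) τ ^ 2) ∂(G.trajLaw πb) ≤
        ENNReal.ofReal ((B * (ratioError G πb π (E n ω k) + valueError G πb π (E n ω k))) ^ 2) := by
      filter_upwards [h_bound n k] with ω hω
      refine (lintegral_mono_ae (g := fun _ => ENNReal.ofReal
        ((B * (ratioError G πb π (E n ω k) + valueError G πb π (E n ω k))) ^ 2)) ?_).trans (by simp)
      filter_upwards [hB (E n ω k).toModel ((E n ω k).ratio π) hω] with τ hτ
      exact ENNReal.ofReal_le_ofReal (sq_le_sq.2 (hτ.trans (le_abs_self _)))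
    calc ∫⁻ ω, ENNReal.ofReal ((n : ℝ)⁻¹ * A n ω k ^ 2) ∂P
        = ENNReal.ofReal (n : ℝ)⁻¹ * ∫⁻ ω, ENNReal.ofReal (A n ω k ^ 2) ∂P := by
          rw [← lintegral_const_mul _ ((hAm n k).pow_const 2).ennreal_ofReal]
          simp only [ENNReal.ofReal_mul (inv_nonneg.2 hn0.le)]
      _ ≤ ENNReal.ofReal (n : ℝ)⁻¹ * (n * ∫⁻ ω, ∫⁻ τ, ENNReal.ofReal
            (scoreError G πb π (E n ω k) τ ^ 2) ∂(G.trajLaw πb) ∂P) :=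
          mul_le_mul_right (lintegral_foldSum_sq_le h_reward hX_meas hX_indep hX_law hF_meas
            hF_indep h_est n k) _
      _ = ∫⁻ ω, ∫⁻ τ, ENNReal.ofReal
            (scoreError G πb π (E n ω k) τ ^ 2) ∂(G.trajLaw πb) ∂P := by
          rw [← mul_assoc, ← ENNReal.ofReal_natCast, ← ENNReal.ofReal_mul (by positivity),
            inv_mul_cancel₀ hn0.ne', ENNReal.ofReal_one, one_mul]
      _ ≤ _ := lintegral_mono_ae h1
  -- the biases
  have hb0 : ∀ k, Tendsto (fun n : ℕ => ∫⁻ ω, ENNReal.ofReal (√n * |b n ω k|) ∂P)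
      atTop (𝓝 0) := by
    intro k
    have hprod := ((h_ratio k).const_mul (2 * T)).tendsto_lintegral_mul (h_value k)
      (by linarith)
    refine tendsto_of_tendsto_of_tendsto_of_le_of_le tendsto_const_nhds hprod
      (fun _ => zero_le) fun n => lintegral_mono fun ω => ENNReal.ofReal_le_ofReal ?_
    refine mul_le_mul_of_nonneg_left ?_ (Real.sqrt_nonneg _)
    refine (abs_integral_scoreError_le h_reward hAC (E n ω k)).trans ?_
    rw [← mul_assoc]
    exact le_abs_self _
  set θ : ℝ := ε / (2 * (K + 1)) with hθ
  have hθ0 : 0 < θ := by positivity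
  have hlim := tendsto_finsetSum (Finset.univ : Finset (Fin K)) fun k _ =>
    (tendsto_measure_of_tendsto_lintegral (fun n => ((hAm n k).pow_const 2).const_mul _) (hA0 k)
      (show 0 < θ ^ 2 by positivity)).add
    (tendsto_measure_of_tendsto_lintegral (fun n => ((hbm n k).abs).const_mul _) (hb0 k) hθ0)
  simp only [add_zero, Finset.sum_const_zero] at hlim
  refine tendsto_of_tendsto_of_tendsto_of_le_of_le' tendsto_const_nhds hlim
    (Eventually.of_forall fun _ => zero_le) ?_
  filter_upwards [eventually_ge_atTop 1] with n hn
  have hn0 : (0 : ℝ) < n := by exact_mod_cast hn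
  have hsn : 0 < √(n : ℝ) := Real.sqrt_pos.2 hn0
  refine le_trans (measure_mono (t := ⋃ k ∈ (Finset.univ : Finset (Fin K)),
    ({ω | θ ^ 2 ≤ (n : ℝ)⁻¹ * A n ω k ^ 2} ∪ {ω | θ ≤ √n * |b n ω k|})) fun ω hω => ?_)
    ((measure_biUnion_finset_le _ _).trans (Finset.sum_le_sum fun k _ => measure_union_le _ _))
  by_contra hcon
  simp only [Finset.mem_univ, Set.iUnion_true, Set.mem_iUnion, Set.mem_union, Set.mem_ofPred_eq,
    not_exists, not_or, not_le] at hcon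
  have hk : ∀ k, |A n ω k + ((Finset.univ.filter fun i => F n ω i = k).card : ℝ) * b n ω k| ≤
      2 * θ * √n := by
    intro k
    obtain ⟨h1, h2⟩ := hcon k
    have h3 : |A n ω k| ≤ θ * √n := by
      rw [inv_mul_eq_div, div_lt_iff₀ hn0] at h1
      refine abs_le_of_sq_le_sq ?_ (by positivity)
      rw [mul_pow, Real.sq_sqrt hn0.le]
      exact h1.le
    have h4 : ((Finset.univ.filter fun i => F n ω i = k).card : ℝ) ≤ √n * √n := by
      rw [Real.mul_self_sqrt hn0.le]
      exact_mod_cast (Finset.card_le_univ _).trans (by simp)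
    refine (abs_add_le _ _).trans ?_
    rw [abs_mul, Nat.abs_cast]
    have h5 : ((Finset.univ.filter fun i => F n ω i = k).card : ℝ) * |b n ω k| ≤ √n * θ := by
      calc _ ≤ √n * √n * |b n ω k| := mul_le_mul_of_nonneg_right h4 (abs_nonneg _)
        _ = √n * (√n * |b n ω k|) := by ring
        _ ≤ _ := mul_le_mul_of_nonneg_left h2.le hsn.le
    linarith
  have hω' : ε ≤ √n * |est.valueDRL G.γ (F n ω) (fun i => X i ω) π -
      (n : ℝ)⁻¹ * ∑ i : Fin n, drlScore G.toModel G.γ π (G.ratio πb π) (X i ω)| := hω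
  rw [valueDRL_sub_oracle (πb := πb) n (F n ω) fun i => X i ω] at hω'
  have hfin : √n * |(n : ℝ)⁻¹ * ∑ k, (A n ω k +
      ((Finset.univ.filter fun i => F n ω i = k).card : ℝ) * b n ω k)| ≤ K * (2 * θ) := by
    rw [abs_mul, abs_of_pos (inv_pos.2 hn0)]
    calc _ ≤ √n * ((n : ℝ)⁻¹ * ∑ _k : Fin K, (2 * θ * √n)) := by
          gcongr
          exact (Finset.abs_sum_le_sum_abs _ _).trans (Finset.sum_le_sum fun k _ => hk k)
      _ = (√n * √n) * (n : ℝ)⁻¹ * (K * (2 * θ)) := by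
          rw [Finset.sum_const, Finset.card_univ, Fintype.card_fin, nsmul_eq_mul]; ring
      _ = _ := by rw [Real.mul_self_sqrt hn0.le, mul_inv_cancel₀ hn0.ne', one_mul]
  have hlt : K * (2 * θ) < ε := by
    rw [hθ]
    have : (K : ℝ) * (2 * (ε / (2 * (K + 1)))) = ε * (K / (K + 1)) := by field_simp
    rw [this]
    exact mul_lt_of_lt_one_right hε (by rw [div_lt_one (by positivity)]; linarith)
  linarith

end Nuisance

/-! ### A Bernstein inequality for moderate deviations -/

section Bernstein

variable {Ω : Type*} [MeasurableSpace Ω] {P : Measure Ω} [IsProbabilityMeasure P]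

lemma exp_le_one_add_add_sq {x : ℝ} (hx : |x| ≤ 1) : Real.exp x ≤ 1 + x + x ^ 2 := by
  have h := Real.norm_exp_sub_one_sub_id_le (x := x) hx
  rw [Real.norm_eq_abs, Real.norm_eq_abs, sq_abs] at h
  linarith [le_abs_self (Real.exp x - 1 - x)]

lemma mgf_le_exp_sq {Y : Ω → ℝ} (hY : Measurable Y) {B V l : ℝ} (hB : ∀ᵐ ω ∂P, |Y ω| ≤ B)
    (hmean : ∫ ω, Y ω ∂P = 0) (hV : ∫ ω, Y ω ^ 2 ∂P ≤ V) (hl : |l| * B ≤ 1) :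
    Integrable (fun ω => Real.exp (l * Y ω)) P ∧ mgf Y P l ≤ Real.exp (l ^ 2 * V) := by
  have hY2 : MemLp Y 2 P := memLp_two_of_ae_bound hY ⟨B, hB⟩
  have hYi : Integrable Y P := hY2.integrable (by norm_num)
  have hle : ∀ᵐ ω ∂P, Real.exp (l * Y ω) ≤ 1 + l * Y ω + l ^ 2 * Y ω ^ 2 := by
    filter_upwards [hB] with ω hω
    rw [← mul_pow]
    refine exp_le_one_add_add_sq ?_
    rw [abs_mul]
    exact (mul_le_mul_of_nonneg_left hω (abs_nonneg l)).trans hl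
  have hint1 : Integrable (fun ω => 1 + l * Y ω) P := (integrable_const 1).add (hYi.const_mul l)
  have hint2 : Integrable (fun ω => l ^ 2 * Y ω ^ 2) P := hY2.integrable_sq.const_mul _
  have hint : Integrable (fun ω => 1 + l * Y ω + l ^ 2 * Y ω ^ 2) P := hint1.add hint2
  have hexp : Integrable (fun ω => Real.exp (l * Y ω)) P := by
    refine hint.mono' (hY.const_mul l).exp.aestronglyMeasurable ?_
    filter_upwards [hle] with ω hω
    rwa [Real.norm_of_nonneg (Real.exp_pos _).le]
  refine ⟨hexp, ?_⟩
  calc mgf Y P l ≤ ∫ ω, 1 + l * Y ω + l ^ 2 * Y ω ^ 2 ∂P := integral_mono_ae hexp hint hle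
    _ = 1 + l ^ 2 * ∫ ω, Y ω ^ 2 ∂P := by
        rw [integral_add hint1 hint2, integral_add (integrable_const 1) (hYi.const_mul l),
          integral_const_mul, integral_const_mul, hmean]
        simp
    _ ≤ 1 + l ^ 2 * V := by gcongr
    _ ≤ _ := by linarith [Real.add_one_le_exp (l ^ 2 * V)]

lemma measure_sum_ge_le {n : ℕ} {Y : Fin n → Ω → ℝ} (hY : ∀ i, Measurable (Y i))
    (hindep : iIndepFun Y P) {B V L : ℝ} (hB : ∀ i, ∀ᵐ ω ∂P, |Y i ω| ≤ B)
    (hmean : ∀ i, ∫ ω, Y i ω ∂P = 0) (hV : ∀ i, ∫ ω, Y i ω ^ 2 ∂P ≤ V) (hn : 0 < n) (hV0 : 0 < V)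
    (hL : 0 ≤ L) (hLn : B ^ 2 * L ≤ n * V) :
    P {ω | 2 * √(n * V * L) ≤ ∑ i, Y i ω} ≤ ENNReal.ofReal (Real.exp (-L)) := by
  have hnV : 0 < (n : ℝ) * V := by positivity
  -- the optimal exponent in the Chernoff bound
  set l : ℝ := √(L / (n * V)) with hl
  have hl0 : 0 ≤ l := Real.sqrt_nonneg _
  have hl2 : l ^ 2 = L / (n * V) := Real.sq_sqrt (by positivity)
  have hlB : |l| * B ≤ 1 := by
    rw [abs_of_nonneg hl0]
    have h1 : (l * B) ^ 2 ≤ 1 := by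
      rw [mul_pow, hl2, div_mul_eq_mul_div, div_le_one hnV]
      linarith
    nlinarith
  have hm := fun i => mgf_le_exp_sq (hY i) (hB i) (hmean i) (hV i) hlB
  have hsum : mgf (∑ i, Y i) P l ≤ Real.exp L := by
    rw [hindep.mgf_sum hY]
    calc _ ≤ ∏ _i : Fin n, Real.exp (l ^ 2 * V) :=
          Finset.prod_le_prod (fun i _ => mgf_nonneg) fun i _ => (hm i).2
      _ = Real.exp L := by
          rw [Finset.prod_const, Finset.card_univ, Fintype.card_fin, ← Real.exp_nat_mul, hl2]
          congr 1
          field_simp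
  have hint : Integrable (fun ω => Real.exp (l * (∑ i, Y i) ω)) P :=
    hindep.integrable_exp_mul_sum hY fun i _ => (hm i).1
  have hch := measure_ge_le_exp_mul_mgf (μ := P) (X := ∑ i, Y i) (2 * √(n * V * L)) hl0 hint
  have hprod : l * √(n * V * L) = L := by
    rw [hl, ← Real.sqrt_mul (by positivity)]
    rw [show L / (n * V) * (n * V * L) = L ^ 2 by field_simp, Real.sqrt_sq hL]
  have hfin : Real.exp (-l * (2 * √(n * V * L))) * mgf (∑ i, Y i) P l ≤ Real.exp (-L) := by
    calc _ ≤ Real.exp (-l * (2 * √(n * V * L))) * Real.exp L :=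
          mul_le_mul_of_nonneg_left hsum (Real.exp_pos _).le
      _ = _ := by
          rw [← Real.exp_add]
          congr 1
          linear_combination (-2) * hprod
  have h := hch.trans hfin
  rw [Measure.real, ← ENNReal.le_ofReal_iff_toReal_le (measure_ne_top _ _) (Real.exp_pos _).le] at h
  simpa only [Finset.sum_apply] using h

/-- In the range `B² L ≤ n V` of moderate deviations the variance alone determines the tail of a
sum of bounded independent variables. -/
lemma measure_abs_sum_ge_le {n : ℕ} {Y : Fin n → Ω → ℝ} (hY : ∀ i, Measurable (Y i))
    (hindep : iIndepFun Y P) {B V L : ℝ} (hB : ∀ i, ∀ᵐ ω ∂P, |Y i ω| ≤ B)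
    (hmean : ∀ i, ∫ ω, Y i ω ∂P = 0) (hV : ∀ i, ∫ ω, Y i ω ^ 2 ∂P ≤ V) (hn : 0 < n) (hV0 : 0 < V)
    (hL : 0 ≤ L) (hLn : B ^ 2 * L ≤ n * V) :
    P {ω | 2 * √(n * V * L) ≤ |∑ i, Y i ω|} ≤ ENNReal.ofReal (2 * Real.exp (-L)) := by
  have h1 := measure_sum_ge_le hY hindep hB hmean hV hn hV0 hL hLn
  have h2 := measure_sum_ge_le (Y := fun i ω => -Y i ω) (fun i => (hY i).neg)
    (hindep.comp (fun _ => Neg.neg) fun _ => measurable_neg) (by simpa using hB)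
    (fun i => by rw [integral_neg, hmean i, neg_zero]) (by simpa using hV) hn hV0 hL hLn
  rw [two_mul (Real.exp _), ENNReal.ofReal_add (Real.exp_pos _).le (Real.exp_pos _).le]
  refine le_trans (measure_mono fun ω hω => ?_) ((measure_union_le _ _).trans (add_le_add h1 h2))
  have hω' : 2 * √(n * V * L) ≤ |∑ i, Y i ω| := hω
  rcases le_abs.1 hω' with h | h
  · exact Or.inl h
  · exact Or.inr (by simpa using h)

end Bernstein

/-! ### The oracle estimator and the regret bound -/

section Oracle

variable {T K : ℕ} {S A₁ A₂ : Type*} [Fintype S] [Fintype A₁] [Fintype A₂]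
  [MeasurableSpace S] [DiscreteMeasurableSpace S]
  [MeasurableSpace A₁] [DiscreteMeasurableSpace A₁]
  [MeasurableSpace A₂] [DiscreteMeasurableSpace A₂]
  {Ω : Type*} [MeasurableSpace Ω] {P : Measure Ω} [IsProbabilityMeasure P]
  {G : Game S A₁ A₂} {Rmax : ℝ} {πb π : Profile T S A₁ A₂}
  {X : ℕ → Ω → Traj T S A₁ A₂} {F : (n : ℕ) → Ω → Fin n → Fin K}
  {est : Estimator K T S A₁ A₂}

lemma memLp_score [IsProbabilityMeasure (G.trajLaw πb)]
    (h_reward : ∀ s a b, ∀ᵐ r ∂(G.PR s a b), |r| ≤ Rmax) :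
    MemLp (drlScore G.toModel G.γ π (G.ratio πb π)) 2 (G.trajLaw πb) := by
  obtain ⟨B, -, hB⟩ := ae_abs_drlScore_le h_reward πb π G.toModel (G.ratio πb π)
  exact memLp_two_of_ae_bound (measurable_drlScore _ _ _ _) ⟨B, hB⟩

lemma value_sq_le [IsProbabilityMeasure (G.trajLaw πb)]
    (h_reward : ∀ s a b, ∀ᵐ r ∂(G.PR s a b), |r| ≤ Rmax) :
    G.value π ^ 2 ≤ ∫ τ, drlScore G.toModel G.γ π (G.ratio πb π) τ ^ 2 ∂(G.trajLaw πb) := by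
  have h1 := variance_eq_sub (memLp_score (πb := πb) (π := π) h_reward)
  have h2 := variance_nonneg (drlScore G.toModel G.γ π (G.ratio πb π)) (G.trajLaw πb)
  rw [h1, integral_drlScore_true h_reward] at h2
  simpa using h2

/-- Tail bound for the oracle estimator, which uses the true nuisance functions. -/
lemma eventually_measure_oracle_le [IsProbabilityMeasure (G.trajLaw πb)]
    (h_reward : ∀ s a b, ∀ᵐ r ∂(G.PR s a b), |r| ≤ Rmax) (hX_meas : ∀ i, Measurable (X i))
    (hX_indep : iIndepFun X P) (hX_law : ∀ i, P.map (X i) = G.trajLaw πb) {V L : ℝ} (hV0 : 0 < V)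
    (hV : ∫ τ, drlScore G.toModel G.γ π (G.ratio πb π) τ ^ 2 ∂(G.trajLaw πb) ≤ V) (hL : 0 ≤ L) :
    ∀ᶠ n : ℕ in atTop, P {ω | 2 * √(n * V * L) ≤
      |∑ i : Fin n, (drlScore G.toModel G.γ π (G.ratio πb π) (X i ω) - G.value π)|} ≤
        ENNReal.ofReal (2 * Real.exp (-L)) := by
  obtain ⟨B, hB0, hB⟩ := ae_abs_drlScore_le h_reward πb π G.toModel (G.ratio πb π)
  set f := drlScore G.toModel G.γ π (G.ratio πb π) with hf
  have hfm : Measurable f := measurable_drlScore _ _ _ _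
  have hf2 : MemLp f 2 (G.trajLaw πb) := memLp_score h_reward
  have hmean : ∫ τ, f τ ∂(G.trajLaw πb) = G.value π := integral_drlScore_true h_reward _ _ _
  have hlaw : ∀ (i : ℕ) (g : Traj T S A₁ A₂ → ℝ), Measurable g →
      ∫ ω, g (X i ω) ∂P = ∫ τ, g τ ∂(G.trajLaw πb) := fun i g hg => by
    rw [← hX_law i, integral_map (hX_meas i).aemeasurable hg.aestronglyMeasurable]
  set c := B + |G.value π| with hc
  filter_upwards [eventually_ge_atTop 1, eventually_ge_atTop ⌈c ^ 2 * L / V⌉₊] with n hn hn'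
  refine measure_abs_sum_ge_le (Y := fun (i : Fin n) ω => f (X i ω) - G.value π) (B := c)
    (fun i => (hfm.comp (hX_meas i)).sub_const _)
    ((hX_indep.precomp Fin.val_injective).comp (fun _ τ => f τ - G.value π)
      fun _ => hfm.sub_const _)
    (fun i => ?_) (fun i => ?_) (fun i => ?_) (by omega) hV0 hL ?_
  · have h1 : ∀ᵐ τ ∂(P.map (X i)), |f τ| ≤ B := by rw [hX_law]; exact hB
    filter_upwards [ae_of_ae_map (hX_meas i).aemeasurable h1] with ω hω
    exact (abs_sub _ _).trans (add_le_add hω le_rfl)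
  · rw [hlaw i (fun τ => f τ - G.value π) (hfm.sub_const _),
      integral_sub (hf2.integrable (by norm_num)) (integrable_const _), hmean]
    simp
  · rw [hlaw i (fun τ => (f τ - G.value π) ^ 2) ((hfm.sub_const _).pow_const 2)]
    have h1 : Var[f; G.trajLaw πb] = ∫ τ, (f τ - G.value π) ^ 2 ∂(G.trajLaw πb) := by
      rw [variance_eq_integral hfm.aemeasurable, hmean]
    rw [← h1]
    exact (variance_le_expectation_sq hfm.aestronglyMeasurable).trans hV
  · have h1 : c ^ 2 * L / V ≤ n := (Nat.le_ceil _).trans (by exact_mod_cast hn')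
    rwa [div_le_iff₀ hV0] at h1

lemma Model.MeasurableFamily.segProb {β : Type*} [MeasurableSpace β] {M : β → Model S A₁ A₂}
    (hM : Model.MeasurableFamily M) (i j : ℕ) (hj : j < T) (s : Fin T → S) (a : Fin T → A₁)
    (b : Fin T → A₂) : Measurable fun x => (M x).segProb i j hj s a b := by
  refine Finset.measurable_prod _ fun l _ => ?_
  split_ifs
  · exact hM.PT _ _ _ _
  · exact measurable_const

/-- If every estimated path quantity has its mean square rate, the nuisance error vanishes. -/
lemma tendsto_nuisance_of_rates [IsProbabilityMeasure (G.trajLaw πb)]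
    (h_reward : ∀ s a b, ∀ᵐ r ∂(G.PR s a b), |r| ≤ Rmax) (hX_meas : ∀ i, Measurable (X i))
    (hX_indep : iIndepFun X P) (hX_law : ∀ i, P.map (X i) = G.trajLaw πb)
    (hF_meas : ∀ n, Measurable (F n))
    (hF_indep : ∀ n, IndepFun (F n) (fun ω (i : Fin n) => X i ω) P) (h_est : est.IsMeasurable)
    (hAC : π.AbsCont πb) {Cη : ℝ}
    (h_bound : ∀ n k, ∀ᵐ ω ∂P, ∀ (t : Fin T) s a b, 0 < G.toModel.occ πb t s a b →
        0 ≤ (est.fit (F n ω) (fun i => X i ω) k).ratio π t s a b ∧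
        (est.fit (F n ω) (fun i => X i ω) k).ratio π t s a b ≤ Cη ^ ((t : ℕ) + 1))
    {α₁ α₂ : ℝ} (hα₁ : 0 ≤ α₁) (hα₂ : 0 ≤ α₂) (hα : 1 / 2 ≤ α₁ + α₂)
    (h_rateQ : ∀ (k : Fin K) (t t' : Fin T), t ≤ t' →
      ∀ (s : Fin T → S) (a : Fin T → A₁) (b : Fin T → A₂),
        0 < G.toModel.occ πb t (s t) (a t) (b t) →
        (∀ l, t < l → l ≤ t' → 0 < πb.p l (s l) (a l) (b l)) →
        MeanSquareLittleO P (fun n ω =>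
          (est.fit (F n ω) (fun i => X i ω) k).rewardPath t t' s a b
            - G.toModel.rewardPath t t' s a b) α₁)
    (h_rateμ : ∀ (k : Fin K) (t : Fin T),
      ∀ (s : Fin T → S) (a : Fin T → A₁) (b : Fin T → A₂),
        0 < G.toModel.occ πb t (s t) (a t) (b t) →
        (∀ l, l < t → 0 < πb.p l (s l) (a l) (b l)) →
        MeanSquareLittleO P (fun n ω =>
          (est.fit (F n ω) (fun i => X i ω) k).pathProb t s a b
              / (est.fit (F n ω) (fun i => X i ω) k).pb t (s t) (a t) (b t)
            - G.toModel.pathProb t s a b / G.toModel.occ πb t (s t) (a t) (b t)) α₂)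
    {ε : ℝ} (hε : 0 < ε) :
    Tendsto (fun n : ℕ => P {ω | ε ≤ √n * |est.valueDRL G.γ (F n ω) (fun i => X i ω) π -
      (n : ℝ)⁻¹ * ∑ i : Fin n, drlScore G.toModel G.γ π (G.ratio πb π) (X i ω)|}) atTop (𝓝 0) := by
  have hm : ∀ (n : ℕ) (k : Fin K) {g : Estimate T S A₁ A₂ → ℝ},
      (∀ f, Measurable fun D => g (est n f k D)) →
      Measurable fun ω => g (est.fit (F n ω) (fun i => X i ω) k) := fun n k g hg =>
    measurable_partition_data hX_meas hF_meas n (φ := fun f D => g (est.fit f D k))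
      fun f => (hg f).comp (measurable_fit n f k)
  refine tendsto_nuisance h_reward hX_meas hX_indep hX_law hF_meas hF_indep h_est hAC
    (c := (1 + |Cη|) ^ T) (fun n k => ?_) hα₁ hα₂ hα (fun k => ?_) (fun k => ?_) hε
  · filter_upwards [h_bound n k] with ω hω t s a b h0
    obtain ⟨h1, h2⟩ := hω t s a b h0
    rw [abs_of_nonneg h1]
    calc _ ≤ Cη ^ ((t : ℕ) + 1) := h2
      _ ≤ |Cη| ^ ((t : ℕ) + 1) := (le_abs_self _).trans (abs_pow _ _).le
      _ ≤ (1 + |Cη|) ^ ((t : ℕ) + 1) := pow_le_pow_left₀ (abs_nonneg _) (by linarith) _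
      _ ≤ (1 + |Cη|) ^ T := pow_le_pow_right₀ (by linarith [abs_nonneg Cη]) t.isLt
  · refine rate_supportDist fun t s a b h0 => rate_Q (E := fun n ω =>
      est.fit (F n ω) (fun i => X i ω) k) hAC G.γ t (fun t' htt' s a b h1 h2 =>
      ⟨fun n => (hm n k (g := fun E => E.rewardPath t t' s a b) fun f => ?_).sub_const _,
        h_rateQ k t t' htt' s a b h1 h2⟩) h0
    exact ((h_est.family n f k).R _ _ _).mul ((h_est.family n f k).segProb _ _ t'.isLt _ _ _)
  · refine rate_supportDist fun t s a b h0 => rate_ratio (E := fun n ω =>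
      est.fit (F n ω) (fun i => X i ω) k) hAC t (fun s a b h1 h2 =>
      ⟨fun n => (hm n k (g := fun E => E.pathProb t s a b / E.pb t (s t) (a t) (b t))
        fun f => ?_).sub_const _, h_rateμ k t s a b h1 h2⟩) h0
    simp only [Model.pathProb_eq]
    exact (((h_est.family n f k).PI _).mul ((h_est.family n f k).segProb _ _ t.isLt _ _ _)).div
      ((h_est n f k).2.2.2 _ _ _ _)

lemma Game.le_varianceDRL {C : Set (Profile T S A₁ A₂)} (hC : C.Finite) (hπ : π ∈ C) :
    ∫ τ, drlScore G.toModel G.γ π (G.ratio πb π) τ ^ 2 ∂(G.trajLaw πb) ≤ G.varianceDRL πb C :=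
  le_csSup (hC.image _).bddAbove (Set.mem_image_of_mem _ hπ)

lemma Game.varianceDRL_nonneg (C : Set (Profile T S A₁ A₂)) : 0 ≤ G.varianceDRL πb C := by
  refine Real.sSup_nonneg ?_
  rintro _ ⟨π, -, rfl⟩
  exact integral_nonneg fun _ => sq_nonneg _

/-- If all values in the class vanish, all profiles of the class have exploitability zero. -/
lemma exploitability_eq_zero {C₁ : Set (Policy T S A₁)} {C₂ : Set (Policy T S A₂)}
    {v : Profile T S A₁ A₂ → ℝ} (hv : ∀ π ∈ C₁ ×ˢ C₂, v π = 0) (hπ : π ∈ C₁ ×ˢ C₂) :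
    exploitability v C₁ C₂ π = 0 := by
  have h1 : (fun π₁' => v (π₁', π.2)) '' C₁ = {0} := by
    rw [Set.image_congr fun π₁' h => hv (π₁', π.2) ⟨h, hπ.2⟩]
    exact Set.Nonempty.image_const ⟨_, hπ.1⟩ 0
  have h2 : (fun π₂' => -v (π.1, π₂')) '' C₂ = {0} := by
    rw [Set.image_congr fun π₂' h => by rw [hv (π.1, π₂') ⟨hπ.1, h⟩]]
    exact Set.Nonempty.image_const ⟨_, hπ.2⟩ (-0 : ℝ) |>.trans (by simp)
  simp [exploitability, h1, h2]

end Oracle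

section Regret

variable {T : ℕ} {S A₁ A₂ : Type*} [Fintype A₁] [Fintype A₂]

/-- The deterministic part of the regret bound, for a value function `v`, its estimate `w` and its
oracle estimate `o / n`: deviations of the order of the bound, uniformly over the class, cost the
selected profile at most a constant factor. -/
lemma regret_le_of_deviation {C₁ : Set (Policy T S A₁)} {C₂ : Set (Policy T S A₂)}
    (hC₁ : C₁.Finite) (hC₂ : C₂.Finite) {v w o : Profile T S A₁ A₂ → ℝ} {n : ℕ} (hn : 0 < n)
    {V L κ m l : ℝ} (hV : 0 ≤ V) (hL : √L ≤ 2 * m * κ + l) (hl : 0 ≤ l) (hm : 0 ≤ m) (hκ : 0 ≤ κ)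
    (h1 : ∀ π ∈ C₁ ×ˢ C₂, √n * |w π - (n : ℝ)⁻¹ * o π| < κ * √V)
    (h2 : ∀ π ∈ C₁ ×ˢ C₂, |o π - n * v π| < 2 * √(n * V * L))
    {π π' : Profile T S A₁ A₂} (hπ : IsSelected (exploitability w C₁ C₂) C₁ C₂ π)
    (hπ' : π' ∈ C₁ ×ˢ C₂) :
    exploitability v C₁ C₂ π - exploitability v C₁ C₂ π' ≤
      (12 + 16 * m) * (κ + l) * √(V / n) := by
  have hn0 : (0 : ℝ) < n := by exact_mod_cast hn
  have hsn : 0 < √(n : ℝ) := Real.sqrt_pos.2 hn0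
  have hdiv : √(V / n) = √V / √n := Real.sqrt_div hV _
  have hdev : ∀ π ∈ C₁ ×ˢ C₂, |w π - v π| ≤ (κ + 2 * (2 * m * κ + l)) * √(V / n) := by
    intro π hπ
    have e1 : |w π - (n : ℝ)⁻¹ * o π| ≤ κ * √(V / n) := by
      rw [hdiv, ← mul_div_assoc, le_div_iff₀ hsn, mul_comm]
      exact (h1 π hπ).le
    have e2 : |(n : ℝ)⁻¹ * o π - v π| ≤ 2 * (2 * m * κ + l) * √(V / n) := by
      have e3 : (n : ℝ)⁻¹ * o π - v π = (n : ℝ)⁻¹ * (o π - n * v π) := by field_simp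
      have e4 : √(n * V * L) ≤ √n * √V * (2 * m * κ + l) := by
        rw [Real.sqrt_mul (by positivity), Real.sqrt_mul hn0.le]
        gcongr
      rw [e3, abs_mul, abs_of_pos (inv_pos.2 hn0), hdiv, inv_mul_eq_div, div_le_iff₀ hn0]
      calc _ ≤ 2 * (√n * √V * (2 * m * κ + l)) := (h2 π hπ).le.trans (by linarith)
        _ = 2 * (2 * m * κ + l) * (√V / √n) * (√n * √n) := by field_simp
        _ = _ := by rw [Real.mul_self_sqrt hn0.le]
    calc |w π - v π| ≤ |w π - (n : ℝ)⁻¹ * o π| + |(n : ℝ)⁻¹ * o π - v π| := abs_sub_le _ _ _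
      _ ≤ κ * √(V / n) + 2 * (2 * m * κ + l) * √(V / n) := add_le_add e1 e2
      _ = _ := by ring
  refine (exploitability_sub_le hC₁ hC₂ hdev hπ hπ').trans ?_
  rw [← mul_assoc]
  refine mul_le_mul_of_nonneg_right ?_ (Real.sqrt_nonneg _)
  have : 0 ≤ m * l := mul_nonneg hm hl
  linarith

end Regret

end MarkovGame

theorem theorem7 {S A₁ A₂ : Type*} [Fintype S] [Fintype A₁] [Fintype A₂]
    [MeasurableSpace S] [DiscreteMeasurableSpace S]
    [MeasurableSpace A₁] [DiscreteMeasurableSpace A₁]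
    [MeasurableSpace A₂] [DiscreteMeasurableSpace A₂]
    {T K : ℕ} (G : Game S A₁ A₂) (πb : Profile T S A₁ A₂)
    (C₁ : Set (Policy T S A₁)) (C₂ : Set (Policy T S A₂))
    -- the data: independent trajectories sampled with the behavior policy profile
    {Ω : Type*} [MeasurableSpace Ω] (P : Measure Ω) [IsProbabilityMeasure P]
    (X : ℕ → Ω → Traj T S A₁ A₂) (hX_meas : ∀ i, Measurable (X i))
    (hX_indep : iIndepFun X P) (hX_law : ∀ i, P.map (X i) = G.trajLaw πb)
    -- the random partitions into folds and the cross-fitted estimators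
    (F : (n : ℕ) → Ω → Fin n → Fin K) (hF_meas : ∀ n, Measurable (F n))
    (hF_bal : ∀ n, ∀ᵐ ω ∂P, IsBalanced (F n ω))
    (hF_indep : ∀ n, IndepFun (F n) (fun ω (i : Fin n) => X i ω) P)
    (est : Estimator K T S A₁ A₂) (h_est : est.IsMeasurable)
    -- overlap and bounded rewards
    (Cη Rmax : ℝ)
    (h_overlap : ∀ π ∈ C₁ ×ˢ C₂, ∀ (t : Fin T) s a b,
      Profile.p π t s a b ≤ Cη * πb.p t s a b)
    (h_reward : ∀ s a b, ∀ᵐ r ∂(G.PR s a b), |r| ≤ Rmax)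
    -- bounded estimators
    (h_bound : ∀ n k, ∀ᵐ ω ∂P, ∀ π ∈ C₁ ×ˢ C₂, ∀ (t : Fin T) s a b,
      0 < G.toModel.occ πb t s a b →
        0 ≤ (est.fit (F n ω) (fun i => X i ω) k).ratio π t s a b ∧
        (est.fit (F n ω) (fun i => X i ω) k).ratio π t s a b ≤ Cη ^ ((t : ℕ) + 1) ∧
        |(est.fit (F n ω) (fun i => X i ω) k).Q G.γ π t s a b| ≤ ((T : ℝ) - t) * Rmax)
    -- covering numbers
    (h_cover : HasEntropyBound (C₁ ×ˢ C₂))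
    -- convergence rates of the estimated model
    (α₁ α₂ : ℝ) (hα₁ : 0 < α₁) (hα₂ : 0 < α₂) (hα : 1 / 2 ≤ α₁ + α₂)
    (h_rateQ : ∀ (k : Fin K) (t t' : Fin T), t ≤ t' →
      ∀ (s : Fin T → S) (a : Fin T → A₁) (b : Fin T → A₂),
        0 < G.toModel.occ πb t (s t) (a t) (b t) →
        (∀ l, t < l → l ≤ t' → 0 < πb.p l (s l) (a l) (b l)) →
        MeanSquareLittleO P (fun n ω =>
          (est.fit (F n ω) (fun i => X i ω) k).rewardPath t t' s a b
            - G.toModel.rewardPath t t' s a b) α₁)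
    (h_rateμ : ∀ (k : Fin K) (t : Fin T),
      ∀ (s : Fin T → S) (a : Fin T → A₁) (b : Fin T → A₂),
        0 < G.toModel.occ πb t (s t) (a t) (b t) →
        (∀ l, l < t → 0 < πb.p l (s l) (a l) (b l)) →
        MeanSquareLittleO P (fun n ω =>
          (est.fit (F n ω) (fun i => X i ω) k).pathProb t s a b
              / (est.fit (F n ω) (fun i => X i ω) k).pb t (s t) (a t) (b t)
            - G.toModel.pathProb t s a b / G.toModel.occ πb t (s t) (a t) (b t)) α₂)
    -- a profile in the class of lowest exploitability, and the selected profiles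
    (πstar : Profile T S A₁ A₂)
    (h_star : IsSelected (exploitability G.value C₁ C₂) C₁ C₂ πstar)
    (πhat : ℕ → Ω → Profile T S A₁ A₂)
    (h_hat : ∀ n, ∀ᵐ ω ∂P, IsSelected
      (exploitability (est.valueDRL G.γ (F n ω) fun i => X i ω) C₁ C₂) C₁ C₂ (πhat n ω)) :
    ∃ C : ℝ, 0 < C ∧ ∀ δ : ℝ, 0 < δ → ∃ N : ℕ, 0 < N ∧ ∀ n : ℕ, N ≤ n →
      P {ω | ¬ (exploitability G.value C₁ C₂ (πhat n ω) - exploitability G.value C₁ C₂ πstar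
          ≤ C * (entropyIntegral (C₁ ×ˢ C₂) + √(Real.log (1 / δ)))
            * √(G.varianceDRL πb (C₁ ×ˢ C₂) / n))} ≤ ENNReal.ofReal (2 * δ) ∧
      (HasBestResponses G.value C₁ C₂ →
        P {ω | ¬ (exploitability G.value Set.univ Set.univ (πhat n ω)
              - exploitability G.value Set.univ Set.univ πstar
            ≤ C * (entropyIntegral (C₁ ×ˢ C₂) + √(Real.log (1 / δ)))
              * √(G.varianceDRL πb (C₁ ×ˢ C₂) / n))} ≤ ENNReal.ofReal (2 * δ)) := by
  have hprob : IsProbabilityMeasure (G.trajLaw πb) := by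
    rw [← hX_law 0]
    exact Measure.isProbabilityMeasure_map (hX_meas 0).aemeasurable
  have hS : Nonempty S := by
    by_contra h
    rw [not_nonempty_iff] at h
    have := G.PI_sum
    simp at this
  have hfin : (C₁ ×ˢ C₂).Finite := h_cover.finite
  have hC₁ : C₁.Finite := hfin.of_prod_left ⟨_, h_star.1.2⟩
  have hC₂ : C₂.Finite := hfin.of_prod_right ⟨_, h_star.1.1⟩
  set κ := entropyIntegral (C₁ ×ˢ C₂) with hκ
  set V := G.varianceDRL πb (C₁ ×ˢ C₂) with hVdef
  set m : ℝ := √((Fintype.card S ^ T : ℕ) : ℝ) with hm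
  have hm0 : 0 ≤ m := Real.sqrt_nonneg _
  have hκ0 : 0 ≤ κ := entropyIntegral_nonneg _
  have hV0 : 0 ≤ V := G.varianceDRL_nonneg _
  suffices hmain : ∀ δ : ℝ, 0 < δ → ∃ N : ℕ, 0 < N ∧ ∀ n : ℕ, N ≤ n →
      P {ω | ¬ (πhat n ω ∈ C₁ ×ˢ C₂ ∧
        exploitability G.value C₁ C₂ (πhat n ω) - exploitability G.value C₁ C₂ πstar ≤
          (12 + 16 * m) * (κ + √(Real.log (1 / δ))) * √(V / n))} ≤ ENNReal.ofReal (2 * δ) by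
    refine ⟨12 + 16 * m, by positivity, fun δ hδ => ?_⟩
    obtain ⟨N, hN, h⟩ := hmain δ hδ
    refine ⟨N, hN, fun n hn => ⟨le_trans (measure_mono ?_) (h n hn),
      fun hbest => le_trans (measure_mono ?_) (h n hn)⟩⟩
    · exact fun ω hω h' => hω h'.2
    · intro ω hω h'
      refine hω ?_
      rw [hbest.exploitability_univ h'.1, hbest.exploitability_univ h_star.1]
      exact h'.2
  intro δ hδ
  rcases le_or_gt (1 / 2) δ with hδ2 | hδ2
  · refine ⟨1, one_pos, fun n _ => prob_le_one.trans ?_⟩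
    rw [← ENNReal.ofReal_one]
    exact ENNReal.ofReal_le_ofReal (by linarith)
  by_cases hdeg : V = 0 ∨ (C₁ ×ˢ C₂).ncard ≤ 1
  · -- all profiles of the class have the same exploitability
    have hconst : ∀ π ∈ C₁ ×ˢ C₂, exploitability G.value C₁ C₂ π =
        exploitability G.value C₁ C₂ πstar := by
      rcases hdeg with h0 | h1
      · have hv : ∀ π ∈ C₁ ×ˢ C₂, G.value π = 0 := fun π hπ => by
          have := (value_sq_le (πb := πb) h_reward).trans (G.le_varianceDRL (πb := πb) hfin hπ)
          rw [← hVdef, h0] at this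
          exact pow_eq_zero_iff two_ne_zero |>.1 (le_antisymm this (sq_nonneg _))
        intro π hπ
        rw [exploitability_eq_zero hv hπ, exploitability_eq_zero hv h_star.1]
      · intro π hπ
        rw [(Set.ncard_le_one hfin).1 h1 π hπ πstar h_star.1]
    refine ⟨1, one_pos, fun n _ => le_trans (le_of_eq (measure_mono_null ?_
      (ae_iff.1 (h_hat n)))) zero_le⟩
    intro ω hω hsel
    refine hω ⟨hsel.1, ?_⟩
    rw [hconst _ hsel.1, sub_self]
    positivity
  push Not at hdeg
  obtain ⟨hVne, hcard⟩ := hdeg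
  have hVpos : 0 < V := hV0.lt_of_ne' hVne
  set M : ℝ := ((C₁ ×ˢ C₂).ncard : ℝ) with hM
  have hM2 : (2 : ℝ) ≤ M := by
    rw [hM]
    exact_mod_cast hcard
  have hlogM : Real.log 2 ≤ Real.log M := Real.log_le_log (by norm_num) hM2
  have hlog2 : 0 < Real.log 2 := Real.log_pos (by norm_num)
  have hent : √(Real.log M) ≤ m * κ := sqrt_log_ncard_le_entropyIntegral hfin
  have hκpos : 0 < κ := by
    have h1 : 0 < m * κ := (Real.sqrt_pos.2 (hlog2.trans_le hlogM)).trans_le hent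
    exact pos_of_mul_pos_right h1 hm0
  have hδlog : 0 ≤ Real.log (1 / δ) := Real.log_nonneg (by rw [le_div_iff₀ hδ]; linarith)
  set l := √(Real.log (1 / δ)) with hl
  -- the union bound over the class costs `log M`, which the entropy integral controls
  set L := Real.log (2 * M / δ) with hLdef
  have hLsplit : L = Real.log 2 + Real.log M + Real.log (1 / δ) := by
    rw [hLdef, ← Real.log_mul (by norm_num) (by positivity),
      ← Real.log_mul (by positivity) (by positivity), mul_one_div]
  have hL0 : 0 ≤ L := by linarith
  have hLle : √L ≤ 2 * m * κ + l := by
    have h1 : √L ≤ 2 * √(Real.log M) + l := by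
      refine Real.sqrt_le_iff.2 ⟨by positivity, ?_⟩
      have e1 := Real.sq_sqrt (hlog2.le.trans hlogM)
      have e2 := Real.sq_sqrt hδlog
      have e3 : 0 ≤ √(Real.log M) * l := by positivity
      nlinarith
    linarith
  have hexp : M * (2 * Real.exp (-L)) = δ := by
    rw [Real.exp_neg, hLdef, Real.exp_log (by positivity)]
    field_simp
  have hAC : ∀ π ∈ C₁ ×ˢ C₂, Profile.AbsCont π πb := fun π hπ => Profile.absCont_of_le (h_overlap π hπ)
  have hcardM : ((hfin.toFinset.card : ℕ) : ℝ) = M := by rw [hM, Set.ncard_eq_toFinset_card _ hfin]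
  have horacle := (eventually_all_finite hfin).2 fun π hπ => eventually_measure_oracle_le (π := π)
    h_reward hX_meas hX_indep hX_law hVpos (G.le_varianceDRL (πb := πb) hfin hπ) hL0
  have hnuis := tendsto_finsetSum hfin.toFinset fun π hπ => tendsto_nuisance_of_rates
    h_reward hX_meas hX_indep hX_law hF_meas hF_indep h_est (hAC π (by simpa using hπ))
    (fun n k => (h_bound n k).mono fun ω hω t s a b h0 =>
      ⟨(hω π (by simpa using hπ) t s a b h0).1, (hω π (by simpa using hπ) t s a b h0).2.1⟩)
    hα₁.le hα₂.le hα h_rateQ h_rateμ (mul_pos hκpos (Real.sqrt_pos.2 hVpos))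
  simp only [Finset.sum_const_zero] at hnuis
  obtain ⟨N, hN⟩ := eventually_atTop.1 (horacle.and
    (hnuis.eventually_le_const (ENNReal.ofReal_pos.2 hδ)))
  refine ⟨N + 1, Nat.succ_pos _, fun n hn => ?_⟩
  obtain ⟨hor, hnu⟩ := hN n (by omega)
  set A : Profile T S A₁ A₂ → Set Ω := fun π => {ω | 2 * √(n * V * L) ≤
    |∑ i : Fin n, (drlScore G.toModel G.γ π (G.ratio πb π) (X i ω) - G.value π)|} with hA
  set B : Profile T S A₁ A₂ → Set Ω := fun π => {ω | κ * √V ≤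
    √n * |est.valueDRL G.γ (F n ω) (fun i => X i ω) π -
      (n : ℝ)⁻¹ * ∑ i : Fin n, drlScore G.toModel G.γ π (G.ratio πb π) (X i ω)|} with hB
  have hsub : {ω | ¬ (πhat n ω ∈ C₁ ×ˢ C₂ ∧
      exploitability G.value C₁ C₂ (πhat n ω) - exploitability G.value C₁ C₂ πstar ≤
        (12 + 16 * m) * (κ + l) * √(V / n))} ⊆
      {ω | ¬ IsSelected (exploitability (est.valueDRL G.γ (F n ω) fun i => X i ω) C₁ C₂)
        C₁ C₂ (πhat n ω)} ∪ ((⋃ π ∈ hfin.toFinset, A π) ∪ ⋃ π ∈ hfin.toFinset, B π) := by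
    intro ω hω
    by_contra hcon
    simp only [Set.mem_union, Set.mem_iUnion, Set.Finite.mem_toFinset, not_or, not_exists,
      Set.mem_ofPred_eq, not_not, hA, hB, not_le] at hcon
    obtain ⟨hsel, hcA, hcB⟩ := hcon
    refine hω ⟨hsel.1, regret_le_of_deviation hC₁ hC₂ (by omega) hV0 hLle (Real.sqrt_nonneg _) hm0
      hκ0 (o := fun π => ∑ i : Fin n, drlScore G.toModel G.γ π (G.ratio πb π) (X i ω)) hcB
      (fun π hπ => ?_) hsel h_star.1⟩
    have := hcA π hπ
    rwa [Finset.sum_sub_distrib, Finset.sum_const, Finset.card_univ, Fintype.card_fin,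
      nsmul_eq_mul] at this
  calc _ ≤ P _ + (P (⋃ π ∈ hfin.toFinset, A π) + P (⋃ π ∈ hfin.toFinset, B π)) :=
        (measure_mono hsub).trans ((measure_union_le _ _).trans
          (add_le_add le_rfl (measure_union_le _ _)))
    _ ≤ 0 + (ENNReal.ofReal δ + ENNReal.ofReal δ) := by
        refine add_le_add (ae_iff.1 (h_hat n)).le (add_le_add ?_ ?_)
        · refine (measure_biUnion_finset_le _ _).trans ((Finset.sum_le_sum fun π hπ =>
            hor π (by simpa using hπ)).trans ?_)
          rw [Finset.sum_const, nsmul_eq_mul, ← ENNReal.ofReal_natCast,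
            ← ENNReal.ofReal_mul (Nat.cast_nonneg _), hcardM, hexp]
        · exact (measure_biUnion_finset_le _ _).trans hnu
    _ = ENNReal.ofReal (2 * δ) := by
        rw [zero_add, ← ENNReal.ofReal_add hδ.le hδ.le, two_mul]
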